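/- Let $\mu=(\mu_0,\mu_1)$ be a pair of probability distributions on $\{0,1,2,\dots\}$ with means $m_0,m_1$. Indices of types are taken modulo $2$. Assume that $\mu$ is nondegenerate, i.e. $\mu_0(1)+\mu_1(1)<2$, critical, i.e. $m_0m_1=1$, and has exponential moments, i.e. for each $i\in\{0,1\}$ there is $a>0$ with $\sum_{k\ge 0}e^{ak}\mu_i(k)<\infty$. For $i\in\{0,1\}$ let $P^{(i)}$ be the law of the alternating two-type Galton–Watson tree $T$ with root of type $i$: a vertex at height $h$ has type $i+h \bmod 2$, and the numbers of children of the vertices are independent, those of type $j$ having law $\mu_j$. Let $P^{(i)}_\infty$ be the law of the forest $F$ whose tree components are an infinite sequence of independent trees with law $P^{(i)}$. For a tree $\mathbf t$ (resp. forest), let $\mathbf t^{(j)}$ be the set of its vertices of type $j$, let $u^{(j)}(0)\prec u^{(j)}(1)\prec\cdots$ be the vertices of type $j$ listed in depth-first (lexicographical) order $\prec$ (in a forest, the tree components are visited one after the other), and let $$G^{(j)}_{\mathbf t}(k)=\#\{u\in\mathbf t:\ u\prec u^{(j)}(k)\},\qquad 0\le k\le \#\mathbf t^{(j)}-1,$$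 with the convention $G^{(j)}_{\mathbf t}(\#\mathbf t^{(j)})=\#\mathbf t-1$ for a finite tree. Then for every $\gamma>0$ there exists $\varepsilon>0$ such that for all $i,j\in\{0,1\}$ and every $n$ large enough, $$P^{(i)}_\infty\Big(\sup_{0\le k\le n}\big|G^{(j)}_F(k)-(1+m_j)k\big|>n^{1/2+\gamma}\Big)\le \exp(-n^{\varepsilon}),$$ and, for all $i,j,c\in\{0,1\}$ and every $n$ large enough, $$P^{(i)}\Big(\sup_{0\le k\le \#T^{(j)}}\big|G^{(j)}_T(k)-(1+m_j)k\big|>n^{1/2+\gamma}\ \Big|\ \#T^{(c)}=n\Big)\le \exp(-n^{\varepsilon}),$$ where the conditional probability is taken to be $0$ if $P^{(i)}(\#T^{(c)}=n)=0$. -/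

import Mathlib

open MeasureTheory ProbabilityTheory Filter

namespace TwoTypeGW

/-- Finite words of nonnegative integers, used as vertices of plane trees.  The letter `a` stands
for the `(a + 1)`-st child, so that the children of `u` in a tree are `u ++ [0], u ++ [1], …`, the
root is `[]`, and the height of `u` is `u.length`.  The order `<` on `List ℕ` is the
lexicographical (depth-first) order, for which a strict prefix precedes its extensions. -/
abbrev Word : Type := List ℕ

/-! ### Trees and forests as sets of words, and types of vertices -/

/-- The fringe set of `S` at `u`: the words `v` with `uv ∈ S`. -/
def fringe (S : Set Word) (u : Word) : Set Word := {v | u ++ v ∈ S}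

/-- The forest with tree components `t 0, t 1, …`: the union over `k` of the sets `k (t k)`. -/
def forestOf (t : ℕ → Set Word) : Set Word := {w | ∃ k, ∃ v ∈ t k, w = k :: v}

/-- The vertices of type `j` of a tree `t` whose root has type `i`; types alternate between
generations. -/
def treeType (i j : ZMod 2) (t : Set Word) : Set Word := {u ∈ t | i + (u.length : ZMod 2) = j}

/-- The vertices of type `j` of a forest `f` all of whose tree components have a root of
type `i`. -/
def forestType (i j : ZMod 2) (f : Set Word) : Set Word :=
  forestOf fun k => treeType i j (fringe f [k])

/-! ### Depth-first order -/

/-- `u` is the vertex `u(k)` of rank `k` (starting from rank `0`) when the elements of `A` are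
listed in depth-first order. -/
def IsNth (A : Set Word) (k : ℕ) (u : Word) : Prop := u ∈ A ∧ {v ∈ A | v < u}.encard = k

open Classical in
/-- The number of elements of `S` (a tree or forest) that strictly precede the element of rank `k`
of `A ⊆ S`.  When `A` has only `k` elements, the value is `#S - 1` by convention. -/
noncomputable def visitedBefore (S A : Set Word) (k : ℕ) : ℕ :=
  if ∃ u, IsNth A k u then {v ∈ S | ∃ u, IsNth A k u ∧ v < u}.ncard else S.ncard - 1

/-- The process `G_t^{(j)}` of a tree `t` with root of type `i`. -/
noncomputable def treeG (i j : ZMod 2) (t : Set Word) (k : ℕ) : ℕ :=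
  visitedBefore t (treeType i j t) k

/-- The process `G_f^{(j)}` of a forest `f` with roots of type `i`. -/
noncomputable def forestG (i j : ZMod 2) (f : Set Word) (k : ℕ) : ℕ :=
  visitedBefore f (forestType i j f) k

/-! ### Offspring distributions -/

/-- The mean of a distribution on the nonnegative integers. -/
noncomputable def mean (ν : PMF ℕ) : ℝ := ∑' k : ℕ, (k : ℝ) * (ν k).toReal

/-- The distribution `ν` has some exponential moment: `⟨ν, exp(a ·)⟩ < ∞` for some `a > 0`. -/
def HasExpMoment (ν : PMF ℕ) : Prop :=
  ∃ a : ℝ, 0 < a ∧ Summable fun k : ℕ => Real.exp (a * k) * (ν k).toReal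

/-- The pair of offspring distributions is not `(δ_1, δ_1)`. -/
def Nondegenerate (μ : ZMod 2 → PMF ℕ) : Prop := μ 0 1 + μ 1 1 < 2

/-- The pair of offspring distributions is critical. -/
def Critical (μ : ZMod 2 → PMF ℕ) : Prop := mean (μ 0) * mean (μ 1) = 1

/-! ### Galton-Watson trees and forests -/

/-- The tree in which every vertex `u` has `X u` children. -/
def treeOf (X : Word → ℕ) : Set Word := {u | ∀ (p : Word) (a : ℕ), p ++ [a] <+: u → a < X p}

/-- The law `P^{(i)}` of the alternating two-type Galton-Watson tree with root of type `i`: the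
numbers of children are independent, with distribution `μ (i + |u|)` for the vertex `u`.
Sets of words carry the product σ-algebra. -/
noncomputable def gwTree (μ : ZMod 2 → PMF ℕ) (i : ZMod 2) : Measure (Set Word) :=
  (Measure.infinitePi fun u : Word => (μ (i + (u.length : ZMod 2))).toMeasure).map treeOf

/-- The law `P_∞^{(i)}` of the forest whose tree components form an infinite sequence of
independent trees with law `P^{(i)}`. -/
noncomputable def gwForest (μ : ZMod 2 → PMF ℕ) (i : ZMod 2) : Measure (Set Word) :=
  (Measure.infinitePi fun _ : ℕ => gwTree μ i).map forestOf

theorem measurable_treeOf : Measurable treeOf := by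
  refine measurable_set_iff.2 fun u => ?_
  change Measurable fun X : Word → ℕ => ∀ (p : Word) (a : ℕ), p ++ [a] <+: u → a < X p
  refine Measurable.forall fun p => Measurable.forall fun a => ?_
  refine Measurable.imp measurable_const ?_
  exact (measurable_of_countable fun m : ℕ => a < m).comp (measurable_pi_apply p)

theorem measurable_forestOf : Measurable forestOf := by
  refine measurable_set_iff.2 fun w => ?_
  change Measurable fun t : ℕ → Set Word => ∃ k, ∃ v, v ∈ t k ∧ w = k :: v
  refine Measurable.exists fun k => Measurable.exists fun v => ?_
  exact ((measurable_set_mem v).comp (measurable_pi_apply k)).and measurable_const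

instance isProbabilityMeasure_gwTree (μ : ZMod 2 → PMF ℕ) (i : ZMod 2) :
    IsProbabilityMeasure (gwTree μ i) :=
  Measure.isProbabilityMeasure_map measurable_treeOf.aemeasurable

instance isProbabilityMeasure_gwForest (μ : ZMod 2 → PMF ℕ) (i : ZMod 2) :
    IsProbabilityMeasure (gwForest μ i) :=
  Measure.isProbabilityMeasure_map measurable_forestOf.aemeasurable

end TwoTypeGW

/-! The forest is explored in depth-first order with a stack of pending vertices. The next vertex
depends only on offspring numbers already revealed, so its own offspring number is fresh. Hence, for
each type `j`, the offspring collected from the visited vertices of type `j`, minus `m j` times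
their number, is a sum of centred increments with an exponential supermartingale. With Laplace
parameter of order `n^(-1/2)`, these fluctuations stay of order `n^(1/2+γ)` over order `n` steps, up
to a stretched exponentially small probability (`measure_exists_abs_offspringCount_gt`).

The rest of the forest estimate is deterministic (`abs_sub_visitCount_le`). Each visited or pending
vertex is a root or a child of a visited vertex, which gives one balance equation per type. Since `m
0 * m 1 = 1`, a suitable combination of the two equations eliminates the visit counts and expresses
a weighted stack size as the number of roots plus fluctuations. Each new root is taken when the
stack is empty, so the number of roots is itself of the order of the fluctuations; hence so is the
stack, and the visits split between the two types in the right proportion.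

For a conditioned tree, the first tree of the forest has the unconditioned law, and the forest
estimate is divided by the probability that `#T^(c) = n`. It suffices that this probability is zero
or at least `exp(-n^ρ)` for every fixed `ρ > 0` and large `n` (`eventually_gwTree_encard_ge`).
Keeping only the vertices of type `c` gives a one-type critical tree whose offspring law is the
grandchild law `ν`; the count becomes a first passage time, and the cycle lemma compares its law
with that of a sum of `n` independent variables.

The pointwise lower bound for that sum avoids a sharp local limit theorem. Conditionally on the sum,
a value `a` appears about `n ν(a)` times by Hoeffding's inequality. This shows that replacing one
`a` by one `b` hardly changes the point probability, so neighbouring points of the lattice have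
nearly equal probabilities. Concentration provides one point near the mean with probability at least
`1/(6n)`, and slightly more than `n^(1/2)` shifts carry this bound to every admissible point near
the mean, at a subexponential cost. -/

namespace TwoTypeGW

/-! ### Depth-first exploration of a forest -/

/-- The forest in which every vertex `u` has `Y u` children. -/
def forestSet (Y : Word → ℕ) : Set Word :=
  {w | w ≠ [] ∧ ∀ (p : Word) (a : ℕ), p ≠ [] → p ++ [a] <+: w → a < Y p}

/-- The first `n` children of `u`. -/
def children (u : Word) (n : ℕ) : List Word := (List.range n).map fun a => u ++ [a]

theorem mem_children {u w : Word} {n : ℕ} : w ∈ children u n ↔ ∃ a < n, u ++ [a] = w := by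
  simp [children]

/-- The next vertex visited by the exploration whose stack is `q.1` and whose next unused root
is `[q.2]`. -/
def current : List Word × ℕ → Word
  | (u :: _, _) => u
  | ([], r) => [r]

/-- The state of the exploration after the visit of a vertex with `a` children. -/
def advance (a : ℕ) : List Word × ℕ → List Word × ℕ
  | (u :: L, r) => (children u a ++ L, r)
  | ([], r) => (children [r] a, r + 1)

/-- The state of the depth-first exploration after `s` steps. -/
def state (Y : Word → ℕ) : ℕ → List Word × ℕ
  | 0 => ([], 0)
  | s + 1 => advance (Y (current (state Y s))) (state Y s)

/-- The vertex visited at step `s`. -/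
def visit (Y : Word → ℕ) (s : ℕ) : Word := current (state Y s)

/-- All descendants of `u` precede all descendants of `v`. -/
def Before (u v : Word) : Prop := ∀ x y : Word, u ++ x < v ++ y

theorem lt_append_cons (u : Word) (a : ℕ) (x : Word) : u < u ++ a :: x := by
  induction u with
  | nil => simp
  | cons b u ih => simpa using ih

theorem append_lt_append_iff (u x y : Word) : u ++ x < u ++ y ↔ x < y := by
  induction u with
  | nil => simp
  | cons b u ih => simpa using ih

theorem le_of_isPrefix {u w : Word} (h : u <+: w) : u ≤ w := by
  obtain ⟨x, rfl⟩ := h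
  cases x with
  | nil => simp
  | cons a x => exact (lt_append_cons u a x).le

theorem Before.lt {u v : Word} (h : Before u v) : u < v := by simpa using h [] []

theorem Before.append {u v : Word} (h : Before u v) (x : Word) : Before (u ++ x) v := by
  intro y z; simpa using h (x ++ y) z

theorem before_siblings (u : Word) {a b : ℕ} (h : a < b) : Before (u ++ [a]) (u ++ [b]) := by
  intro x y
  simp only [List.append_assoc, append_lt_append_iff]
  simp [List.cons_lt_cons_iff, h]

theorem before_roots {a b : ℕ} (h : a < b) : Before [a] [b] := by
  simpa using before_siblings [] h

/-- The frontier of a state. -/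
def frontier (q : List Word × ℕ) : Set Word := {u | u ∈ q.1 ∨ ∃ k, q.2 ≤ k ∧ u = [k]}

theorem current_mem_frontier (q : List Word × ℕ) : current q ∈ frontier q := by
  rcases q with ⟨_ | ⟨u, L⟩, r⟩
  · exact Or.inr ⟨r, le_rfl, rfl⟩
  · exact Or.inl (by simp [current])

/-- The frontier is listed in depth-first order. -/
def SortedState (q : List Word × ℕ) : Prop :=
  q.1.Pairwise Before ∧ ∀ u ∈ q.1, ∀ k, q.2 ≤ k → Before u [k]

theorem SortedState.current_before {q : List Word × ℕ} (h : SortedState q) {u : Word}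
    (hu : u ∈ frontier q) : u = current q ∨ Before (current q) u := by
  rcases q with ⟨_ | ⟨v, L⟩, r⟩
  · rcases hu with hu | ⟨k, hk, rfl⟩
    · simp at hu
    · rcases (show r ≤ k from hk).eq_or_lt with rfl | hk
      · exact Or.inl rfl
      · exact Or.inr (before_roots hk)
  · rcases hu with hu | ⟨k, hk, rfl⟩
    · rcases List.mem_cons.1 hu with rfl | hu
      · exact Or.inl rfl
      · exact Or.inr ((List.pairwise_cons.1 h.1).1 u hu)
    · exact Or.inr (h.2 v (by simp) k hk)

theorem pairwise_children (u : Word) (n : ℕ) : (children u n).Pairwise Before := by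
  refine List.Pairwise.map _ (R := (· < ·)) (fun a b hab => before_siblings u hab) ?_
  exact List.pairwise_lt_range

theorem SortedState.advance {q : List Word × ℕ} (h : SortedState q) (a : ℕ) :
    SortedState (advance a q) := by
  rcases q with ⟨_ | ⟨v, L⟩, r⟩
  · refine ⟨pairwise_children _ _, fun u hu k hk => ?_⟩
    obtain ⟨b, -, rfl⟩ := mem_children.1 hu
    exact (before_roots (Nat.lt_of_succ_le hk)).append _
  · have h1 := List.pairwise_cons.1 h.1
    refine ⟨List.pairwise_append.2 ⟨pairwise_children _ _, h1.2, fun u hu w hw => ?_⟩,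
      fun u hu k hk => ?_⟩
    · obtain ⟨b, -, rfl⟩ := mem_children.1 hu
      exact (h1.1 w hw).append _
    · rcases List.mem_append.1 hu with hu | hu
      · obtain ⟨b, -, rfl⟩ := mem_children.1 hu
        exact (h.2 v (by simp) k hk).append _
      · exact h.2 u (List.mem_cons_of_mem _ hu) k hk

theorem mem_frontier_advance {q : List Word × ℕ} {a : ℕ} {u : Word}
    (h : u ∈ frontier (advance a q)) :
    (∃ b < a, current q ++ [b] = u) ∨ u ∈ frontier q := by
  rcases q with ⟨_ | ⟨v, L⟩, r⟩
  · rcases h with hu | ⟨k, hk, rfl⟩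
    · exact Or.inl (mem_children.1 hu)
    · exact Or.inr (Or.inr ⟨k, (Nat.le_succ r).trans hk, rfl⟩)
  · rcases h with hu | hu
    · rcases List.mem_append.1 hu with hu | hu
      · exact Or.inl (mem_children.1 hu)
      · exact Or.inr (Or.inl (List.mem_cons_of_mem _ hu))
    · exact Or.inr (Or.inr hu)

theorem child_mem_frontier_advance (q : List Word × ℕ) {a b : ℕ} (h : b < a) :
    current q ++ [b] ∈ frontier (advance a q) := by
  rcases q with ⟨_ | ⟨v, L⟩, r⟩
  · exact Or.inl (mem_children.2 ⟨b, h, rfl⟩)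
  · exact Or.inl (List.mem_append_left _ (mem_children.2 ⟨b, h, rfl⟩))

theorem frontier_advance_of_ne {q : List Word × ℕ} (a : ℕ) {u : Word}
    (hu : u ∈ frontier q) (hne : u ≠ current q) : u ∈ frontier (advance a q) := by
  rcases q with ⟨_ | ⟨v, L⟩, r⟩
  · rcases hu with hu | ⟨k, hk, rfl⟩
    · simp at hu
    · refine Or.inr ⟨k, ?_, rfl⟩
      have : k ≠ r := fun h => hne (by simp [current, h])
      change r + 1 ≤ k
      change r ≤ k at hk
      omega
  · rcases hu with hu | hu
    · rcases List.mem_cons.1 hu with rfl | hu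
      · exact absurd rfl hne
      · exact Or.inl (List.mem_append_right _ hu)
    · exact Or.inr hu

theorem sortedState_state (Y : Word → ℕ) (s : ℕ) : SortedState (state Y s) := by
  induction s with
  | zero => exact ⟨List.Pairwise.nil, by simp [state]⟩
  | succ s ih => exact ih.advance _

theorem isPrefix_of_mem_frontier_zero {Y : Word → ℕ} {w : Word} (hw : w ∈ forestSet Y) :
    ∃ u ∈ frontier (state Y 0), u <+: w := by
  rcases w with _ | ⟨k, v⟩
  · exact absurd rfl hw.1
  · exact ⟨[k], Or.inr ⟨k, Nat.zero_le _, rfl⟩, ⟨v, rfl⟩⟩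

theorem append_mem_forestSet {Y : Word → ℕ} {u : Word} {a : ℕ} (hu : u ∈ forestSet Y)
    (ha : a < Y u) : u ++ [a] ∈ forestSet Y := by
  refine ⟨by simp, fun p b hp h => ?_⟩
  rcases List.prefix_concat_iff.1 h with h | h
  · have := List.append_inj' h rfl
    simp only [List.cons.injEq, and_true] at this
    rw [this.1, this.2]; exact ha
  · exact hu.2 p b hp h

theorem root_mem_forestSet (Y : Word → ℕ) (k : ℕ) : [k] ∈ forestSet Y := by
  refine ⟨by simp, fun p a hp h => absurd (h.length_le) ?_⟩
  have : 0 < p.length := List.length_pos_of_ne_nil hp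
  simp; omega

theorem frontier_subset (Y : Word → ℕ) (s : ℕ) : frontier (state Y s) ⊆ forestSet Y := by
  induction s with
  | zero =>
    rintro u (hu | ⟨k, -, rfl⟩)
    · simp [state] at hu
    · exact root_mem_forestSet Y k
  | succ s ih =>
    intro u hu
    rcases mem_frontier_advance hu with ⟨b, hb, rfl⟩ | hu
    · exact append_mem_forestSet (ih (current_mem_frontier _)) hb
    · exact ih hu

theorem visit_mem_forestSet (Y : Word → ℕ) (s : ℕ) : visit Y s ∈ forestSet Y :=
  frontier_subset Y s (current_mem_frontier _)

/-- The frontier contains all unused roots, so the claim holds at time zero. When the pending prefix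
`u` of `w` is visited, either `w = u` or the child of `u` on the way to `w` enters the frontier. -/
theorem forestSet_cover (Y : Word → ℕ) (s : ℕ) {w : Word} (hw : w ∈ forestSet Y) :
    (∃ s' < s, visit Y s' = w) ∨ ∃ u ∈ frontier (state Y s), u <+: w := by
  induction s with
  | zero => exact Or.inr (isPrefix_of_mem_frontier_zero hw)
  | succ s ih =>
    rcases ih with ⟨s', hs', h⟩ | ⟨u, hu, h⟩
    · exact Or.inl ⟨s', hs'.trans (Nat.lt_succ_self s), h⟩
    · by_cases hc : u = current (state Y s)
      · obtain ⟨x, rfl⟩ := h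
        rcases x with _ | ⟨a, x⟩
        · exact Or.inl ⟨s, Nat.lt_succ_self s, by rw [List.append_nil]; exact hc.symm⟩
        · have hpre : u ++ [a] <+: u ++ a :: x := ⟨x, by simp⟩
          refine Or.inr ⟨u ++ [a], ?_, hpre⟩
          have ha : a < Y u := hw.2 u a (frontier_subset Y s hu).1 hpre
          subst hc
          exact child_mem_frontier_advance _ ha
      · exact Or.inr ⟨u, frontier_advance_of_ne _ hu hc, h⟩

theorem visit_lt_of_mem_frontier_succ (Y : Word → ℕ) (s : ℕ) {u : Word}
    (hu : u ∈ frontier (state Y (s + 1))) : visit Y s < u := by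
  have hq := sortedState_state Y s
  unfold visit
  rw [state] at hu
  generalize state Y s = q at *
  rcases q with ⟨_ | ⟨v, L⟩, r⟩
  · rcases hu with hu | ⟨k, hk, rfl⟩
    · obtain ⟨b, -, rfl⟩ := mem_children.1 hu
      exact lt_append_cons _ _ _
    · exact (before_roots (Nat.lt_of_succ_le hk)).lt
  · rcases hu with hu | ⟨k, hk, rfl⟩
    · rcases List.mem_append.1 hu with hu | hu
      · obtain ⟨b, -, rfl⟩ := mem_children.1 hu
        exact lt_append_cons _ _ _
      · exact ((List.pairwise_cons.1 hq.1).1 u hu).lt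
    · exact (hq.2 v (by simp) k hk).lt

theorem visit_strictMono (Y : Word → ℕ) : StrictMono (visit Y) :=
  strictMono_nat_of_lt_succ fun s => visit_lt_of_mem_frontier_succ Y s (current_mem_frontier _)

/-- An unvisited vertex descends from an element of the frontier, and the current vertex is the
least element of the frontier. -/
theorem lt_visit_iff (Y : Word → ℕ) (s : ℕ) {w : Word} (hw : w ∈ forestSet Y) :
    w < visit Y s ↔ ∃ s' < s, visit Y s' = w := by
  constructor
  · intro h
    rcases forestSet_cover Y s hw with h' | ⟨u, hu, hp⟩
    · exact h'
    · have h1 : visit Y s ≤ u := by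
        rcases (sortedState_state Y s).current_before hu with rfl | hb
        · exact le_rfl
        · exact hb.lt.le
      exact absurd (h1.trans (le_of_isPrefix hp)) (not_le.2 h)
  · rintro ⟨s', hs', rfl⟩
    exact visit_strictMono Y hs'

/-! ### Counts of visited and pending vertices by type. -/

/-- The type of a word when the empty word has type `e`. -/
def wordType (e : ZMod 2) (w : Word) : ZMod 2 := e + (w.length : ZMod 2)

open Classical in
/-- The number of vertices of type `j` visited in the first `s` steps. -/
noncomputable def visitCount (e j : ZMod 2) (Y : Word → ℕ) (s : ℕ) : ℕ :=
  Nat.count (fun s => wordType e (visit Y s) = j) s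

/-- The number of children of the vertices of type `j` visited in the first `s` steps. -/
def offspringCount (e j : ZMod 2) (Y : Word → ℕ) (s : ℕ) : ℕ :=
  ∑ l ∈ Finset.range s, if wordType e (visit Y l) = j then Y (visit Y l) else 0

theorem visitCount_succ (e j : ZMod 2) (Y : Word → ℕ) (s : ℕ) :
    visitCount e j Y (s + 1)
      = visitCount e j Y s + if wordType e (visit Y s) = j then 1 else 0 := by
  classical
  rw [visitCount, Nat.count_succ]
  unfold visitCount
  congr 1

theorem setOf_type_lt_visit (e j : ZMod 2) (Y : Word → ℕ) (s : ℕ) :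
    {w ∈ {w ∈ forestSet Y | wordType e w = j} | w < visit Y s}.encard = visitCount e j Y s := by
  classical
  have : {w ∈ {w ∈ forestSet Y | wordType e w = j} | w < visit Y s}
      = visit Y '' ((Finset.range s).filter fun s => wordType e (visit Y s) = j) := by
    ext w
    constructor
    · rintro ⟨⟨hw, ht⟩, h⟩
      obtain ⟨s', h1, rfl⟩ := (lt_visit_iff Y s hw).1 h
      exact ⟨s', by simp [h1, ht], rfl⟩
    · rintro ⟨s', h1, rfl⟩
      simp only [Finset.coe_filter, Finset.mem_range, Set.mem_ofPred_eq] at h1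
      exact ⟨⟨visit_mem_forestSet Y s', h1.2⟩, visit_strictMono Y h1.1⟩
  rw [this, (visit_strictMono Y).injective.encard_image, Set.encard_coe_eq_coe_finsetCard,
    visitCount, Nat.count_eq_card_filter_range]

open Classical in
/-- The number of vertices of type `j` on the stack. -/
noncomputable def stackCount (e j : ZMod 2) (L : List Word) : ℕ :=
  L.countP fun w => wordType e w = j

theorem stackCount_append (e j : ZMod 2) (L L' : List Word) :
    stackCount e j (L ++ L') = stackCount e j L + stackCount e j L' := by
  simp [stackCount]

theorem stackCount_cons (e j : ZMod 2) (u : Word) (L : List Word) :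
    stackCount e j (u :: L) = stackCount e j L + if wordType e u = j then 1 else 0 := by
  simp [stackCount, List.countP_cons]

theorem wordType_child (e : ZMod 2) (u : Word) (a : ℕ) :
    wordType e (u ++ [a]) = wordType e u + 1 := by
  simp [wordType, add_assoc]

theorem ZMod.two_eq_iff_ne (x y : ZMod 2) : x + 1 = y ↔ x = y + 1 := by
  revert x y; decide

theorem stackCount_children (e j : ZMod 2) (u : Word) (n : ℕ) :
    stackCount e j (children u n) = if wordType e u = j + 1 then n else 0 := by
  unfold stackCount children
  rw [List.countP_map]
  have : ((fun w => decide (wordType e w = j)) ∘ fun a => u ++ [a])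
      = fun _ : ℕ => decide (wordType e u = j + 1) := by
    funext a
    simp only [Function.comp, wordType_child, ZMod.two_eq_iff_ne]
  rw [this]
  by_cases h : wordType e u = j + 1 <;> simp [h]

/-- Every visited or pending vertex is a root or a child of a visited vertex. -/
theorem visitCount_add_stackCount (e j : ZMod 2) (Y : Word → ℕ) (s : ℕ) :
    visitCount e j Y s + stackCount e j (state Y s).1
      = offspringCount e (j + 1) Y s + if e + 1 = j then (state Y s).2 else 0 := by
  induction s with
  | zero => simp [visitCount, stackCount, offspringCount, state]
  | succ s ih =>
    rw [visitCount_succ, offspringCount, Finset.sum_range_succ, ← offspringCount]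
    have hst : state Y (s + 1) = advance (Y (visit Y s)) (state Y s) := rfl
    rw [hst]
    have hv : visit Y s = current (state Y s) := rfl
    generalize Y (visit Y s) = a at *
    generalize visit Y s = v at *
    generalize state Y s = q at *
    rcases q with ⟨_ | ⟨u, L⟩, r⟩
    · subst hv
      have hr : wordType e [r] = e + 1 := by simp [wordType]
      simp only [advance, current, stackCount_children, hr] at ih ⊢
      simp only [stackCount, List.countP_nil] at ih
      split_ifs at ih ⊢ <;> omega
    · subst hv
      simp only [advance, stackCount_append, stackCount_children, stackCount_cons] at ih ⊢
      split_ifs at ih ⊢ <;> omega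

/-- A root is taken only when the stack is empty. At the last such time the balance equations
express the number of roots through the offspring fluctuations alone. -/
theorem exists_empty_stack (Y : Word → ℕ) (s : ℕ) :
    (state Y s).2 = 0 ∨ ∃ s' ≤ s, (state Y s').1 = [] ∧ (state Y s').2 + 1 = (state Y s).2 := by
  induction s with
  | zero => exact Or.inl rfl
  | succ s ih =>
    have hst : state Y (s + 1) = advance (Y (visit Y s)) (state Y s) := rfl
    rcases hq : state Y s with ⟨_ | ⟨u, L⟩, r⟩
    · right
      refine ⟨s, Nat.le_succ s, by rw [hq], ?_⟩
      rw [hst, hq]; rfl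
    · have h2 : (state Y (s + 1)).2 = (state Y s).2 := by rw [hst, hq]; rfl
      rw [h2]
      rcases ih with h | ⟨s', h1, h3⟩
      · exact Or.inl h
      · exact Or.inr ⟨s', h1.trans (Nat.le_succ s), h3⟩

/-! ### Deterministic estimates -/

theorem ZMod.two_eq_zero_or_one (x : ZMod 2) : x = 0 ∨ x = 1 := by
  revert x; decide

theorem ZMod.two_add_one_add_one (x : ZMod 2) : x + 1 + 1 = x := by
  revert x; decide

theorem ZMod.two_add_one_ne (x : ZMod 2) : x + 1 ≠ x := by
  revert x; decide

theorem ZMod.two_eq_or_eq_add_one (x y : ZMod 2) : x = y ∨ x = y + 1 := by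
  revert x y; decide

theorem visitCount_add (e : ZMod 2) (Y : Word → ℕ) (s : ℕ) (j : ZMod 2) :
    visitCount e j Y s + visitCount e (j + 1) Y s = s := by
  induction s with
  | zero => simp [visitCount]
  | succ s ih =>
    rw [visitCount_succ, visitCount_succ]
    rcases ZMod.two_eq_or_eq_add_one (wordType e (visit Y s)) j with h | h
    · rw [if_pos h, if_neg (by rw [h]; exact (ZMod.two_add_one_ne j).symm)]; omega
    · rw [if_neg (by rw [h]; exact ZMod.two_add_one_ne j), if_pos h]; omega

/-- If the offspring numbers collected by the exploration are close to their mean, the proportions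
of the two types among the visited vertices are close to the limiting ones. -/
theorem abs_sub_visitCount_le {m : ZMod 2 → ℝ} (hm : ∀ j, 0 ≤ m j) (hcrit : m 0 * m 1 = 1)
    {e : ZMod 2} {Y : Word → ℕ} {N : ℕ} {δ : ℝ}
    (h : ∀ s ≤ N, ∀ j, |(offspringCount e j Y s : ℝ) - m j * visitCount e j Y s| ≤ δ)
    {s : ℕ} (hs : s ≤ N) (j : ZMod 2) :
    |(s : ℝ) - (1 + m j) * visitCount e j Y s| ≤ 4 * (1 + m 0) * (1 + m 1) * (1 + δ) := by
  have hδ : 0 ≤ δ := (abs_nonneg _).trans (h 0 (Nat.zero_le _) 0)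
  have hee := ZMod.two_add_one_add_one e
  have hprod : m e * m (e + 1) = 1 := by
    rcases ZMod.two_eq_zero_or_one e with rfl | rfl
    · simpa using hcrit
    · rw [show (1 + 1 : ZMod 2) = 0 from rfl, mul_comm]; exact hcrit
  have hsymm : 4 * (1 + m 0) * (1 + m 1) = 4 * (1 + m (e + 1)) * (1 + m e) := by
    rcases ZMod.two_eq_zero_or_one e with rfl | rfl
    · simp; ring
    · rw [show (1 + 1 : ZMod 2) = 0 from rfl]
  -- The first identity adds the two balance equations with weights `1` and `m e`; criticality
  -- cancels the visit counts, leaving only the roots and the fluctuations.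
  have key : ∀ s ≤ N,
      (stackCount e (e + 1) (state Y s).1 : ℝ) + m e * stackCount e e (state Y s).1
        = (state Y s).2 + ((offspringCount e e Y s : ℝ) - m e * visitCount e e Y s)
          + m e * ((offspringCount e (e + 1) Y s : ℝ)
            - m (e + 1) * visitCount e (e + 1) Y s) ∧
      (visitCount e e Y s : ℝ) + stackCount e e (state Y s).1 = offspringCount e (e + 1) Y s ∧
      (visitCount e (e + 1) Y s : ℝ) + stackCount e (e + 1) (state Y s).1
        = offspringCount e e Y s + (state Y s).2 := by
    intro s _
    have h1 := visitCount_add_stackCount e e Y s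
    have h2 := visitCount_add_stackCount e (e + 1) Y s
    rw [hee, if_pos rfl] at h2
    rw [if_neg (ZMod.two_add_one_ne e), add_zero] at h1
    have h1' : (visitCount e e Y s : ℝ) + stackCount e e (state Y s).1
      = offspringCount e (e + 1) Y s := by exact_mod_cast h1
    have h2' : (visitCount e (e + 1) Y s : ℝ) + stackCount e (e + 1) (state Y s).1
        = offspringCount e e Y s + (state Y s).2 := by exact_mod_cast h2
    refine ⟨?_, h1', h2'⟩
    linear_combination h2' + m e * h1' + (visitCount e (e + 1) Y s : ℝ) * hprod
  -- When the last root is about to be taken, the weighted stack vanishes, so the earlier roots are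
  -- balanced by the fluctuations; the `1` is the last root.
  have hroots : ∀ s ≤ N, ((state Y s).2 : ℝ) ≤ 1 + (1 + m e) * δ := by
    intro s hs
    have h0 : 0 ≤ (1 + m e) * δ := mul_nonneg (by linarith [hm e]) hδ
    rcases exists_empty_stack Y s with h1 | ⟨s', hs', h2, h3⟩
    · rw [h1]; push_cast; linarith
    · have hs'' := hs'.trans hs
      have h4 := (key s' hs'').1
      rw [h2] at h4
      simp only [stackCount, List.countP_nil, Nat.cast_zero] at h4
      have h5 := abs_le.1 (h s' hs'' e)
      have h6 := abs_le.1 (h s' hs'' (e + 1))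
      have h7 := mul_le_mul_of_nonneg_left h6.1 (hm e)
      rw [← h3]; push_cast
      linarith
  obtain ⟨k1, k2, k3⟩ := key s hs
  have hr := hroots s hs
  have h5 := abs_le.1 (h s hs e)
  have h6 := abs_le.1 (h s hs (e + 1))
  have h7 := mul_le_mul_of_nonneg_left h6.2 (hm e)
  have hA0 : (0 : ℝ) ≤ stackCount e (e + 1) (state Y s).1 := Nat.cast_nonneg _
  have hA1 : (0 : ℝ) ≤ stackCount e e (state Y s).1 := Nat.cast_nonneg _
  have hr0 : (0 : ℝ) ≤ (state Y s).2 := Nat.cast_nonneg _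
  have hme := hm e
  have hmo := hm (e + 1)
  have q1 : 0 ≤ m e * δ := mul_nonneg hme hδ
  have q2 : 0 ≤ m (e + 1) * δ := mul_nonneg hmo hδ
  have hbound : 4 * (1 + m (e + 1)) * (1 + m e) * (1 + δ)
      = 4 * (2 + m e + m (e + 1) + 2 * δ + m e * δ + m (e + 1) * δ) := by
    linear_combination (4 * (1 + δ)) * hprod
  rw [hsymm, hbound]
  -- Dropping either nonnegative stack term from the weighted identity bounds the other; `m (e + 1)`
  -- plays the role of the inverse of `m e`.
  have hA0le : (stackCount e (e + 1) (state Y s).1 : ℝ) - (state Y s).2 ≤ (1 + m e) * δ := by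
    nlinarith [mul_nonneg hme hA1]
  have hA1le : (stackCount e e (state Y s).1 : ℝ) ≤ m (e + 1) * (1 + 2 * (1 + m e) * δ) := by
    have h8 : m e * (stackCount e e (state Y s).1 : ℝ) ≤ 1 + 2 * (1 + m e) * δ := by linarith
    have h9 := mul_le_mul_of_nonneg_left h8 hmo
    calc (stackCount e e (state Y s).1 : ℝ)
        = m (e + 1) * (m e * (stackCount e e (state Y s).1 : ℝ)) := by
          linear_combination -(stackCount e e (state Y s).1 : ℝ) * hprod
      _ ≤ _ := h9
  have hA1le' : (stackCount e e (state Y s).1 : ℝ) ≤ m (e + 1) + 2 * (m (e + 1) * δ) + 2 * δ := by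
    refine hA1le.trans (le_of_eq ?_)
    linear_combination (2 * δ) * hprod
  have hje := ZMod.two_eq_or_eq_add_one j e
  have hsum : (visitCount e e Y s : ℝ) + visitCount e (e + 1) Y s = s := by
    exact_mod_cast visitCount_add e Y s e
  rcases hje with rfl | rfl
  · rw [abs_le]; constructor <;> linarith
  · rw [abs_le]; constructor <;> linarith

/-! ### From exploration times to ranks in depth-first order. -/

/-- The vertices of type `j` of rank at most `n` exist and the number of vertices that precede them
is within `δ` of the limiting one. -/
def GoodForest (m : ZMod 2 → ℝ) (i : ZMod 2) (n : ℕ) (δ : ℝ) : Set (Set Word) :=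
  {f | ∀ j, ∀ k ≤ n, ∃ u, IsNth (forestType i j f) k u ∧
    ∃ S : Finset Word, (∀ v, v ∈ S ↔ v ∈ f ∧ v < u) ∧ |(S.card : ℝ) - (1 + m j) * k| ≤ δ}

theorem mem_forestType {i j : ZMod 2} {f : Set Word} {w : Word} :
    w ∈ forestType i j f ↔ w ∈ f ∧ w ≠ [] ∧ wordType (i + 1) w = j := by
  rcases w with _ | ⟨k, v⟩
  · simp [forestType, forestOf]
  · have hty : wordType (i + 1) (k :: v) = i + (v.length : ZMod 2) := by
      have : (1 + 1 : ZMod 2) = 0 := by decide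
      simp only [wordType, List.length_cons, Nat.cast_add, Nat.cast_one]
      linear_combination this
    rw [hty]
    constructor
    · rintro ⟨k', v', hv', h⟩
      obtain ⟨rfl, rfl⟩ := List.cons.inj h
      exact ⟨hv'.1, by simp, hv'.2⟩
    · rintro ⟨h1, -, h2⟩
      exact ⟨k, v, ⟨h1, h2⟩, rfl⟩

theorem forestOf_treeOf (Y : Word → ℕ) :
    forestOf (fun k => treeOf fun v => Y (k :: v)) = forestSet Y := by
  ext w
  constructor
  · rintro ⟨k, v, hv, rfl⟩
    refine ⟨by simp, fun p a hp h => ?_⟩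
    rcases p with _ | ⟨b, p⟩
    · exact absurd rfl hp
    · rw [List.cons_append, List.cons_prefix_cons] at h
      obtain ⟨rfl, h⟩ := h
      exact hv p a h
  · rintro ⟨hne, h⟩
    rcases w with _ | ⟨k, v⟩
    · exact absurd rfl hne
    · exact ⟨k, v, fun p a hp => h (k :: p) a (by simp) (by
        rw [List.cons_append, List.cons_prefix_cons]; exact ⟨rfl, hp⟩), rfl⟩

theorem forestType_forestSet (i j : ZMod 2) (Y : Word → ℕ) :
    forestType i j (forestSet Y) = {w ∈ forestSet Y | wordType (i + 1) w = j} := by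
  ext w
  rw [mem_forestType]
  exact ⟨fun h => ⟨h.1, h.2.2⟩, fun h => ⟨h.1, h.1.1, h.2⟩⟩

/-- By `hN`, more than `n` vertices of each type are met within `N` steps. The vertex of rank `k` is
visited at time `Nat.nth p k`, and its predecessors are the vertices visited earlier, so their
number is that time. -/
theorem forestSet_mem_goodForest {m : ZMod 2 → ℝ} (hm : ∀ j, 0 ≤ m j) (hcrit : m 0 * m 1 = 1)
    {i : ZMod 2} {Y : Word → ℕ} {n N : ℕ} {δ : ℝ}
    (h : ∀ s ≤ N, ∀ j,
      |(offspringCount (i + 1) j Y s : ℝ) - m j * visitCount (i + 1) j Y s| ≤ δ)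
    (hN : ∀ j, (1 + m j) * n + 4 * (1 + m 0) * (1 + m 1) * (1 + δ) < N) :
    forestSet Y ∈ GoodForest m i n (4 * (1 + m 0) * (1 + m 1) * (1 + δ)) := by
  classical
  intro j k hk
  have hlt : k < visitCount (i + 1) j Y N := by
    have h1 := (abs_le.1 (abs_sub_visitCount_le hm hcrit h le_rfl j)).2
    have h2 := hN j
    have h3 : (n : ℝ) < visitCount (i + 1) j Y N := by
      have hpos : 0 < 1 + m j := by linarith [hm j]
      refine lt_of_mul_lt_mul_left ?_ hpos.le
      linarith
    exact hk.trans_lt (by exact_mod_cast h3)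
  set p : ℕ → Prop := fun s => wordType (i + 1) (visit Y s) = j with hp
  have hcount : ∀ s, visitCount (i + 1) j Y s = Nat.count p s := fun s => by
    unfold visitCount; congr
  rw [hcount] at hlt
  -- `Nat.nth` takes a default value beyond the end of a finite set, so more than `k` elements must
  -- be known to exist.
  have hfin : ∀ hf : (Set.ofPred p).Finite, k < hf.toFinset.card := fun hf =>
    hlt.trans_le (Nat.count_le_card hf N)
  have hs : Nat.nth p k < N := Nat.nth_lt_of_lt_count hlt
  have hps : p (Nat.nth p k) := Nat.nth_mem k hfin
  have hcs : Nat.count p (Nat.nth p k) = k := Nat.count_nth hfin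
  set s := Nat.nth p k
  refine ⟨visit Y s, ⟨?_, ?_⟩, (Finset.range s).image (visit Y), fun v => ?_, ?_⟩
  · rw [forestType_forestSet]
    exact ⟨visit_mem_forestSet Y s, hps⟩
  · rw [forestType_forestSet, setOf_type_lt_visit, hcount, hcs]
  · rw [Finset.mem_image]
    constructor
    · rintro ⟨s', hs', rfl⟩
      exact ⟨visit_mem_forestSet Y s', visit_strictMono Y (Finset.mem_range.1 hs')⟩
    · rintro ⟨hv, hlt⟩
      obtain ⟨s', h1, h2⟩ := (lt_visit_iff Y s hv).1 hlt
      exact ⟨s', Finset.mem_range.2 h1, h2⟩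
  · rw [Finset.card_image_of_injective _ (visit_strictMono Y).injective, Finset.card_range]
    have h1 := abs_sub_visitCount_le hm hcrit h hs.le j
    rwa [hcount, hcs] at h1

/-! ### Exponential moments -/

/-- The Laplace transform of `ν` is bounded by that of a Gaussian of mean `m` near the origin. -/
def QuadraticMGF (ν : PMF ℕ) (m C θ₀ : ℝ) : Prop :=
  ∀ θ : ℝ, |θ| ≤ θ₀ → ∑' k : ℕ, ν k * ENNReal.ofReal (Real.exp (θ * k))
    ≤ ENNReal.ofReal (Real.exp (m * θ + C * θ ^ 2))

theorem QuadraticMGF.mono {ν : PMF ℕ} {m C θ₀ C' θ₀' : ℝ} (h : QuadraticMGF ν m C θ₀)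
    (hC : C ≤ C') (hθ : θ₀' ≤ θ₀) : QuadraticMGF ν m C' θ₀' := by
  intro θ hθ'
  refine (h θ (hθ'.trans hθ)).trans (ENNReal.ofReal_le_ofReal (Real.exp_le_exp.2 ?_))
  have := mul_le_mul_of_nonneg_right hC (sq_nonneg θ)
  linarith

theorem exp_le_one_add_add (x : ℝ) : Real.exp x ≤ 1 + x + x ^ 2 * Real.exp |x| := by
  have h := Complex.norm_exp_sub_sum_le_norm_mul_exp (x : ℂ) 2
  have e1 : Complex.exp x - ∑ m ∈ Finset.range 2, (x : ℂ) ^ m / m.factorial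
      = ((Real.exp x - (1 + x) : ℝ) : ℂ) := by
    simp [Finset.sum_range_succ]
  rw [e1, Complex.norm_real, Complex.norm_real, Real.norm_eq_abs, Real.norm_eq_abs, sq_abs] at h
  linarith [le_abs_self (Real.exp x - (1 + x))]

theorem summable_toReal (ν : PMF ℕ) : Summable fun k => (ν k).toReal :=
  ENNReal.summable_toReal ν.tsum_coe_ne_top

theorem tsum_toReal_eq_one (ν : PMF ℕ) : ∑' k, (ν k).toReal = 1 := by
  rw [← ENNReal.tsum_toReal_eq fun k => ν.apply_ne_top k, ν.tsum_coe, ENNReal.toReal_one]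

theorem mean_nonneg (ν : PMF ℕ) : 0 ≤ mean ν :=
  tsum_nonneg fun k => mul_nonneg (Nat.cast_nonneg k) ENNReal.toReal_nonneg

/-- The bound `exp x ≤ 1 + x + x² exp |x|` is summed against `ν`. For `|θ| ≤ a/2`, half of the
exponential moment absorbs `exp |θk|`, and the other half absorbs `k² ≤ (8/a²) exp(ak/2)`. -/
theorem HasExpMoment.exists_quadraticMGF {ν : PMF ℕ} (h : HasExpMoment ν) :
    ∃ C θ₀ : ℝ, 0 ≤ C ∧ 0 < θ₀ ∧ QuadraticMGF ν (mean ν) C θ₀ := by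
  obtain ⟨a, ha, hs⟩ := h
  set q : ℕ → ℝ := fun k => (ν k).toReal
  have hq : ∀ k, 0 ≤ q k := fun k => ENNReal.toReal_nonneg
  have hmean : Summable fun k : ℕ => (k : ℝ) * q k := by
    refine Summable.of_nonneg_of_le (fun k => mul_nonneg (Nat.cast_nonneg k) (hq k))
      (fun k => ?_) (hs.mul_left a⁻¹)
    rw [← mul_assoc]
    refine mul_le_mul_of_nonneg_right ?_ (hq k)
    rw [le_inv_mul_iff₀ ha]
    linarith [Real.add_one_le_exp (a * k)]
  set D : ℝ := ∑' k : ℕ, 8 / a ^ 2 * (Real.exp (a * k) * q k)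
  have hD : 0 ≤ D := tsum_nonneg fun k => by have := hq k; positivity
  refine ⟨D, a / 2, hD, by positivity, fun θ hθ => ?_⟩
  have hterm : ∀ k : ℕ, q k * Real.exp (θ * k)
      ≤ q k + θ * (k * q k) + θ ^ 2 * (8 / a ^ 2 * (Real.exp (a * k) * q k)) := by
    intro k
    have hk : (0 : ℝ) ≤ k := Nat.cast_nonneg k
    have h1 := exp_le_one_add_add (θ * k)
    have h2 : |θ * k| ≤ a * k / 2 := by
      rw [abs_mul, abs_of_nonneg hk]
      nlinarith
    have h3 : (k : ℝ) ^ 2 ≤ 8 / a ^ 2 * Real.exp (a * k / 2) := by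
      have h4 := Real.quadratic_le_exp_of_nonneg (x := a * k / 2) (by positivity)
      rw [div_mul_eq_mul_div, le_div_iff₀ (by positivity)]
      nlinarith [mul_nonneg ha.le hk]
    have h5 : (θ * k) ^ 2 * Real.exp |θ * k| ≤ θ ^ 2 * (8 / a ^ 2 * Real.exp (a * k)) := by
      calc (θ * k) ^ 2 * Real.exp |θ * k|
          ≤ (θ * k) ^ 2 * Real.exp (a * k / 2) :=
            mul_le_mul_of_nonneg_left (Real.exp_le_exp.2 h2) (sq_nonneg _)
        _ = θ ^ 2 * ((k : ℝ) ^ 2 * Real.exp (a * k / 2)) := by ring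
        _ ≤ θ ^ 2 * (8 / a ^ 2 * Real.exp (a * k / 2) * Real.exp (a * k / 2)) := by
            gcongr
        _ = θ ^ 2 * (8 / a ^ 2 * Real.exp (a * k)) := by
            rw [mul_assoc (8 / a ^ 2), ← Real.exp_add]; ring_nf
    have h6 := mul_le_mul_of_nonneg_left (h1.trans (add_le_add_right h5 _)) (hq k)
    linarith
  have hsum : Summable fun k : ℕ =>
      q k + θ * (k * q k) + θ ^ 2 * (8 / a ^ 2 * (Real.exp (a * k) * q k)) :=
    ((summable_toReal ν).add (hmean.mul_left θ)).add ((hs.mul_left _).mul_left _)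
  have hpos : ∀ k : ℕ, 0 ≤ q k * Real.exp (θ * k) := fun k =>
    mul_nonneg (hq k) (Real.exp_pos _).le
  have hsum' : Summable fun k : ℕ => q k * Real.exp (θ * k) :=
    Summable.of_nonneg_of_le hpos hterm hsum
  have hE : ∑' k : ℕ, ν k * ENNReal.ofReal (Real.exp (θ * k))
      = ENNReal.ofReal (∑' k : ℕ, q k * Real.exp (θ * k)) := by
    rw [ENNReal.ofReal_tsum_of_nonneg hpos hsum']
    refine tsum_congr fun k => ?_
    rw [ENNReal.ofReal_mul (hq k), ENNReal.ofReal_toReal (ν.apply_ne_top k)]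
  rw [hE]
  refine ENNReal.ofReal_le_ofReal ?_
  calc ∑' k : ℕ, q k * Real.exp (θ * k) ≤ _ := hsum'.tsum_le_tsum hterm hsum
    _ = 1 + θ * mean ν + θ ^ 2 * D := by
      rw [((summable_toReal ν).add (hmean.mul_left θ)).tsum_add ((hs.mul_left _).mul_left _),
        (summable_toReal ν).tsum_add (hmean.mul_left θ), tsum_mul_left, tsum_mul_left,
        tsum_toReal_eq_one]
      rfl
    _ ≤ _ := by
      have := Real.add_one_le_exp (mean ν * θ + D * θ ^ 2)
      linarith

/-! ### Resampling one coordinate of a product measure -/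

theorem measurable_update_pair {ι : Type*} [DecidableEq ι] {X : ι → Type*}
    [∀ i, MeasurableSpace (X i)] (w : ι) :
    Measurable fun p : (∀ i, X i) × X w => Function.update p.1 w p.2 := by
  refine measurable_pi_iff.2 fun i => ?_
  by_cases h : i = w
  · subst h; simpa using measurable_snd
  · simp only [Function.update_of_ne h]
    exact (measurable_pi_apply i).comp measurable_fst

theorem infinitePi_map_update {ι : Type*} [DecidableEq ι] {X : ι → Type*}
    [∀ i, MeasurableSpace (X i)] (P : ∀ i, Measure (X i)) [∀ i, IsProbabilityMeasure (P i)]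
    (w : ι) :
    ((Measure.infinitePi P).prod (P w)).map (fun p => Function.update p.1 w p.2)
      = Measure.infinitePi P := by
  refine Measure.eq_infinitePi P fun s t ht => ?_
  rw [Measure.map_apply (measurable_update_pair w) (MeasurableSet.pi s.countable_toSet fun i _ => ht i)]
  by_cases hw : w ∈ s
  · have : (fun p : (∀ i, X i) × X w => Function.update p.1 w p.2) ⁻¹' (s : Set ι).pi t
        = ((s.erase w : Finset ι) : Set ι).pi t ×ˢ t w := by
      ext p
      simp only [Set.mem_preimage, Set.mem_pi, Finset.mem_coe, Set.mem_prod, Finset.mem_erase]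
      constructor
      · intro h
        refine ⟨fun i hi => ?_, ?_⟩
        · simpa [Function.update_of_ne hi.1] using h i hi.2
        · simpa using h w hw
      · rintro ⟨h1, h2⟩ i hi
        by_cases hiw : i = w
        · subst hiw; simpa using h2
        · simpa [Function.update_of_ne hiw] using h1 i ⟨hiw, hi⟩
    rw [this, Measure.prod_prod, Measure.infinitePi_pi P fun i _ => ht i,
      Finset.prod_erase_mul s (fun i => P i (t i)) hw]
  · have : (fun p : (∀ i, X i) × X w => Function.update p.1 w p.2) ⁻¹' (s : Set ι).pi t
        = (s : Set ι).pi t ×ˢ Set.univ := by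
      ext p
      simp only [Set.mem_preimage, Set.mem_pi, Finset.mem_coe, Set.mem_prod, Set.mem_univ,
        and_true]
      refine forall₂_congr fun i hi => ?_
      rw [Function.update_of_ne (ne_of_mem_of_not_mem hi hw)]
    rw [this, Measure.prod_prod, Measure.infinitePi_pi P fun i _ => ht i, measure_univ, mul_one]

/-- This serves to integrate out the offspring number of one vertex while all the others are frozen.
-/
theorem lintegral_infinitePi_update {ι : Type*} [DecidableEq ι] {X : ι → Type*}
    [∀ i, MeasurableSpace (X i)] (P : ∀ i, Measure (X i)) [∀ i, IsProbabilityMeasure (P i)]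
    (w : ι) {g : (∀ i, X i) → ENNReal} (hg : Measurable g) :
    ∫⁻ Y, g Y ∂Measure.infinitePi P
      = ∫⁻ Y, ∫⁻ a, g (Function.update Y w a) ∂P w ∂Measure.infinitePi P := by
  conv_lhs => rw [← infinitePi_map_update P w]
  rw [lintegral_map hg (measurable_update_pair w),
    lintegral_prod (fun p => g (Function.update p.1 w p.2))
      (hg.comp (measurable_update_pair w)).aemeasurable]

/-! ### Large deviations along the exploration -/

/-- The law of the offspring numbers of all words when the empty word has type `e`. -/
noncomputable def wordLaw (μ : ZMod 2 → PMF ℕ) (e : ZMod 2) : Measure (Word → ℕ) :=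
  Measure.infinitePi fun w : Word => (μ (wordType e w)).toMeasure

instance (μ : ZMod 2 → PMF ℕ) (e : ZMod 2) : IsProbabilityMeasure (wordLaw μ e) := by
  unfold wordLaw; infer_instance

theorem state_congr {Y Y' : Word → ℕ} {s : ℕ} (h : ∀ l < s, Y (visit Y l) = Y' (visit Y l)) :
    state Y' s = state Y s := by
  induction s with
  | zero => rfl
  | succ s ih =>
    have h1 := ih fun l hl => h l (hl.trans (Nat.lt_succ_self s))
    have h2 := h s (Nat.lt_succ_self s)
    simp only [state, h1]
    unfold visit at h2
    rw [h2]

theorem state_update {Y : Word → ℕ} {s : ℕ} {w : Word} (h : visit Y s = w) (a : ℕ) {l : ℕ}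
    (hl : l ≤ s) : state (Function.update Y w a) l = state Y l := by
  refine state_congr fun l' hl' => ?_
  rw [Function.update_of_ne]
  rw [← h]
  exact (visit_strictMono Y (hl'.trans_le hl)).ne

/-- Predictability: the vertex visited at step `s` is determined by the offspring numbers of earlier
vertices, all different from it. -/
theorem visit_update_eq_iff (Y : Word → ℕ) (s : ℕ) (w : Word) (a : ℕ) :
    visit (Function.update Y w a) s = w ↔ visit Y s = w := by
  have key : ∀ (Y : Word → ℕ) (a : ℕ), visit Y s = w → visit (Function.update Y w a) s = w := by
    intro Y a h
    unfold visit at h ⊢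
    rw [state_update h a le_rfl, h]
  refine ⟨fun h => ?_, key Y a⟩
  have := key _ (Y w) h
  rwa [Function.update_idem, Function.update_eq_self] at this

theorem measurableSet_state (s : ℕ) (q : List Word × ℕ) :
    MeasurableSet {Y : Word → ℕ | state Y s = q} := by
  induction s generalizing q with
  | zero => simp only [state]; exact MeasurableSet.const _
  | succ s ih =>
    have : {Y : Word → ℕ | state Y (s + 1) = q}
        = ⋃ q' : List Word × ℕ, {Y | state Y s = q'} ∩ {Y | advance (Y (current q')) q' = q} := by
      ext Y
      simp [state]
    rw [this]
    refine MeasurableSet.iUnion fun q' => (ih q').inter ?_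
    exact (measurable_pi_apply (current q') : Measurable fun Y : Word → ℕ => Y (current q'))
      (MeasurableSet.of_discrete (s := {a | advance a q' = q}))

theorem measurableSet_visit (s : ℕ) (w : Word) :
    MeasurableSet {Y : Word → ℕ | visit Y s = w} := by
  have : {Y : Word → ℕ | visit Y s = w}
      = ⋃ q ∈ {q : List Word × ℕ | current q = w}, {Y | state Y s = q} := by
    ext Y
    simp [visit]
  rw [this]
  exact MeasurableSet.biUnion (Set.to_countable _) fun q _ => measurableSet_state s q

theorem measurable_visit_comp {β : Type*} [MeasurableSpace β] (s : ℕ) (g : Word → ℕ → β) :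
    Measurable fun Y : Word → ℕ => g (visit Y s) (Y (visit Y s)) := by
  intro B _
  have : (fun Y : Word → ℕ => g (visit Y s) (Y (visit Y s))) ⁻¹' B
      = ⋃ w : Word, {Y | visit Y s = w} ∩ {Y | g w (Y w) ∈ B} := by
    ext Y
    simp
  rw [this]
  refine MeasurableSet.iUnion fun w => (measurableSet_visit s w).inter ?_
  exact (measurable_pi_apply w : Measurable fun Y : Word → ℕ => Y w)
    (MeasurableSet.of_discrete (s := {a | g w a ∈ B}))

/-- The product of a function of the visited vertices and their offspring numbers. -/
noncomputable def visitProd (g : Word → ℕ → ENNReal) (Y : Word → ℕ) (s : ℕ) : ENNReal :=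
  ∏ l ∈ Finset.range s, g (visit Y l) (Y (visit Y l))

theorem measurable_visitProd (g : Word → ℕ → ENNReal) (s : ℕ) :
    Measurable fun Y => visitProd g Y s :=
  Finset.measurable_prod _ fun l _ => measurable_visit_comp l g

/-- Supermartingale property. On the event that `w` is visited at step `s`, neither the event nor
the first `s` factors depend on `Y w`; resampling this coordinate makes the last factor contribute
at most one. -/
theorem lintegral_visitProd_le (μ : ZMod 2 → PMF ℕ) (e : ZMod 2) {g : Word → ℕ → ENNReal}
    (hg : ∀ w, ∫⁻ a, g w a ∂(μ (wordType e w)).toMeasure ≤ 1) (s : ℕ) :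
    ∫⁻ Y, visitProd g Y s ∂wordLaw μ e ≤ 1 := by
  induction s with
  | zero => simp [visitProd]
  | succ s ih =>
    refine le_trans ?_ ih
    set f : Word → (Word → ℕ) → ENNReal :=
      fun w => {Y : Word → ℕ | visit Y s = w}.indicator fun Y => visitProd g Y s with hf
    have hfm : ∀ w, Measurable (f w) := fun w =>
      (measurable_visitProd g s).indicator (measurableSet_visit s w)
    have hfu : ∀ w Y a, f w (Function.update Y w a) = f w Y := by
      intro w Y a
      simp only [hf, Set.indicator_apply, Set.mem_ofPred_eq, visit_update_eq_iff]
      split_ifs with h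
      · refine Finset.prod_congr rfl fun l hl => ?_
        have hl' := Finset.mem_range.1 hl
        have hv : visit (Function.update Y w a) l = visit Y l := by
          unfold visit; rw [state_update h a hl'.le]
        rw [hv, Function.update_of_ne]
        rw [← h]
        exact (visit_strictMono Y hl').ne
      · rfl
    have hsum : ∀ Y, ∑' w, f w Y = visitProd g Y s := by
      intro Y
      rw [tsum_eq_single (visit Y s)]
      · simp [hf]
      · intro w hw
        simp [hf, hw.symm]
    have hsum' : ∀ Y, visitProd g Y (s + 1) = ∑' w, f w Y * g w (Y w) := by
      intro Y
      rw [tsum_eq_single (visit Y s)]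
      · rw [visitProd, Finset.prod_range_succ, ← visitProd]
        simp [hf]
      · intro w hw
        simp [hf, hw.symm]
    have hgm : ∀ w, Measurable fun Y : Word → ℕ => g w (Y w) := fun w =>
      (measurable_of_countable (g w)).comp (measurable_pi_apply w)
    have hfg : ∀ w, Measurable fun Y : Word → ℕ => f w Y * g w (Y w) := fun w =>
      (hfm w).mul (hgm w)
    simp only [hsum', ← hsum]
    rw [lintegral_tsum fun w => (hfg w).aemeasurable,
      lintegral_tsum fun w => (hfm w).aemeasurable]
    refine ENNReal.tsum_le_tsum fun w => ?_
    unfold wordLaw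
    rw [lintegral_infinitePi_update _ w (hfg w)]
    refine lintegral_mono fun Y => ?_
    simp only [hfu, Function.update_self]
    rw [lintegral_const_mul _ (measurable_of_countable _)]
    exact mul_le_of_le_one_right' (hg w)

/-- Markov's inequality at each time and a union bound; the factor `N + 1` is harmless against
stretched exponentials. -/
theorem measure_exists_visitProd_ge (μ : ZMod 2 → PMF ℕ) (e : ZMod 2) {g : Word → ℕ → ENNReal}
    (hg : ∀ w, ∫⁻ a, g w a ∂(μ (wordType e w)).toMeasure ≤ 1) (N : ℕ) (x : ℝ) :
    wordLaw μ e {Y | ∃ s ≤ N, ENNReal.ofReal (Real.exp x) ≤ visitProd g Y s}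
      ≤ (N + 1 : ℕ) * ENNReal.ofReal (Real.exp (-x)) := by
  have hsub : {Y | ∃ s ≤ N, ENNReal.ofReal (Real.exp x) ≤ visitProd g Y s}
      ⊆ ⋃ s ∈ Finset.range (N + 1), {Y | ENNReal.ofReal (Real.exp x) ≤ visitProd g Y s} := by
    rintro Y ⟨s, hs, h⟩
    exact Set.mem_biUnion (Finset.mem_coe.2 (Finset.mem_range.2 (Nat.lt_succ_of_le hs))) h
  refine (measure_mono hsub).trans ((measure_biUnion_finset_le _ _).trans ?_)
  refine (Finset.sum_le_card_nsmul _ _ (ENNReal.ofReal (Real.exp (-x))) fun s _ => ?_).trans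
    (by simp)
  have hpos : ENNReal.ofReal (Real.exp x) ≠ 0 := by simp [Real.exp_pos]
  have h1 := mul_meas_ge_le_lintegral (μ := wordLaw μ e) (measurable_visitProd g s)
    (ENNReal.ofReal (Real.exp x))
  have h2 := h1.trans (lintegral_visitProd_le μ e hg s)
  rw [Real.exp_neg, ENNReal.ofReal_inv_of_pos (Real.exp_pos x)]
  rw [mul_comm] at h2
  exact (ENNReal.le_inv_iff_mul_le).2 h2

theorem lintegral_toMeasure (ν : PMF ℕ) (g : ℕ → ENNReal) :
    ∫⁻ a, g a ∂ν.toMeasure = ∑' a, ν a * g a := by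
  rw [lintegral_countable']
  refine tsum_congr fun a => ?_
  rw [PMF.toMeasure_apply_singleton ν a (measurableSet_singleton a), mul_comm]

theorem measure_exists_offspringCount_ge {μ : ZMod 2 → PMF ℕ} {m C θ₀ θ : ℝ} {j : ZMod 2}
    (hμ : QuadraticMGF (μ j) m C θ₀) (hθ : |θ| ≤ θ₀) (e : ZMod 2) (N : ℕ) (x : ℝ) :
    wordLaw μ e {Y | ∃ s ≤ N,
      x ≤ θ * (offspringCount e j Y s - m * visitCount e j Y s)
        - C * θ ^ 2 * visitCount e j Y s}
      ≤ (N + 1 : ℕ) * ENNReal.ofReal (Real.exp (-x)) := by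
  -- Vertices of the other type receive the factor one, so the product is the exponential
  -- supermartingale of type `j` alone.
  set g : Word → ℕ → ENNReal := fun w a =>
    ENNReal.ofReal (Real.exp (if wordType e w = j then θ * (a - m) - C * θ ^ 2 else 0)) with hg
  have hprod : ∀ (Y : Word → ℕ) s, visitProd g Y s = ENNReal.ofReal (Real.exp
      (θ * (offspringCount e j Y s - m * visitCount e j Y s)
        - C * θ ^ 2 * visitCount e j Y s)) := by
    intro Y s
    induction s with
    | zero => simp [visitProd, offspringCount, visitCount]
    | succ s ih =>
      rw [visitProd, Finset.prod_range_succ, ← visitProd, ih, hg,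
        ← ENNReal.ofReal_mul (Real.exp_pos _).le, ← Real.exp_add, visitCount_succ, offspringCount,
        offspringCount, Finset.sum_range_succ]
      congr 2
      split_ifs
      · push_cast; ring
      · push_cast; ring
  have hint : ∀ w, ∫⁻ a, g w a ∂(μ (wordType e w)).toMeasure ≤ 1 := by
    intro w
    by_cases hw : wordType e w = j
    · rw [lintegral_toMeasure, hw]
      have h1 : ∀ a : ℕ, μ j a * g w a = (μ j a * ENNReal.ofReal (Real.exp (θ * a)))
          * ENNReal.ofReal (Real.exp (-(m * θ + C * θ ^ 2))) := by
        intro a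
        simp only [hg, if_pos hw]
        rw [mul_assoc, ← ENNReal.ofReal_mul (Real.exp_pos _).le, ← Real.exp_add]
        ring_nf
      simp only [h1]
      rw [ENNReal.tsum_mul_right]
      refine (mul_le_mul_left (hμ θ hθ) _).trans (le_of_eq ?_)
      rw [← ENNReal.ofReal_mul (Real.exp_pos _).le, ← Real.exp_add]
      simp
    · simp [hg, hw]
  refine (measure_mono ?_).trans (measure_exists_visitProd_ge μ e hint N x)
  rintro Y ⟨s, hs, h⟩
  refine ⟨s, hs, ?_⟩
  rw [hprod]
  exact ENNReal.ofReal_le_ofReal (Real.exp_le_exp.2 h)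

theorem visitCount_le (e j : ZMod 2) (Y : Word → ℕ) (s : ℕ) : visitCount e j Y s ≤ s :=
  (Nat.le_add_right _ _).trans (visitCount_add e Y s j).le

/-- The factor `4` counts two types and two signs of the Laplace parameter; the variance term is
bounded using at most `N` visits. -/
theorem measure_exists_abs_offspringCount_gt {μ : ZMod 2 → PMF ℕ} {m : ZMod 2 → ℝ} {C θ₀ θ : ℝ}
    (hμ : ∀ j, QuadraticMGF (μ j) (m j) C θ₀) (hC : 0 ≤ C) (hθ0 : 0 < θ) (hθ : θ ≤ θ₀)
    (e : ZMod 2) (N : ℕ) (x : ℝ) :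
    wordLaw μ e {Y | ∃ s ≤ N, ∃ j, C * θ * N + x / θ
        < |(offspringCount e j Y s : ℝ) - m j * visitCount e j Y s|}
      ≤ 4 * ((N + 1 : ℕ) * ENNReal.ofReal (Real.exp (-x))) := by
  set B : ZMod 2 → ℝ → Set (Word → ℕ) := fun j θ => {Y | ∃ s ≤ N,
      x ≤ θ * (offspringCount e j Y s - m j * visitCount e j Y s)
        - C * θ ^ 2 * visitCount e j Y s}
  have hsub : {Y | ∃ s ≤ N, ∃ j, C * θ * N + x / θ
        < |(offspringCount e j Y s : ℝ) - m j * visitCount e j Y s|}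
      ⊆ (B 0 θ ∪ B 0 (-θ)) ∪ (B 1 θ ∪ B 1 (-θ)) := by
    rintro Y ⟨s, hs, j, h⟩
    have hmem : Y ∈ B j θ ∪ B j (-θ) := by
      have hV : (visitCount e j Y s : ℝ) ≤ N := by
        exact_mod_cast (visitCount_le e j Y s).trans hs
      have h1 : C * θ ^ 2 * visitCount e j Y s ≤ C * θ ^ 2 * N :=
        mul_le_mul_of_nonneg_left hV (by positivity)
      have h3 : θ * (C * θ * N + x / θ) = C * θ ^ 2 * N + x := by
        field_simp
      rcases lt_abs.1 h with h | h
      · left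
        refine ⟨s, hs, ?_⟩
        have h2 := mul_lt_mul_of_pos_left h hθ0
        linarith
      · right
        refine ⟨s, hs, ?_⟩
        have h2 := mul_lt_mul_of_pos_left h hθ0
        rw [neg_sq]
        linarith
    rcases ZMod.two_eq_zero_or_one j with rfl | rfl
    · exact Or.inl hmem
    · exact Or.inr hmem
  have hθ' : |θ| ≤ θ₀ := by rwa [abs_of_pos hθ0]
  have hθ'' : |(-θ)| ≤ θ₀ := by rwa [abs_neg]
  have hb : ∀ j, wordLaw μ e (B j θ ∪ B j (-θ))
      ≤ 2 * ((N + 1 : ℕ) * ENNReal.ofReal (Real.exp (-x))) := fun j =>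
    (measure_union_le _ _).trans (by
      rw [two_mul]
      exact add_le_add (measure_exists_offspringCount_ge (hμ j) hθ' e N x)
        (measure_exists_offspringCount_ge (hμ j) hθ'' e N x))
  refine (measure_mono hsub).trans ((measure_union_le _ _).trans ((add_le_add (hb 0) (hb 1)).trans
    (le_of_eq ?_)))
  ring

/-! ### Ranks in depth-first order -/

theorem IsNth.lt_encard {A : Set Word} {k : ℕ} {u : Word} (h : IsNth A k u) :
    (k : ENat) < A.encard := by
  have hins : insert u {v ∈ A | v < u} ⊆ A := by
    rintro v (rfl | hv)
    · exact h.1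
    · exact hv.1
  have h1 := Set.encard_le_encard hins
  rw [Set.encard_insert_of_notMem (by simp), h.2] at h1
  exact lt_of_lt_of_le (by exact_mod_cast Nat.lt_succ_self k) h1

theorem IsNth.not_lt_of_isNth {A : Set Word} {k : ℕ} {u u' : Word} (h : IsNth A k u) (h' : IsNth A k u') :
    ¬ u < u' := by
  intro hlt
  have : IsNth {v ∈ A | v < u'} k u := by
    refine ⟨⟨h.1, hlt⟩, ?_⟩
    rw [← h.2]
    congr 1
    ext v
    exact ⟨fun hv => ⟨hv.1.1, hv.2⟩, fun hv => ⟨⟨hv.1, hv.2.trans hlt⟩, hv.2⟩⟩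
  have h2 := this.lt_encard
  rw [h'.2] at h2
  exact lt_irrefl _ h2

theorem IsNth.unique {A : Set Word} {k : ℕ} {u u' : Word} (h : IsNth A k u) (h' : IsNth A k u') :
    u = u' :=
  le_antisymm (not_lt.1 (h'.not_lt_of_isNth h)) (not_lt.1 (h.not_lt_of_isNth h'))

theorem IsNth.visitedBefore_eq {S A : Set Word} {k : ℕ} {u : Word} (h : IsNth A k u) :
    visitedBefore S A k = {v ∈ S | v < u}.ncard := by
  rw [visitedBefore, if_pos ⟨u, h⟩]
  congr 1
  ext v
  refine and_congr_right fun _ => ⟨?_, fun hv => ⟨u, h, hv⟩⟩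
  rintro ⟨u', h', hv⟩
  rwa [h.unique h']

theorem ncard_eq_card {A : Set Word} {S : Finset Word} (h : ∀ v, v ∈ S ↔ v ∈ A) :
    A.ncard = S.card := by
  have : A = S := by ext v; exact (h v).symm
  rw [this, Set.ncard_coe_finset]

theorem encard_eq_natCast_iff {A : Set Word} {n : ℕ} :
    A.encard = n ↔ ∃ S : Finset Word, S.card = n ∧ ∀ v, v ∈ S ↔ v ∈ A := by
  constructor
  · intro h
    have hfin : A.Finite := Set.finite_of_encard_eq_coe h
    refine ⟨hfin.toFinset, ?_, fun v => hfin.mem_toFinset⟩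
    rw [hfin.encard_eq_coe_toFinset_card] at h
    exact_mod_cast h
  · rintro ⟨S, rfl, hS⟩
    have : A = S := by ext v; exact (hS v).symm
    rw [this, Set.encard_coe_eq_coe_finsetCard]

theorem GoodForest.abs_forestG_sub_le {m : ZMod 2 → ℝ} {i j : ZMod 2} {n : ℕ} {δ : ℝ}
    {f : Set Word} (hf : f ∈ GoodForest m i n δ) {k : ℕ} (hk : k ≤ n) :
    |(forestG i j f k : ℝ) - (1 + m j) * k| ≤ δ := by
  obtain ⟨u, hu, S, hS, h⟩ := hf j k hk
  rw [forestG, hu.visitedBefore_eq, ncard_eq_card (A := {v ∈ f | v < u}) hS]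
  exact h

/-! ### The first tree of a forest -/

theorem zero_cons_lt_iff (u v : Word) : 0 :: u < 0 :: v ↔ u < v := by simp

theorem cons_lt_zero_cons {a : ℕ} {u v : Word} (h : a :: u < 0 :: v) : a = 0 ∧ u < v := by
  rcases List.cons_lt_cons_iff.1 h with h | h
  · exact absurd h (Nat.not_lt_zero _)
  · exact h

theorem zero_cons_lt_succ_cons (a : ℕ) (u v : Word) : 0 :: u < (a + 1) :: v :=
  List.cons_lt_cons_iff.2 (Or.inl (Nat.succ_pos a))

theorem zero_cons_mem_forestType {i j : ZMod 2} {f : Set Word} {v : Word} :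
    0 :: v ∈ forestType i j f ↔ v ∈ treeType i j (fringe f [0]) := by
  constructor
  · rintro ⟨k, v', hv, h⟩
    obtain ⟨rfl, rfl⟩ := List.cons.inj h
    exact hv
  · exact fun h => ⟨0, v, h, rfl⟩

theorem setOf_forestType_lt (i j : ZMod 2) (f : Set Word) (u : Word) :
    {w ∈ forestType i j f | w < 0 :: u}
      = (fun v => 0 :: v) '' {w ∈ treeType i j (fringe f [0]) | w < u} := by
  ext w
  constructor
  · rintro ⟨hw, hlt⟩
    rcases w with _ | ⟨a, w⟩
    · exact absurd rfl (mem_forestType.1 hw).2.1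
    · obtain ⟨rfl, hlt'⟩ := cons_lt_zero_cons hlt
      exact ⟨w, ⟨zero_cons_mem_forestType.1 hw, hlt'⟩, rfl⟩
  · rintro ⟨v, ⟨hv, hlt⟩, rfl⟩
    exact ⟨zero_cons_mem_forestType.2 hv, (zero_cons_lt_iff _ _).2 hlt⟩

theorem setOf_forest_lt {f : Set Word} (hf : [] ∉ f) (u : Word) :
    {w ∈ f | w < 0 :: u} = (fun v => 0 :: v) '' {w ∈ fringe f [0] | w < u} := by
  ext w
  constructor
  · rintro ⟨hw, hlt⟩
    rcases w with _ | ⟨a, w⟩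
    · exact absurd hw hf
    · obtain ⟨rfl, hlt'⟩ := cons_lt_zero_cons hlt
      exact ⟨w, ⟨hw, hlt'⟩, rfl⟩
  · rintro ⟨v, ⟨hv, hlt⟩, rfl⟩
    exact ⟨hv, (zero_cons_lt_iff _ _).2 hlt⟩

theorem zero_cons_injective : Function.Injective fun v : Word => 0 :: v :=
  fun _ _ h => (List.cons.inj h).2

theorem isNth_zero_cons_iff {i j : ZMod 2} {f : Set Word} {k : ℕ} {u : Word} :
    IsNth (forestType i j f) k (0 :: u) ↔ IsNth (treeType i j (fringe f [0])) k u := by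
  unfold IsNth
  rw [setOf_forestType_lt, zero_cons_injective.encard_image, zero_cons_mem_forestType]

/-- In a forest, a vertex of type `j` whose rank is at least the number of those vertices in the
first tree is visited after the first tree. -/
theorem IsNth.zero_cons_lt {i j : ZMod 2} {f : Set Word} {k : ℕ} {u : Word}
    (h : IsNth (forestType i j f) k u) (hk : (treeType i j (fringe f [0])).encard ≤ k) (v : Word) :
    0 :: v < u := by
  rcases u with _ | ⟨_ | a, u⟩
  · exact absurd rfl (mem_forestType.1 h.1).2.1
  · exact absurd (isNth_zero_cons_iff.1 h).lt_encard (not_lt.2 hk)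
  · exact zero_cons_lt_succ_cons a v u

/-- A vertex in a later tree would have all vertices of type `j` of the first tree before it, hence
too large a rank. -/
theorem IsNth.exists_zero_cons {i j : ZMod 2} {f : Set Word} {k : ℕ} {u : Word}
    (h : IsNth (forestType i j f) k u) (hk : (k : ENat) < (treeType i j (fringe f [0])).encard) :
    ∃ u', u = 0 :: u' ∧ IsNth (treeType i j (fringe f [0])) k u' := by
  rcases u with _ | ⟨_ | a, u⟩
  · exact absurd rfl (mem_forestType.1 h.1).2.1
  · exact ⟨u, rfl, isNth_zero_cons_iff.1 h⟩
  · exfalso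
    have hsub : (fun v : Word => 0 :: v) '' treeType i j (fringe f [0])
        ⊆ {w ∈ forestType i j f | w < (a + 1) :: u} := by
      rintro _ ⟨v, hv, rfl⟩
      exact ⟨zero_cons_mem_forestType.2 hv, zero_cons_lt_succ_cons a v u⟩
    have h1 := Set.encard_le_encard hsub
    rw [zero_cons_injective.encard_image, h.2] at h1
    exact absurd hk (not_lt.2 h1)

theorem finite_of_image_subset {t : Set Word} {S : Finset Word} (h : ∀ v ∈ t, 0 :: v ∈ S) :
    t.Finite ∧ t.ncard ≤ S.card := by
  have hsub : (fun v : Word => 0 :: v) '' t ⊆ S := by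
    rintro _ ⟨v, hv, rfl⟩; exact h v hv
  have hfin : t.Finite := (S.finite_toSet.subset hsub).of_finite_image
    zero_cons_injective.injOn
  refine ⟨hfin, ?_⟩
  rw [← Set.ncard_image_of_injective t zero_cons_injective, ← Set.ncard_coe_finset S]
  exact Set.ncard_le_ncard hsub S.finite_toSet

/-- Inside the first tree, ranks and predecessors agree with those in the forest. The size of the
tree is controlled by the first vertex of the forest that comes after it; in particular the tree is
finite. The extra `1 + m j` pays for the terminal value `#t - 1`, compared with rank one lower. -/
theorem GoodForest.abs_treeG_sub_le {m : ZMod 2 → ℝ} (hm : ∀ j, 0 ≤ m j) {i c : ZMod 2}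
    {n n' : ℕ} {δ : ℝ} {f : Set Word} (hf : f ∈ GoodForest m i n' δ) (hnil : [] ∉ f)
    (hc : (treeType i c (fringe f [0])).encard = n) (hn : (1 + m c) * n + δ ≤ n') :
    (fringe f [0]).Finite ∧ ∀ j, ∀ k ≤ (treeType i j (fringe f [0])).ncard,
      |(treeG i j (fringe f [0]) k : ℝ) - (1 + m j) * k| ≤ δ + (1 + m j) := by
  set t := fringe f [0] with ht
  have hδ : 0 ≤ δ := by
    obtain ⟨u, -, S, -, h⟩ := hf c 0 (Nat.zero_le _)
    exact (abs_nonneg _).trans h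
  have hnn' : n ≤ n' := by
    have : (n : ℝ) ≤ n' := by
      have := mul_nonneg (hm c) (Nat.cast_nonneg (α := ℝ) n)
      linarith
    exact_mod_cast this
  -- The vertex of rank `k` then lies beyond the first tree, so the whole tree is among its
  -- predecessors.
  have hafter : ∀ j k, k ≤ n' → (treeType i j t).encard ≤ k →
      t.Finite ∧ (t.ncard : ℝ) ≤ (1 + m j) * k + δ := by
    intro j k hk hle
    obtain ⟨u, hu, S, hS, h⟩ := hf j k hk
    have h1 := finite_of_image_subset (t := t) (S := S) fun v hv =>
      (hS _).2 ⟨hv, hu.zero_cons_lt hle v⟩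
    refine ⟨h1.1, ?_⟩
    have h2 : (t.ncard : ℝ) ≤ S.card := by exact_mod_cast h1.2
    linarith [(abs_le.1 h).2]
  obtain ⟨hfin, hcard⟩ := hafter c n hnn' hc.le
  refine ⟨hfin, fun j k hk => ?_⟩
  have hsub : treeType i j t ⊆ t := fun v hv => hv.1
  have hfinj : (treeType i j t).Finite := hfin.subset hsub
  have hcast : (treeType i j t).encard = (treeType i j t).ncard := hfinj.cast_ncard_eq.symm
  have hq : (treeType i j t).ncard ≤ t.ncard := Set.ncard_le_ncard hsub hfin
  have hq' : (treeType i j t).ncard ≤ n' := by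
    have : (t.ncard : ℝ) ≤ n' := hcard.trans hn
    exact hq.trans (by exact_mod_cast this)
  have hbefore : ∀ k < (treeType i j t).ncard, ∃ u, IsNth (treeType i j t) k u ∧
      |({w ∈ t | w < u}.ncard : ℝ) - (1 + m j) * k| ≤ δ := by
    intro k hk
    obtain ⟨u, hu, S, hS, h⟩ := hf j k (hk.le.trans hq')
    obtain ⟨u', rfl, hu'⟩ := hu.exists_zero_cons (by rw [← ht, hcast]; exact_mod_cast hk)
    refine ⟨u', hu', ?_⟩
    have h1 : {w ∈ t | w < u'}.ncard = S.card := by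
      rw [← ncard_eq_card (A := {w ∈ f | w < 0 :: u'}) hS, setOf_forest_lt hnil,
        Set.ncard_image_of_injective _ zero_cons_injective]
    rw [h1]; exact h
  rcases hk.lt_or_eq with hk | rfl
  · obtain ⟨u, hu, h⟩ := hbefore k hk
    rw [treeG, hu.visitedBefore_eq]
    linarith [hm j]
  · have hval : treeG i j t (treeType i j t).ncard = t.ncard - 1 := by
      rw [treeG, visitedBefore, if_neg]
      rintro ⟨u, hu⟩
      have := hu.lt_encard
      rw [hcast] at this
      exact lt_irrefl _ this
    rw [hval]
    have hup := (hafter j _ hq' hcast.le).2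
    set q := (treeType i j t).ncard with hqdef
    have hle : ((t.ncard - 1 : ℕ) : ℝ) ≤ t.ncard := by exact_mod_cast Nat.sub_le _ _
    rw [abs_le]
    refine ⟨?_, by linarith [hm j]⟩
    rcases Nat.eq_zero_or_pos q with h0 | hpos
    · rw [h0]
      have : (0 : ℝ) ≤ ((t.ncard - 1 : ℕ) : ℝ) := Nat.cast_nonneg _
      push_cast
      linarith [hm j]
    -- The last vertex `u` of type `j` does not precede itself, so it has at most `#t - 1`
    -- predecessors in the tree.
    · obtain ⟨u, hu, h⟩ := hbefore (q - 1) (by omega)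
      have hss : {w ∈ t | w < u}.ncard < t.ncard := by
        refine Set.ncard_lt_ncard ⟨fun v hv => hv.1, fun h => ?_⟩ hfin
        exact lt_irrefl u (h (hsub hu.1)).2
      have h1 : ({w ∈ t | w < u}.ncard : ℝ) ≤ ((t.ncard - 1 : ℕ) : ℝ) := by
        exact_mod_cast Nat.le_sub_one_of_lt hss
      have h2 := (abs_le.1 h).1
      rw [Nat.cast_sub hpos] at h2
      push_cast at h2
      linarith

/-! ### Measurability -/

theorem measurable_mem_word (w : Word) : Measurable fun f : Set Word => w ∈ f :=
  measurable_set_mem w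

theorem measurable_isNth {A : Set Word → Set Word} (hA : ∀ w, Measurable fun f => w ∈ A f) (k : ℕ)
    (u : Word) : Measurable fun f => IsNth (A f) k u := by
  have : (fun f => IsNth (A f) k u) = fun f => u ∈ A f ∧ ∃ S : Finset Word, S.card = k ∧
      ∀ v, v ∈ S ↔ (v ∈ A f ∧ v < u) := by
    funext f
    exact propext (and_congr_right fun _ => encard_eq_natCast_iff)
  rw [this]
  refine (hA u).and (Measurable.exists fun S => measurable_const.and (Measurable.forall fun v => ?_))
  exact measurable_const.iff ((hA v).and measurable_const)

theorem measurable_mem_forestType (i j : ZMod 2) (w : Word) :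
    Measurable fun f => w ∈ forestType i j f := by
  simp only [mem_forestType]
  exact (measurable_mem_word w).and measurable_const

/-- Finite sets of words are countably many, so prescribing the set of predecessors gives a
countable combination of coordinate events. -/
theorem measurableSet_goodForest (m : ZMod 2 → ℝ) (i : ZMod 2) (n : ℕ) (δ : ℝ) :
    MeasurableSet (GoodForest m i n δ) := by
  refine measurableSet_setOfPred.2 ?_
  refine Measurable.forall fun j => Measurable.forall fun k => Measurable.forall fun _ =>
    Measurable.exists fun u => (measurable_isNth (measurable_mem_forestType i j) k u).and
      (Measurable.exists fun S => (Measurable.forall fun v => ?_).and measurable_const)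
  exact measurable_const.iff ((measurable_mem_word v).and measurable_const)

theorem measurableSet_encard_treeType_eq (i c : ZMod 2) (n : ℕ) :
    MeasurableSet {t : Set Word | (treeType i c t).encard = n} := by
  have : {t : Set Word | (treeType i c t).encard = n} = {t | ∃ S : Finset Word, S.card = n ∧
      ∀ v, v ∈ S ↔ (v ∈ t ∧ wordType i v = c)} := by
    ext t
    exact encard_eq_natCast_iff
  rw [this]
  refine measurableSet_setOfPred.2 (Measurable.exists fun S => measurable_const.and
    (Measurable.forall fun v => measurable_const.iff ((measurable_mem_word v).and
      measurable_const)))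

/-- There are countably many finite sets of words, and each is a measurable singleton. -/
theorem measurableSet_of_forall_finite {B : Set (Set Word)} (h : ∀ t ∈ B, t.Finite) :
    MeasurableSet B := by
  have : MeasurableSingletonClass (Set Word) :=
    inferInstanceAs (MeasurableSingletonClass (Word → Prop))
  exact (Set.Countable.ofPred_finite.mono h).measurableSet

/-! ### The laws of trees and forests as images of a law on words -/

theorem gwTree_eq_map (μ : ZMod 2 → PMF ℕ) (i : ZMod 2) :
    gwTree μ i = (wordLaw μ i).map treeOf := rfl

theorem measurable_forestSet : Measurable forestSet := by
  refine measurable_set_iff.2 fun w => ?_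
  refine measurable_const.and (Measurable.forall fun p => Measurable.forall fun a =>
    Measurable.imp measurable_const (Measurable.imp measurable_const ?_))
  exact (measurable_of_countable fun m : ℕ => a < m).comp (measurable_pi_apply p)

/-- Prefixing the index of the component merges the independent families into one family indexed by
nonempty words. The empty word gets type `i + 1`, so that the roots, of length one, have type `i`.
-/
theorem gwForest_eq_map (μ : ZMod 2 → PMF ℕ) (i : ZMod 2) :
    gwForest μ i = (wordLaw μ (i + 1)).map forestSet := by
  have hinj : Function.Injective fun p : ℕ × Word => p.1 :: p.2 := by
    rintro ⟨a, u⟩ ⟨b, v⟩ h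
    obtain ⟨h1, h2⟩ := List.cons.inj h
    exact Prod.ext h1 h2
  have hty : ∀ p : ℕ × Word, wordType (i + 1) (p.1 :: p.2) = i + (p.2.length : ZMod 2) := by
    intro p
    have : (1 + 1 : ZMod 2) = 0 := rfl
    simp only [wordType, List.length_cons, Nat.cast_add, Nat.cast_one]
    linear_combination this
  have h1 : (wordLaw μ (i + 1)).map (fun Y (p : ℕ × Word) => Y (p.1 :: p.2))
      = Measure.infinitePi fun p : ℕ × Word => (μ (i + (p.2.length : ZMod 2))).toMeasure := by
    unfold wordLaw
    rw [Measure.map_infinitePi_infinitePi_of_inj hinj]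
    simp only [hty]
  have h2 := Measure.infinitePi_map_curry
    fun (_ : ℕ) (u : Word) => (μ (i + (u.length : ZMod 2))).toMeasure
  have h3 := Measure.infinitePi_map_pi
    (fun _ : ℕ => Measure.infinitePi fun u : Word => (μ (i + (u.length : ZMod 2))).toMeasure)
    (f := fun _ => treeOf) (fun _ => measurable_treeOf)
  have hm1 : Measurable fun (Y : Word → ℕ) (p : ℕ × Word) => Y (p.1 :: p.2) :=
    measurable_pi_iff.2 fun p => measurable_pi_apply _
  have hm2 : Measurable fun (x : ℕ → Word → ℕ) k => treeOf (x k) :=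
    measurable_pi_iff.2 fun k => measurable_treeOf.comp (measurable_pi_apply k)
  unfold gwForest gwTree
  rw [← h3, ← h2, ← h1, Measure.map_map (MeasurableEquiv.measurable _) hm1,
    Measure.map_map hm2 ((MeasurableEquiv.measurable _).comp hm1),
    Measure.map_map measurable_forestOf
      (hm2.comp ((MeasurableEquiv.measurable _).comp hm1))]
  congr 1
  funext Y
  exact forestOf_treeOf Y

theorem measurable_fringe (u : Word) : Measurable fun f => fringe f u :=
  measurable_set_iff.2 fun v => measurable_mem_word (u ++ v)

theorem gwTree_eq_map_fringe (μ : ZMod 2 → PMF ℕ) (i : ZMod 2) :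
    gwTree μ i = (gwForest μ i).map fun f => fringe f [0] := by
  unfold gwForest
  rw [Measure.map_map (measurable_fringe [0]) measurable_forestOf]
  have : ((fun f => fringe f [0]) ∘ forestOf) = fun t : ℕ → Set Word => t 0 := by
    funext t
    ext v
    constructor
    · rintro ⟨k, v', hv, h⟩
      obtain ⟨rfl, rfl⟩ := List.cons.inj h
      exact hv
    · exact fun hv => ⟨0, v, hv, rfl⟩
  rw [this]
  exact (Measure.infinitePi_map_eval (fun _ : ℕ => gwTree μ i) 0).symm

/-! ### Asymptotics -/

theorem tendsto_natCast_rpow {r : ℝ} (hr : 0 < r) :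
    Tendsto (fun n : ℕ => (n : ℝ) ^ r) atTop atTop :=
  (tendsto_rpow_atTop hr).comp tendsto_natCast_atTop_atTop

theorem eventually_const_mul_rpow_le (D : ℝ) {r s : ℝ} (hrs : r < s) :
    ∀ᶠ n : ℕ in atTop, D * (n : ℝ) ^ r ≤ (n : ℝ) ^ s := by
  filter_upwards [(tendsto_natCast_rpow (sub_pos.2 hrs)).eventually_ge_atTop D,
    eventually_ge_atTop 1] with n hn h1
  have hn0 : (0 : ℝ) < n := by exact_mod_cast h1
  calc D * (n : ℝ) ^ r ≤ (n : ℝ) ^ (s - r) * (n : ℝ) ^ r :=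
        mul_le_mul_of_nonneg_right hn (Real.rpow_nonneg hn0.le r)
    _ = (n : ℝ) ^ s := by rw [← Real.rpow_add hn0]; ring_nf

theorem eventually_const_mul_le_exp_rpow (D : ℝ) {r : ℝ} (hr : 0 < r) :
    ∀ᶠ n : ℕ in atTop, D * n ≤ Real.exp ((n : ℝ) ^ r) := by
  have hlog : ∀ᶠ n : ℕ in atTop, ‖Real.log n‖ ≤ 1 / 2 * ‖(n : ℝ) ^ r‖ :=
    tendsto_natCast_atTop_atTop.eventually
      ((isLittleO_log_rpow_atTop hr).bound (by norm_num : (0 : ℝ) < 1 / 2))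
  filter_upwards [hlog, (tendsto_natCast_rpow hr).eventually_ge_atTop (2 * |D|),
    eventually_ge_atTop 1] with n h1 h2 h3
  have hn0 : (0 : ℝ) < n := by exact_mod_cast h3
  have hpos : 0 ≤ (n : ℝ) ^ r := Real.rpow_nonneg hn0.le r
  rw [Real.norm_eq_abs, Real.norm_eq_abs, abs_of_nonneg hpos] at h1
  calc D * n ≤ Real.exp |D| * Real.exp (Real.log n) := by
        rw [Real.exp_log hn0]
        refine mul_le_mul_of_nonneg_right ?_ hn0.le
        linarith [le_abs_self D, Real.add_one_le_exp |D|]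
    _ = Real.exp (|D| + Real.log n) := (Real.exp_add _ _).symm
    _ ≤ _ := Real.exp_le_exp.2 (by linarith [le_abs_self (Real.log n)])

/-- The factor with exponent `r / 2` is spent on the probability of the conditioning event; the one
with exponent `r / 4` remains as the final bound. -/
theorem eventually_mul_exp_neg_rpow_le (D : ℝ) {r : ℝ} (hr : 0 < r) :
    ∀ᶠ n : ℕ in atTop, D * n * Real.exp (-(n : ℝ) ^ r)
      ≤ Real.exp (-(n : ℝ) ^ (r / 4)) * Real.exp (-(n : ℝ) ^ (r / 2)) := by
  filter_upwards [eventually_const_mul_le_exp_rpow D (half_pos hr),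
    eventually_const_mul_rpow_le 3 (half_lt_self hr), eventually_ge_atTop 1] with n h1 h2 h3
  have hn1 : (1 : ℝ) ≤ n := by exact_mod_cast h3
  have h4 : (n : ℝ) ^ (r / 4) ≤ (n : ℝ) ^ (r / 2) :=
    Real.rpow_le_rpow_of_exponent_le hn1 (by linarith)
  calc D * n * Real.exp (-(n : ℝ) ^ r)
      ≤ Real.exp ((n : ℝ) ^ (r / 2)) * Real.exp (-(n : ℝ) ^ r) :=
        mul_le_mul_of_nonneg_right h1 (Real.exp_pos _).le
    _ ≤ _ := by
        rw [← Real.exp_add, ← Real.exp_add]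
        exact Real.exp_le_exp.2 (by linarith)

/-! ### Probability of atypical forests -/

theorem GoodForest.mono {m : ZMod 2 → ℝ} {i : ZMod 2} {n : ℕ} {δ δ' : ℝ} (h : δ ≤ δ') :
    GoodForest m i n δ ⊆ GoodForest m i n δ' := by
  intro f hf j k hk
  obtain ⟨u, hu, S, hS, hb⟩ := hf j k hk
  exact ⟨u, hu, S, hS, hb.trans h⟩

/-- The condition `γ ≤ 1 / 4` keeps the error `n^(1/2+γ)` below linear order, so a linear number of
steps meets all the required ranks. -/
theorem wordLaw_goodForest_compl_le {μ : ZMod 2 → PMF ℕ} (hcrit : Critical μ)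
    (hexp : ∀ i, HasExpMoment (μ i)) {γ : ℝ} (hγ : 0 < γ) (hγ' : γ ≤ 1 / 4) (K : ℕ) :
    ∃ D D' : ℝ, ∀ᶠ n : ℕ in atTop, ∀ i : ZMod 2,
      wordLaw μ (i + 1) {Y | forestSet Y ∉
        GoodForest (fun j => mean (μ j)) i (K * n) (D * (n : ℝ) ^ (1 / 2 + γ))}
        ≤ ENNReal.ofReal (D' * n * Real.exp (-(n : ℝ) ^ γ)) := by
  set m : ZMod 2 → ℝ := fun j => mean (μ j) with hmdef
  have hm : ∀ j, 0 ≤ m j := fun j => mean_nonneg _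
  have hm1 : m 0 * m 1 = 1 := hcrit
  choose C₁ θ₁ hC₁ hθ₁ hquad using fun j => (hexp j).exists_quadraticMGF
  set C := C₁ 0 + C₁ 1 with hC
  set θ₀ := min (θ₁ 0) (θ₁ 1) with hθ₀
  have hθ₀pos : 0 < θ₀ := lt_min (hθ₁ 0) (hθ₁ 1)
  have hCpos : 0 ≤ C := add_nonneg (hC₁ 0) (hC₁ 1)
  have hq : ∀ j, QuadraticMGF (μ j) (m j) C θ₀ := by
    intro j
    rcases ZMod.two_eq_zero_or_one j with rfl | rfl
    · exact (hquad 0).mono (le_add_of_nonneg_right (hC₁ 1)) (min_le_left _ _)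
    · exact (hquad 1).mono (le_add_of_nonneg_left (hC₁ 0)) (min_le_right _ _)
  -- `K' * n` steps suffice to meet `K * n` vertices of either type; the final `+ 1` leaves room for
  -- the sublinear error.
  obtain ⟨K', hK'⟩ := exists_nat_ge ((1 + m 0 + m 1) * K + 1)
  set A := 4 * (1 + m 0) * (1 + m 1) with hA
  have hApos : 0 ≤ A := by have := hm 0; have := hm 1; positivity
  set D := A * (C * K' + 2) with hD
  refine ⟨D, 4 * (K' + 1), ?_⟩
  filter_upwards [eventually_ge_atTop 1,
    (tendsto_natCast_rpow (r := 1 / 2) (by norm_num)).eventually_ge_atTop θ₀⁻¹,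
    eventually_const_mul_rpow_le (D + 1) (show (1 / 2 + γ : ℝ) < 1 by linarith)]
    with n hn1 hnθ hnD i
  have hn0 : (0 : ℝ) < n := by exact_mod_cast hn1
  have hn1' : (1 : ℝ) ≤ n := by exact_mod_cast hn1
  -- With this choice the variance term `C θ K' n` is of order `n^(1/2)`, and `x / θ` is
  -- `n^(1/2+γ)`.
  set θ : ℝ := ((n : ℝ) ^ (1 / 2 : ℝ))⁻¹ with hθ
  have hsq : (n : ℝ) ^ (1 / 2 : ℝ) * (n : ℝ) ^ (1 / 2 : ℝ) = n := by
    rw [← Real.rpow_add hn0]; norm_num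
  have hrpos : 0 < (n : ℝ) ^ (1 / 2 : ℝ) := Real.rpow_pos_of_pos hn0 _
  have hθpos : 0 < θ := inv_pos.2 hrpos
  have hθle : θ ≤ θ₀ := inv_le_of_inv_le₀ hθ₀pos hnθ
  set x : ℝ := (n : ℝ) ^ γ with hx
  have hx1 : 1 ≤ x := Real.one_le_rpow hn1' hγ.le
  have hsplit : (n : ℝ) ^ (1 / 2 + γ) = (n : ℝ) ^ (1 / 2 : ℝ) * x := Real.rpow_add hn0 _ _
  have hr1 : 1 ≤ (n : ℝ) ^ (1 / 2 : ℝ) := Real.one_le_rpow hn1' (by norm_num)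
  set δ₀ : ℝ := C * θ * (K' * n : ℕ) + x / θ with hδ₀
  have hδ₀' : δ₀ = C * K' * (n : ℝ) ^ (1 / 2 : ℝ) + (n : ℝ) ^ (1 / 2 : ℝ) * x := by
    have hθn : θ * n = (n : ℝ) ^ (1 / 2 : ℝ) := by
      rw [hθ, inv_mul_eq_iff_eq_mul₀ hrpos.ne']
      exact hsq.symm
    rw [hδ₀, show x / θ = (n : ℝ) ^ (1 / 2 : ℝ) * x by rw [hθ, div_inv_eq_mul, mul_comm]]
    push_cast
    linear_combination (C * K') * hθn
  have hCK : 0 ≤ C * K' := mul_nonneg hCpos (Nat.cast_nonneg _)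
  have hδle : A * (1 + δ₀) ≤ D * (n : ℝ) ^ (1 / 2 + γ) := by
    rw [hD, mul_assoc A, hδ₀', hsplit]
    refine mul_le_mul_of_nonneg_left ?_ hApos
    have e1 : (n : ℝ) ^ (1 / 2 : ℝ) ≤ (n : ℝ) ^ (1 / 2 : ℝ) * x := le_mul_of_one_le_right hrpos.le hx1
    have e2 := mul_le_mul_of_nonneg_left e1 hCK
    nlinarith
  have hlarge : ∀ j, (1 + m j) * (K * n : ℕ) + A * (1 + δ₀) < (K' * n : ℕ) := by
    intro j
    have h1 : (1 + m j) * (K * n : ℕ) ≤ (1 + m 0 + m 1) * K * n := by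
      push_cast
      rw [← mul_assoc]
      refine mul_le_mul_of_nonneg_right (mul_le_mul_of_nonneg_right ?_ (Nat.cast_nonneg _)) hn0.le
      rcases ZMod.two_eq_zero_or_one j with rfl | rfl <;> linarith [hm 0, hm 1]
    have h2 := mul_le_mul_of_nonneg_right hK' hn0.le
    have h3 : 0 < (n : ℝ) ^ (1 / 2 + γ) := Real.rpow_pos_of_pos hn0 _
    rw [Real.rpow_one] at hnD
    push_cast at h1 ⊢
    linarith
  have hsub : {Y | forestSet Y ∉ GoodForest m i (K * n) (D * (n : ℝ) ^ (1 / 2 + γ))}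
      ⊆ {Y | ∃ s ≤ K' * n, ∃ j, δ₀
        < |(offspringCount (i + 1) j Y s : ℝ) - m j * visitCount (i + 1) j Y s|} := by
    intro Y hY
    by_contra hcon
    simp only [Set.mem_ofPred_eq, not_exists, not_and, not_lt] at hcon
    exact hY (GoodForest.mono hδle (forestSet_mem_goodForest hm hm1 hcon hlarge))
  refine (measure_mono hsub).trans
    ((measure_exists_abs_offspringCount_gt hq hCpos hθpos hθle (i + 1) (K' * n) x).trans ?_)
  rw [ENNReal.ofReal_mul (by positivity), ← mul_assoc]
  refine mul_le_mul_left ?_ _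
  rw [← ENNReal.ofReal_natCast, show (4 : ENNReal) = ENNReal.ofReal 4 by simp,
    ← ENNReal.ofReal_mul (by norm_num)]
  refine ENNReal.ofReal_le_ofReal ?_
  push_cast
  nlinarith

/-! ### Derivation of the deviation bounds -/

theorem gwTree_le_of_fringe {μ : ZMod 2 → PMF ℕ} {i : ZMod 2} {B : Set (Set Word)}
    (hB : MeasurableSet B) {G : Set (Set Word)}
    (h : ∀ f, [] ∉ f → fringe f [0] ∈ B → f ∉ G) :
    gwTree μ i B ≤ wordLaw μ (i + 1) {Y | forestSet Y ∉ G} := by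
  rw [gwTree_eq_map_fringe, Measure.map_apply (measurable_fringe [0]) hB, gwForest_eq_map,
    Measure.map_apply measurable_forestSet (measurable_fringe [0] hB)]
  exact measure_mono fun Y hY => h _ (fun h => h.1 rfl) hY

/-- Conditioning costs at most the inverse of a probability that `hlow` bounds below by
`exp(-n^(r/2))`, whereas atypical forests have probability about `exp(-n^r)`. -/
theorem deviation_of_lower_bound {μ : ZMod 2 → PMF ℕ} (hcrit : Critical μ)
    (hexp : ∀ i, HasExpMoment (μ i)) {γ : ℝ} (hγ : 0 < γ)
    (hlow : ∀ ρ : ℝ, 0 < ρ → ∀ i c : ZMod 2, ∀ᶠ n : ℕ in atTop,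
      gwTree μ i {t | (treeType i c t).encard = n} = 0 ∨
      ENNReal.ofReal (Real.exp (-(n : ℝ) ^ ρ))
        ≤ gwTree μ i {t | (treeType i c t).encard = n}) :
    ∃ ε : ℝ, 0 < ε ∧ ∀ i j : ZMod 2,
      (∀ᶠ n : ℕ in atTop,
        gwForest μ i
          {f | (n : ℝ) ^ (1 / 2 + γ) < ⨆ k : Fin (n + 1),
            |(forestG i j f k : ℝ) - (1 + mean (μ j)) * (k : ℕ)|}
          ≤ ENNReal.ofReal (Real.exp (-(n : ℝ) ^ ε))) ∧
      ∀ c : ZMod 2, ∀ᶠ n : ℕ in atTop,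
        ProbabilityTheory.cond (gwTree μ i)
          {t | (treeType i c t).encard = n}
          {t | (n : ℝ) ^ (1 / 2 + γ) < ⨆ k : Fin ((treeType i j t).ncard + 1),
            |(treeG i j t k : ℝ) - (1 + mean (μ j)) * (k : ℕ)|}
          ≤ ENNReal.ofReal (Real.exp (-(n : ℝ) ^ ε)) := by
  set m : ZMod 2 → ℝ := fun j => mean (μ j) with hmdef
  have hm : ∀ j, 0 ≤ m j := fun j => mean_nonneg _
  -- Strictly below `γ`, to absorb multiplicative constants in the deviation, and at most `1 / 4`,
  -- as required by `wordLaw_goodForest_compl_le`.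
  set r : ℝ := min (γ / 2) (1 / 4) with hr
  have hr0 : 0 < r := lt_min (half_pos hγ) (by norm_num)
  have hrγ : r < γ := (min_le_left _ _).trans_lt (half_lt_self hγ)
  -- A tree with `n` vertices of type `c` in a good forest has at most `K * n` vertices, so every
  -- rank in it is covered.
  obtain ⟨K, hK⟩ := exists_nat_ge (1 + m 0 + m 1 + 1)
  have hmK : ∀ j, 1 + m j + 1 ≤ K := by
    intro j
    rcases ZMod.two_eq_zero_or_one j with rfl | rfl <;> linarith [hm 0, hm 1]
  have hK1 : 1 ≤ K := by
    have : (1 : ℝ) ≤ K := by linarith [hmK 0, hm 0]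
    exact_mod_cast this
  obtain ⟨D, D', hprob⟩ := wordLaw_goodForest_compl_le hcrit hexp hr0 (min_le_right _ _) K
  refine ⟨r / 4, by positivity, fun i j => ⟨?_, fun c => ?_⟩⟩
  · filter_upwards [hprob, eventually_mul_exp_neg_rpow_le D' hr0,
      eventually_const_mul_rpow_le D (show 1 / 2 + r < 1 / 2 + γ by linarith)] with n h1 h2 h3
    have hsub : {f | (n : ℝ) ^ (1 / 2 + γ) < ⨆ k : Fin (n + 1),
            |(forestG i j f k : ℝ) - (1 + mean (μ j)) * (k : ℕ)|}
        ⊆ (GoodForest m i (K * n) (D * (n : ℝ) ^ (1 / 2 + r)))ᶜ := by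
      intro f hf hgood
      have hf' : (n : ℝ) ^ (1 / 2 + γ) < ⨆ k : Fin (n + 1),
        |(forestG i j f k : ℝ) - (1 + mean (μ j)) * (k : ℕ)| := hf
      refine absurd hf' (not_lt.2 (ciSup_le fun k => ?_))
      exact (GoodForest.abs_forestG_sub_le hgood ((Nat.lt_succ_iff.1 k.2).trans
        (Nat.le_mul_of_pos_left n hK1))).trans h3
    refine (measure_mono hsub).trans ?_
    rw [gwForest_eq_map, Measure.map_apply measurable_forestSet
      (measurableSet_goodForest m i _ _).compl]
    refine (h1 i).trans (ENNReal.ofReal_le_ofReal (h2.trans ?_))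
    refine mul_le_of_le_one_right (Real.exp_pos _).le (Real.exp_le_one_iff.2 ?_)
    exact neg_nonpos.2 (Real.rpow_nonneg (Nat.cast_nonneg n) _)
  · filter_upwards [hprob, eventually_mul_exp_neg_rpow_le D' hr0,
      eventually_const_mul_rpow_le (D + (1 + m j)) (show 1 / 2 + r < 1 / 2 + γ by linarith),
      eventually_const_mul_rpow_le D (show 1 / 2 + r < 1 by
        linarith [min_le_right (γ / 2) (1 / 4 : ℝ)]),
      hlow (r / 2) (half_pos hr0) i c, eventually_ge_atTop 1] with n h1 h2 h3 h4 h5 h6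
    set s : Set (Set Word) := {t | (treeType i c t).encard = n} with hs
    have hsm : MeasurableSet s := measurableSet_encard_treeType_eq i c n
    set bad : Set (Set Word) := {t | (n : ℝ) ^ (1 / 2 + γ) < ⨆ k : Fin ((treeType i j t).ncard + 1),
            |(treeG i j t k : ℝ) - (1 + mean (μ j)) * (k : ℕ)|} with hbad
    rw [cond_apply hsm]
    rcases h5 with h5 | h5
    · rw [measure_mono_null Set.inter_subset_left h5, mul_zero]
      exact zero_le
    -- A measurable set containing the event: adding all infinite trees of `s` leaves a set of
    -- finite trees, measurable by countability. The added trees are excluded in a good forest.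
    · set B : Set (Set Word) := (s ∩ {t | t.Finite}ᶜ) ∪ (s ∩ bad ∩ {t | t.Finite}) with hB
      have hBm : MeasurableSet B := by
        refine (hsm.inter (measurableSet_of_forall_finite fun t ht => ht).compl).union
          (measurableSet_of_forall_finite fun t ht => ht.2)
      have hsubB : s ∩ bad ⊆ B := by
        intro t ht
        by_cases hfin : t.Finite
        · exact Or.inr ⟨ht, hfin⟩
        · exact Or.inl ⟨ht.1, hfin⟩
      have hn1 : (1 : ℝ) ≤ n := by exact_mod_cast h6
      have hle : gwTree μ i (s ∩ bad) ≤ ENNReal.ofReal (D' * n * Real.exp (-(n : ℝ) ^ r)) := by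
        refine (measure_mono hsubB).trans ((gwTree_le_of_fringe hBm ?_).trans (h1 i))
        intro f hnil hfB hgood
        have hfs : (treeType i c (fringe f [0])).encard = n := by
          rcases hfB with h | h
          · exact h.1
          · exact h.1.1
        have hn' : (1 + m c) * n + D * (n : ℝ) ^ (1 / 2 + r) ≤ (K * n : ℕ) := by
          have := mul_le_mul_of_nonneg_right (hmK c) (Nat.cast_nonneg (α := ℝ) n)
          rw [Real.rpow_one] at h4
          push_cast
          linarith
        obtain ⟨hfin, hbd⟩ := GoodForest.abs_treeG_sub_le hm hgood hnil hfs hn'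
        rcases hfB with h | h
        · exact h.2 hfin
        · have hb : (n : ℝ) ^ (1 / 2 + γ) < ⨆ k : Fin ((treeType i j (fringe f [0])).ncard + 1),
              |(treeG i j (fringe f [0]) k : ℝ) - (1 + mean (μ j)) * (k : ℕ)| := h.1.2
          refine absurd hb (not_lt.2 (ciSup_le fun k => ?_))
          refine (hbd j k (Nat.lt_succ_iff.1 k.2)).trans (le_trans ?_ h3)
          have hone : 1 ≤ (n : ℝ) ^ (1 / 2 + r) := Real.one_le_rpow hn1 (by linarith)
          have := le_mul_of_one_le_right (show 0 ≤ 1 + m j by linarith [hm j]) hone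
          linarith
      calc (gwTree μ i s)⁻¹ * gwTree μ i (s ∩ bad)
          ≤ (ENNReal.ofReal (Real.exp (-(n : ℝ) ^ (r / 2))))⁻¹
            * ENNReal.ofReal (Real.exp (-(n : ℝ) ^ (r / 4)) * Real.exp (-(n : ℝ) ^ (r / 2))) :=
            mul_le_mul' (ENNReal.inv_le_inv.2 h5) (hle.trans (ENNReal.ofReal_le_ofReal h2))
        _ = ENNReal.ofReal (Real.exp (-(n : ℝ) ^ (r / 4))) := by
            rw [← ENNReal.ofReal_inv_of_pos (Real.exp_pos _),
              ← ENNReal.ofReal_mul (inv_nonneg.2 (Real.exp_pos _).le)]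
            congr 1
            field_simp

/-! ### Sums of independent variables -/

/-- The law of `n` independent variables with law `ν`. -/
noncomputable def iidLaw (ν : PMF ℕ) (n : ℕ) : Measure (Fin n → ℕ) :=
  Measure.pi fun _ => ν.toMeasure

instance (ν : PMF ℕ) (n : ℕ) : IsProbabilityMeasure (iidLaw ν n) := by
  unfold iidLaw; infer_instance

/-- The set of sequences with sum `y`. -/
def sumEq (n : ℕ) (y : ℤ) : Set (Fin n → ℕ) := {x | ∑ l, (x l : ℤ) = y}

/-- The probability that the sum of `n` independent variables with law `ν` is `y`. -/
noncomputable def sumProb (ν : PMF ℕ) (n : ℕ) (y : ℤ) : ℝ := (iidLaw ν n).real (sumEq n y)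

theorem sumProb_nonneg (ν : PMF ℕ) (n : ℕ) (y : ℤ) : 0 ≤ sumProb ν n y := measureReal_nonneg

theorem iidLaw_coord_inter (ν : PMF ℕ) (n : ℕ) (l : Fin (n + 1)) (a : ℕ) (y : ℤ) :
    iidLaw ν (n + 1) ({x | x l = a} ∩ sumEq (n + 1) y) = ν a * iidLaw ν n (sumEq n (y - a)) := by
  have h := measurePreserving_piFinSuccAbove (fun _ : Fin (n + 1) => ν.toMeasure) l
  have hpre : {x : Fin (n + 1) → ℕ | x l = a} ∩ sumEq (n + 1) y
      = (MeasurableEquiv.piFinSuccAbove (fun _ => ℕ) l) ⁻¹' ({a} ×ˢ sumEq n (y - a)) := by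
    ext x
    simp only [sumEq, Set.mem_inter_iff, Set.mem_ofPred_eq, Set.mem_preimage, Set.mem_prod,
      Set.mem_singleton_iff, MeasurableEquiv.piFinSuccAbove_apply, Fin.insertNthEquiv_symm_apply,
      Fin.removeNth, Fin.sum_univ_succAbove _ l]
    refine and_congr_right fun hx => ?_
    rw [hx]
    constructor <;> intro h <;> linarith
  unfold iidLaw
  rw [hpre, h.measure_preimage (MeasurableSet.of_discrete).nullMeasurableSet, Measure.prod_prod,
    PMF.toMeasure_apply_singleton ν a (measurableSet_singleton a)]

theorem iidLaw_coord_inter_real (ν : PMF ℕ) (n : ℕ) (l : Fin (n + 1)) (a : ℕ) (y : ℤ) :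
    (iidLaw ν (n + 1)).real ({x | x l = a} ∩ sumEq (n + 1) y)
      = (ν a).toReal * sumProb ν n (y - a) := by
  rw [measureReal_def, iidLaw_coord_inter, ENNReal.toReal_mul]
  rfl

/-- The number of occurrences of `a`. -/
noncomputable def occ {n : ℕ} (a : ℕ) (x : Fin n → ℕ) : ℝ :=
  ∑ l, {x : Fin n → ℕ | x l = a}.indicator 1 x

theorem occ_nonneg {n : ℕ} (a : ℕ) (x : Fin n → ℕ) : 0 ≤ occ a x :=
  Finset.sum_nonneg fun _ _ => Set.indicator_nonneg (fun _ _ => zero_le_one) x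

theorem occ_le {n : ℕ} (a : ℕ) (x : Fin n → ℕ) : occ a x ≤ n := by
  refine (Finset.sum_le_card_nsmul _ _ 1 fun _ _ => ?_).trans (by simp)
  exact Set.indicator_le_self' (fun _ _ => zero_le_one) x

theorem integrable_iidLaw_of_bounded (ν : PMF ℕ) (n : ℕ) {f : (Fin n → ℕ) → ℝ} {B : ℝ}
    (h : ∀ x, |f x| ≤ B) : Integrable f (iidLaw ν n) :=
  Integrable.of_bound (measurable_of_countable f).aestronglyMeasurable B
    (Eventually.of_forall h)

/-- Each of the `n + 1` coordinates contributes equally: deleting a coordinate equal to `a` leaves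
`n` variables with sum `y - a`. -/
theorem setIntegral_occ (ν : PMF ℕ) (n : ℕ) (a : ℕ) (y : ℤ) :
    ∫ x in sumEq (n + 1) y, occ a x ∂iidLaw ν (n + 1)
      = (n + 1 : ℕ) * ((ν a).toReal * sumProb ν n (y - a)) := by
  have hint : ∀ l : Fin (n + 1), Integrable
      ({x : Fin (n + 1) → ℕ | x l = a}.indicator (1 : (Fin (n + 1) → ℕ) → ℝ)) (iidLaw ν (n + 1)) :=
    fun l => (integrable_const (1 : ℝ)).indicator MeasurableSet.of_discrete
  unfold occ
  rw [integral_finsetSum _ fun l _ => (hint l).integrableOn]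
  have : ∀ l ∈ (Finset.univ : Finset (Fin (n + 1))),
      ∫ x in sumEq (n + 1) y, {x : Fin (n + 1) → ℕ | x l = a}.indicator (1 : (Fin (n + 1) → ℕ) → ℝ) x
        ∂iidLaw ν (n + 1) = (ν a).toReal * sumProb ν n (y - a) := by
    intro l _
    rw [integral_indicator_one MeasurableSet.of_discrete,
      measureReal_restrict_apply MeasurableSet.of_discrete, iidLaw_coord_inter_real]
  rw [Finset.sum_congr rfl this]
  simp

/-- Hoeffding's inequality for indicators, applied to both tails. -/
theorem iidLaw_occ_deviation (ν : PMF ℕ) (n : ℕ) (a : ℕ) {ε : ℝ} (hε : 0 ≤ ε) :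
    (iidLaw ν n).real {x | ε ≤ |occ a x - n * (ν a).toReal|} ≤ 2 * Real.exp (-2 * ε ^ 2 / n) := by
  set X : Fin n → (Fin n → ℕ) → ℝ :=
    fun l x => ({a} : Set ℕ).indicator 1 (x l) - (ν a).toReal with hX
  have hindep : iIndepFun X (iidLaw ν n) :=
    iIndepFun_pi (μ := fun _ : Fin n => ν.toMeasure)
      (X := fun _ k => ({a} : Set ℕ).indicator 1 k - (ν a).toReal)
      fun _ => (measurable_of_countable _).aemeasurable
  have hmean : ∀ l : Fin n, ∫ x, ({a} : Set ℕ).indicator (1 : ℕ → ℝ) (x l) ∂iidLaw ν n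
      = (ν a).toReal := by
    intro l
    unfold iidLaw
    rw [integral_comp_eval (μ := fun _ : Fin n => ν.toMeasure) (i := l)
      (f := ({a} : Set ℕ).indicator (1 : ℕ → ℝ)) (measurable_of_countable _).aestronglyMeasurable,
      integral_indicator_one (measurableSet_singleton a), measureReal_def,
      PMF.toMeasure_apply_singleton ν a (measurableSet_singleton a)]
  have hsub : ∀ l, HasSubgaussianMGF (X l) ((‖(1 : ℝ) - 0‖₊ / 2) ^ 2) (iidLaw ν n) := by
    intro l
    have h := hasSubgaussianMGF_of_mem_Icc (μ := iidLaw ν n) (a := 0) (b := 1)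
      (X := fun x => ({a} : Set ℕ).indicator (1 : ℕ → ℝ) (x l))
      (measurable_of_countable _).aemeasurable
      (Eventually.of_forall fun x => ⟨Set.indicator_nonneg (fun _ _ => zero_le_one) _,
        Set.indicator_le_self' (fun _ _ => zero_le_one) _⟩)
    rw [hmean l] at h
    exact h
  have hsum : ∀ x : Fin n → ℕ, ∑ l, X l x = occ a x - n * (ν a).toReal := by
    intro x
    simp only [hX, Finset.sum_sub_distrib, Finset.sum_const, Finset.card_univ, Fintype.card_fin,
      nsmul_eq_mul, occ]
    congr 1
  have hexp : -ε ^ 2 / (2 * ((∑ _l : Fin n, (‖(1 : ℝ) - 0‖₊ / 2) ^ 2 : NNReal) : ℝ))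
      = -2 * ε ^ 2 / n := by
    simp only [sub_zero, nnnorm_one, Finset.sum_const, Finset.card_univ, Fintype.card_fin]
    push_cast [nsmul_eq_mul]
    rcases Nat.eq_zero_or_pos n with rfl | hn
    · simp
    · have : (0 : ℝ) < n := by exact_mod_cast hn
      field_simp
  have h1 := HasSubgaussianMGF.measure_sum_ge_le_of_iIndepFun hindep (s := Finset.univ)
    (fun l _ => hsub l) hε
  have h2 := HasSubgaussianMGF.measure_sum_ge_le_of_iIndepFun
    (X := fun l x => -X l x) (hindep.comp (fun _ x => -x) fun _ => measurable_neg)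
    (s := Finset.univ) (fun l _ => (hsub l).neg) hε
  rw [hexp] at h1 h2
  have hset : {x : Fin n → ℕ | ε ≤ |occ a x - n * (ν a).toReal|}
      ⊆ {x | ε ≤ ∑ l, X l x} ∪ {x | ε ≤ ∑ l, -X l x} := by
    intro x hx
    rcases le_abs.1 (show ε ≤ |occ a x - n * (ν a).toReal| from hx) with h | h
    · left
      change ε ≤ ∑ l, X l x
      rwa [hsum]
    · right
      change ε ≤ ∑ l, -X l x
      rwa [Finset.sum_neg_distrib, hsum]
  refine (measureReal_mono hset).trans ((measureReal_union_le _ _).trans ?_)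
  linarith

/-- Conditioning on the sum barely affects the expected number of occurrences of `a`. -/
theorem abs_sumProb_sub_le (ν : PMF ℕ) (n : ℕ) (a : ℕ) (y : ℤ) {ε : ℝ} (hε : 0 ≤ ε) :
    (n + 1 : ℕ) * (ν a).toReal * |sumProb ν n (y - a) - sumProb ν (n + 1) y|
      ≤ ε * sumProb ν (n + 1) y
        + (n + 1 : ℕ) * (2 * Real.exp (-2 * ε ^ 2 / (n + 1 : ℕ))) := by
  set P := iidLaw ν (n + 1) with hP
  set q := (ν a).toReal with hq
  have hq0 : 0 ≤ q := ENNReal.toReal_nonneg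
  have hq1 : q ≤ 1 := ENNReal.toReal_le_of_le_ofReal zero_le_one (by simpa using ν.coe_le_one a)
  set N : ℝ := ((n + 1 : ℕ) : ℝ) with hN
  have hN0 : 0 ≤ N := Nat.cast_nonneg _
  set Dev : Set (Fin (n + 1) → ℕ) := {x | ε ≤ |occ a x - N * q|} with hDev
  have hbound : ∀ x : Fin (n + 1) → ℕ, |occ a x - N * q| ≤ N := by
    intro x
    have h1 := occ_nonneg a x
    have h2 : occ a x ≤ N := occ_le a x
    have h3 : N * q ≤ N := mul_le_of_le_one_right hN0 hq1
    have h4 : 0 ≤ N * q := mul_nonneg hN0 hq0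
    rw [abs_le]; constructor <;> linarith
  have hint : Integrable (fun x => occ a x - N * q) P := integrable_iidLaw_of_bounded ν _ hbound
  have hocc : Integrable (fun x : Fin (n + 1) → ℕ => occ a x) P :=
    integrable_iidLaw_of_bounded ν _ fun x => by
      rw [abs_of_nonneg (occ_nonneg a x)]; exact occ_le a x
  have hindD : Integrable (Dev.indicator fun _ => N) P :=
    (integrable_const N).indicator MeasurableSet.of_discrete
  have h1 : ∫ x in sumEq (n + 1) y, (occ a x - N * q) ∂P
      = N * q * (sumProb ν n (y - a) - sumProb ν (n + 1) y) := by
    rw [integral_sub hocc.integrableOn (integrable_const _), setIntegral_occ, setIntegral_const,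
      smul_eq_mul, ← sumProb.eq_def]
    ring
  -- Off `Dev` the integrand is below `ε`. On `Dev` it is at most `N`, and that part is bounded
  -- without restricting to the prescribed sum.
  have h2 : |∫ x in sumEq (n + 1) y, (occ a x - N * q) ∂P|
      ≤ ∫ x in sumEq (n + 1) y, (ε + Dev.indicator (fun _ => N) x) ∂P := by
    refine (abs_integral_le_integral_abs).trans (integral_mono hint.abs.integrableOn
      ((integrable_const ε).add hindD).integrableOn fun x => ?_)
    by_cases hx : x ∈ Dev
    · simp only [Set.indicator_of_mem hx]
      linarith [hbound x]
    · simp only [Set.indicator_of_notMem hx]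
      have : |occ a x - N * q| < ε := not_le.1 hx
      linarith
  have h3 : ∫ x in sumEq (n + 1) y, (ε + Dev.indicator (fun _ => N) x) ∂P
      ≤ ε * sumProb ν (n + 1) y + N * P.real Dev := by
    rw [integral_add (integrable_const ε) hindD.integrableOn, setIntegral_const, smul_eq_mul,
      ← sumProb.eq_def, mul_comm ε]
    refine add_le_add_right ?_ _
    calc ∫ x in sumEq (n + 1) y, Dev.indicator (fun _ => N) x ∂P
        ≤ ∫ x, Dev.indicator (fun _ => N) x ∂P :=
          setIntegral_le_integral hindD (Eventually.of_forall fun x =>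
            Set.indicator_nonneg (fun _ _ => hN0) x)
      _ = N * P.real Dev := by
          rw [integral_indicator_const _ MeasurableSet.of_discrete, smul_eq_mul, mul_comm]
  have h4 := iidLaw_occ_deviation ν (n + 1) a hε
  calc N * q * |sumProb ν n (y - a) - sumProb ν (n + 1) y|
      = |∫ x in sumEq (n + 1) y, (occ a x - N * q) ∂P| := by
        rw [h1, abs_mul, abs_of_nonneg (mul_nonneg hN0 hq0)]
    _ ≤ _ := h2.trans (h3.trans (add_le_add_right (mul_le_mul_of_nonneg_left h4 hN0) _))

/-! ### Concentration of the sum -/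

theorem lintegral_iidLaw_prod (ν : PMF ℕ) (n : ℕ) (g : ℕ → ENNReal) :
    ∫⁻ x, ∏ l, g (x l) ∂iidLaw ν n = (∑' k, ν k * g k) ^ n := by
  have hindep : iIndepFun (fun (l : Fin n) (x : Fin n → ℕ) => g (x l)) (iidLaw ν n) :=
    iIndepFun_pi (μ := fun _ : Fin n => ν.toMeasure) (X := fun _ => g)
      fun _ => (measurable_of_countable _).aemeasurable
  rw [lintegral_prod_eq_prod_lintegral_of_indepFun Finset.univ _ hindep
    fun l => measurable_of_countable _]
  have : ∀ l : Fin n, ∫⁻ x, g (x l) ∂iidLaw ν n = ∑' k, ν k * g k := by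
    intro l
    rw [← lintegral_toMeasure]
    exact (measurePreserving_eval (fun _ : Fin n => ν.toMeasure) l).lintegral_comp
      (measurable_of_countable g)
  simp [this]

theorem iidLaw_sum_ge_le {ν : PMF ℕ} {m C θ₀ θ : ℝ} (hν : QuadraticMGF ν m C θ₀) (hθ : |θ| ≤ θ₀)
    (n : ℕ) (x : ℝ) :
    iidLaw ν n {z | x ≤ θ * ((∑ l, (z l : ℤ) : ℤ) - m * n)}
      ≤ ENNReal.ofReal (Real.exp (C * θ ^ 2 * n - x)) := by
  set g : ℕ → ENNReal := fun k => ENNReal.ofReal (Real.exp (θ * k))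
  have hmono : {z : Fin n → ℕ | x ≤ θ * ((∑ l, (z l : ℤ) : ℤ) - m * n)}
      ⊆ {z | ENNReal.ofReal (Real.exp (x + θ * m * n)) ≤ ∏ l, g (z l)} := by
    intro z hz
    change x ≤ θ * ((∑ l, (z l : ℤ) : ℤ) - m * n) at hz
    change ENNReal.ofReal _ ≤ _
    rw [← ENNReal.ofReal_prod_of_nonneg fun l _ => (Real.exp_pos _).le, ← Real.exp_sum,
      ← Finset.mul_sum]
    refine ENNReal.ofReal_le_ofReal (Real.exp_le_exp.2 ?_)
    push_cast at hz
    linarith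
  refine (measure_mono hmono).trans ?_
  have h1 := mul_meas_ge_le_lintegral (μ := iidLaw ν n)
    (f := fun z : Fin n → ℕ => ∏ l, g (z l)) (measurable_of_countable _)
    (ENNReal.ofReal (Real.exp (x + θ * m * n)))
  rw [lintegral_iidLaw_prod] at h1
  have h2 := h1.trans (pow_le_pow_left₀ zero_le (hν θ hθ) n)
  rw [← ENNReal.ofReal_pow (Real.exp_pos _).le, ← Real.exp_nat_mul] at h2
  have hpos : ENNReal.ofReal (Real.exp (x + θ * m * n)) ≠ 0 := by simp [Real.exp_pos]
  rw [mul_comm, ← ENNReal.le_div_iff_mul_le (Or.inl hpos) (Or.inl ENNReal.ofReal_ne_top),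
    ← ENNReal.ofReal_div_of_pos (Real.exp_pos _), ← Real.exp_sub] at h2
  refine h2.trans (ENNReal.ofReal_le_ofReal (Real.exp_le_exp.2 (le_of_eq ?_)))
  ring

/-- Two tails of mass at most `1/5` leave mass `3/5` on at most `3n` integers; if each carried less
than `1/(6n)`, their total would not exceed `1/2`. -/
theorem eventually_exists_sumProb_ge {ν : PMF ℕ} {C θ₀ : ℝ} (hθ₀ : 0 < θ₀)
    (hν : QuadraticMGF ν 1 C θ₀) {β : ℝ} (hβ : 1 / 2 < β) (hβ1 : β < 1) :
    ∀ᶠ n : ℕ in atTop, ∃ y : ℤ, |(y : ℝ) - n| ≤ (n : ℝ) ^ β ∧ 1 / (6 * n) ≤ sumProb ν n y := by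
  filter_upwards [eventually_ge_atTop 1,
    (tendsto_natCast_rpow (r := 1 / 2) (by norm_num)).eventually_ge_atTop θ₀⁻¹,
    eventually_const_mul_rpow_le 1 hβ1,
    (tendsto_natCast_rpow (sub_pos.2 hβ)).eventually_ge_atTop (|C| + 4)]
    with n hn1 hnθ hβn hlarge
  have hn0 : (0 : ℝ) < n := by exact_mod_cast hn1
  have hn1' : (1 : ℝ) ≤ n := by exact_mod_cast hn1
  rw [one_mul, Real.rpow_one] at hβn
  set r : ℝ := (n : ℝ) ^ (1 / 2 : ℝ) with hr
  have hsq : r * r = n := by rw [hr, ← Real.rpow_add hn0]; norm_num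
  have hrpos : 0 < r := Real.rpow_pos_of_pos hn0 _
  set θ : ℝ := r⁻¹ with hθ
  have hθpos : 0 < θ := inv_pos.2 hrpos
  have hθle : θ ≤ θ₀ := inv_le_of_inv_le₀ hθ₀ hnθ
  have hθn : θ ^ 2 * n = 1 := by rw [hθ, ← hsq]; field_simp
  set lam : ℝ := (n : ℝ) ^ β with hlam
  -- Since `θ² n = 1`, the Chernoff exponent is `C - θ * lam ≤ -4`.
  have hθlam : |C| + 4 ≤ θ * lam := by
    refine hlarge.trans (le_of_eq ?_)
    rw [hθ, hlam, hr, ← Real.rpow_neg hn0.le, ← Real.rpow_add hn0]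
    ring_nf
  have hexp4 : Real.exp (-4) ≤ 1 / 5 := by
    rw [Real.exp_neg, one_div]
    exact inv_anti₀ (by norm_num) (by linarith [Real.add_one_le_exp (4 : ℝ)])
  have htail : ∀ θ' : ℝ, |θ'| = θ →
      (iidLaw ν n).real {z | θ * lam ≤ θ' * ((∑ l, (z l : ℤ) : ℤ) - 1 * n)} ≤ 1 / 5 := by
    intro θ' hθ'
    refine (ENNReal.toReal_le_of_le_ofReal (Real.exp_pos _).le
      (iidLaw_sum_ge_le hν (hθ'.le.trans hθle) n (θ * lam))).trans ((Real.exp_le_exp.2 ?_).trans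
        hexp4)
    have : θ' ^ 2 = θ ^ 2 := by rw [← sq_abs, hθ']
    rw [this, mul_assoc, hθn]
    linarith [le_abs_self C]
  by_contra hcon
  push Not at hcon
  set F : ℕ := ⌊lam⌋₊ with hF
  have hFle : (F : ℝ) ≤ lam := Nat.floor_le (Real.rpow_nonneg hn0.le _)
  have hcover : (Set.univ : Set (Fin n → ℕ)) ⊆
      ({z | θ * lam ≤ θ * ((∑ l, (z l : ℤ) : ℤ) - 1 * n)}
        ∪ {z | θ * lam ≤ -θ * ((∑ l, (z l : ℤ) : ℤ) - 1 * n)})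
      ∪ ⋃ y ∈ Finset.Icc ((n : ℤ) - F) (n + F), sumEq n y := by
    intro z _
    by_cases h1 : lam ≤ |((∑ l, (z l : ℤ) : ℤ) : ℝ) - n|
    · left
      rcases le_abs.1 h1 with h | h
      · left
        change θ * lam ≤ θ * _
        refine mul_le_mul_of_nonneg_left ?_ hθpos.le
        linarith
      · right
        change θ * lam ≤ -θ * _
        rw [neg_mul, ← mul_neg]
        refine mul_le_mul_of_nonneg_left ?_ hθpos.le
        linarith
    · right
      refine Set.mem_biUnion (x := ∑ l, (z l : ℤ)) ?_ rfl
      have h2 : ((|(∑ l, (z l : ℤ)) - (n : ℤ)| : ℤ) : ℝ) < lam := by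
        push_cast at h1 ⊢; exact not_le.1 h1
      have h3 : |(∑ l, (z l : ℤ)) - (n : ℤ)| ≤ F := by
        have h4 : ((|(∑ l, (z l : ℤ)) - (n : ℤ)|).toNat : ℝ) ≤ lam := by
          have h5 : (((|(∑ l, (z l : ℤ)) - (n : ℤ)|).toNat : ℤ) : ℝ)
              = ((|(∑ l, (z l : ℤ)) - (n : ℤ)| : ℤ) : ℝ) := by
            rw [Int.toNat_of_nonneg (abs_nonneg _)]
          rw [Int.cast_natCast] at h5
          rw [h5]; exact h2.le
        have h6 := Nat.le_floor h4
        omega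
      have h4 := abs_le.1 h3
      simp only [Finset.coe_Icc, Set.mem_Icc]
      constructor <;> linarith
  have h1 : (1 : ℝ) ≤ (1 / 5 + 1 / 5) + ∑ y ∈ Finset.Icc ((n : ℤ) - F) (n + F), sumProb ν n y := by
    calc (1 : ℝ) = (iidLaw ν n).real Set.univ := by simp
      _ ≤ _ := measureReal_mono hcover
      _ ≤ _ := measureReal_union_le _ _
      _ ≤ _ := by
        refine add_le_add ((measureReal_union_le _ _).trans (add_le_add ?_ ?_)) ?_
        · exact htail θ (abs_of_pos hθpos)
        · exact htail (-θ) (by rw [abs_neg, abs_of_pos hθpos])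
        · exact measureReal_biUnion_finset_le _ _
  have h2 : ∑ y ∈ Finset.Icc ((n : ℤ) - F) (n + F), sumProb ν n y ≤ (2 * F + 1) * (1 / (6 * n)) := by
    have h4 : ∑ y ∈ Finset.Icc ((n : ℤ) - F) (n + F), sumProb ν n y
        ≤ (Finset.Icc ((n : ℤ) - F) (n + F)).card • (1 / (6 * n) : ℝ) :=
      Finset.sum_le_card_nsmul _ _ _ fun y hy => ?_
    · refine h4.trans (le_of_eq ?_)
      rw [Int.card_Icc, nsmul_eq_mul]
      congr 1
      rw [show (n : ℤ) + F + 1 - (n - F) = ((2 * F + 1 : ℕ) : ℤ) by push_cast; ring, Int.toNat_natCast]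
      push_cast; ring
    · refine (hcon y ?_).le
      have hy' := Finset.mem_Icc.1 hy
      have : |y - n| ≤ (F : ℤ) := abs_le.2 ⟨by linarith [hy'.1], by linarith [hy'.2]⟩
      have h5 : |(y : ℝ) - n| ≤ F := by exact_mod_cast this
      exact h5.trans hFle
  have h3 : (2 * F + 1) * (1 / (6 * n)) ≤ (1 / 2 : ℝ) := by
    rw [mul_one_div, div_le_iff₀ (by positivity)]
    linarith
  linarith

/-! ### A lower bound in the local limit theorem -/

/-- The threshold `N^(1/2+α)` in `abs_sumProb_sub_le` gives relative error `N^(α-1/2)` after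
division by `N ν(a)`, and additive error `exp(-2 N^(2α))` before constants. -/
theorem exists_abs_sumProb_sub_le (ν : PMF ℕ) {a : ℕ} (ha : ν a ≠ 0) (α : ℝ) :
    ∃ D : ℝ, 0 ≤ D ∧ ∀ N : ℕ, 1 ≤ N → ∀ y : ℤ,
      |sumProb ν (N - 1) (y - a) - sumProb ν N y|
        ≤ D * ((N : ℝ) ^ (α - 1 / 2) * sumProb ν N y + Real.exp (-(N : ℝ) ^ (2 * α))) := by
  set q := (ν a).toReal with hq
  have hq0 : 0 < q := ENNReal.toReal_pos ha (ν.apply_ne_top a)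
  refine ⟨2 / q, by positivity, fun N hN y => ?_⟩
  obtain ⟨n, rfl⟩ : ∃ n, N = n + 1 := ⟨N - 1, by omega⟩
  have hN0 : (0 : ℝ) < ((n + 1 : ℕ) : ℝ) := by positivity
  have h := abs_sumProb_sub_le ν n a y (ε := ((n + 1 : ℕ) : ℝ) ^ (1 / 2 + α))
    (Real.rpow_nonneg hN0.le _)
  rw [Nat.add_sub_cancel]
  set N : ℝ := ((n + 1 : ℕ) : ℝ) with hNdef
  have e1 : N ^ (1 / 2 + α) = N * N ^ (α - 1 / 2) := by
    nth_rewrite 2 [← Real.rpow_one N]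
    rw [← Real.rpow_add hN0]; ring_nf
  have e2 : -2 * (N ^ (1 / 2 + α)) ^ 2 / N = -2 * N ^ (2 * α) := by
    rw [← Real.rpow_natCast, ← Real.rpow_mul hN0.le, mul_div_assoc]
    congr 1
    nth_rewrite 2 [← Real.rpow_one N]
    rw [← Real.rpow_sub hN0]
    congr 1
    push_cast; ring
  rw [e2, e1] at h
  have e3 : Real.exp (-2 * N ^ (2 * α)) ≤ Real.exp (-N ^ (2 * α)) :=
    Real.exp_le_exp.2 (by linarith [Real.rpow_nonneg hN0.le (2 * α)])
  have hp := sumProb_nonneg ν (n + 1) y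
  have hη := Real.rpow_nonneg hN0.le (α - 1 / 2)
  have hp' := mul_nonneg hη hp
  rw [div_mul_eq_mul_div, le_div_iff₀ hq0]
  refine le_of_mul_le_mul_left ?_ hN0
  calc N * (|sumProb ν n (y - a) - sumProb ν (n + 1) y| * q)
      = N * q * |sumProb ν n (y - a) - sumProb ν (n + 1) y| := by ring
    _ ≤ _ := h
    _ ≤ N * (2 * (N ^ (α - 1 / 2) * sumProb ν (n + 1) y + Real.exp (-N ^ (2 * α)))) := by
      have := mul_le_mul_of_nonneg_left e3 hN0.le
      have := mul_nonneg hN0.le hp'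
      linarith

/-- The probabilities of `y` and `y + z` are almost equal, in one direction. -/
def ShiftBound (ν : PMF ℕ) (α : ℝ) (z : ℤ) : Prop :=
  ∃ D : ℝ, 0 ≤ D ∧ ∀ᶠ n : ℕ in atTop, ∀ y : ℤ,
    (1 - D * (n : ℝ) ^ (α - 1 / 2)) * sumProb ν n y - D * Real.exp (-(n : ℝ) ^ (2 * α))
      ≤ sumProb ν n (y + z)

theorem shiftBound_zero (ν : PMF ℕ) (α : ℝ) : ShiftBound ν α 0 :=
  ⟨0, le_rfl, Eventually.of_forall fun n y => by simp⟩

theorem eventually_mul_rpow_le {α : ℝ} (hα : α < 1 / 2) (D : ℝ) {κ : ℝ} (hκ : 0 < κ) :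
    ∀ᶠ n : ℕ in atTop, D * (n : ℝ) ^ (α - 1 / 2) ≤ κ := by
  filter_upwards [eventually_const_mul_rpow_le (D / κ) (show α - 1 / 2 < 0 by linarith)]
    with n hn
  rw [Real.rpow_zero] at hn
  have := mul_le_mul_of_nonneg_left hn hκ.le
  rw [mul_one] at this
  refine le_trans (le_of_eq ?_) this
  field_simp

theorem ShiftBound.add {ν : PMF ℕ} {α : ℝ} (hα : α < 1 / 2) {z z' : ℤ} (h : ShiftBound ν α z)
    (h' : ShiftBound ν α z') : ShiftBound ν α (z + z') := by
  obtain ⟨D, hD, h⟩ := h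
  obtain ⟨D', hD', h'⟩ := h'
  refine ⟨D + D', add_nonneg hD hD', ?_⟩
  filter_upwards [h, h', eventually_mul_rpow_le hα D' one_pos] with n h1 h2 h3 y
  have hη : 0 ≤ (n : ℝ) ^ (α - 1 / 2) := Real.rpow_nonneg (Nat.cast_nonneg n) _
  have h4 := h1 y
  have h5 := h2 (y + z)
  rw [add_assoc] at h5
  have h6 := mul_le_mul_of_nonneg_left h4 (sub_nonneg.2 h3)
  have hp := sumProb_nonneg ν n y
  have he := (Real.exp_pos (-(n : ℝ) ^ (2 * α))).le
  have h7 : 0 ≤ D * (n : ℝ) ^ (α - 1 / 2) * (D' * (n : ℝ) ^ (α - 1 / 2)) * sumProb ν n y := by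
    positivity
  have h8 : 0 ≤ D' * (n : ℝ) ^ (α - 1 / 2) * (D * Real.exp (-(n : ℝ) ^ (2 * α))) := by
    positivity
  nlinarith

/-- Removing one `b` from a sum equal to `y`, or one `a` from a sum equal to `y + a - b`, leads to
the same event for one variable fewer. -/
theorem shiftBound_sub (ν : PMF ℕ) {α : ℝ} (hα : α < 1 / 2) {a b : ℕ} (ha : ν a ≠ 0)
    (hb : ν b ≠ 0) : ShiftBound ν α ((a : ℤ) - b) := by
  obtain ⟨D, hD, h⟩ := exists_abs_sumProb_sub_le ν ha α
  obtain ⟨D', hD', h'⟩ := exists_abs_sumProb_sub_le ν hb α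
  refine ⟨D + D', add_nonneg hD hD', ?_⟩
  filter_upwards [eventually_ge_atTop 1, eventually_mul_rpow_le hα D one_pos] with n hn h3 y
  have h4 := (abs_le.1 (h n hn (y + (a - b)))).2
  have h5 := (abs_le.1 (h' n hn y)).1
  rw [show y + ((a : ℤ) - b) - a = y - b by ring] at h4
  set η := (n : ℝ) ^ (α - 1 / 2)
  set e := Real.exp (-(n : ℝ) ^ (2 * α))
  set p := sumProb ν n y
  set p' := sumProb ν n (y + (a - b))
  have hη : 0 ≤ η := Real.rpow_nonneg (Nat.cast_nonneg n) _
  have he : 0 ≤ e := (Real.exp_pos _).le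
  have hp : 0 ≤ p := sumProb_nonneg _ _ _
  have hp' : 0 ≤ p' := sumProb_nonneg _ _ _
  have h6 : (1 - D' * η) * p - (D + D') * e ≤ (1 + D * η) * p' := by linarith
  have hDη : 0 ≤ D * η := mul_nonneg hD hη
  have h7 : (1 - D * η) * ((1 - D' * η) * p - (D + D') * e) ≤ p' := by
    have h8 := mul_le_mul_of_nonneg_left h6 (sub_nonneg.2 h3)
    have h9 : 0 ≤ D * η * (D * η) * p' := by positivity
    nlinarith
  have h10 : 0 ≤ D * η * (D' * η) * p := by positivity
  have h11 : 0 ≤ D * η * ((D + D') * e) := by positivity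
  nlinarith

/-- The subgroup generated by the differences of elements of the support. -/
def supportSpan (ν : PMF ℕ) : AddSubgroup ℤ :=
  AddSubgroup.closure {z | ∃ a b : ℕ, ν a ≠ 0 ∧ ν b ≠ 0 ∧ z = (a : ℤ) - b}

theorem shiftBound_of_mem_supportSpan (ν : PMF ℕ) {α : ℝ} (hα : α < 1 / 2) {z : ℤ}
    (hz : z ∈ supportSpan ν) : ShiftBound ν α z := by
  -- The bound is one-sided, so both signs are carried through the induction to handle inverses.
  have key : ShiftBound ν α z ∧ ShiftBound ν α (-z) := by
    refine AddSubgroup.closure_induction (p := fun z _ => ShiftBound ν α z ∧ ShiftBound ν α (-z))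
      ?_ ?_ ?_ ?_ hz
    · rintro z ⟨a, b, ha, hb, rfl⟩
      refine ⟨shiftBound_sub ν hα ha hb, ?_⟩
      rw [neg_sub]
      exact shiftBound_sub ν hα hb ha
    · rw [neg_zero]
      exact ⟨shiftBound_zero ν α, shiftBound_zero ν α⟩
    · rintro x y _ _ ⟨h1, h2⟩ ⟨h3, h4⟩
      refine ⟨h1.add hα h3, ?_⟩
      rw [neg_add]
      exact h2.add hα h4
    · rintro x _ ⟨h1, h2⟩
      rw [neg_neg]
      exact ⟨h2, h1⟩
  exact key.1

theorem sumProb_add_nsmul_ge {p : ℤ → ℝ} {η e : ℝ} (hη : 0 ≤ η) (hη1 : η ≤ 1) (he : 0 ≤ e) {z : ℤ}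
    (h : ∀ y, (1 - η) * p y - e ≤ p (y + z)) (y : ℤ) (t : ℕ) :
    (1 - η) ^ t * p y - t * e ≤ p (y + t * z) := by
  induction t with
  | zero => simp
  | succ t ih =>
    have h1 := h (y + t * z)
    have h2 := mul_le_mul_of_nonneg_left ih (sub_nonneg.2 hη1)
    have h3 : 0 ≤ η * (t * e) := by positivity
    rw [show y + ((t + 1 : ℕ) : ℤ) * z = y + t * z + z by push_cast; ring]
    push_cast
    rw [pow_succ]
    nlinarith

theorem exists_sum_eq_of_sumProb_ne_zero {ν : PMF ℕ} {n : ℕ} {y : ℤ} (h : sumProb ν n y ≠ 0) :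
    ∃ x : Fin n → ℕ, (∀ l, ν (x l) ≠ 0) ∧ ∑ l, (x l : ℤ) = y := by
  by_contra hcon
  push Not at hcon
  refine h ?_
  rw [sumProb, measureReal_eq_zero_iff]
  have : sumEq n y = ⋃ x ∈ sumEq n y, {x} := by simp
  rw [this, measure_biUnion_null_iff (Set.to_countable _)]
  intro x hx
  by_contra hne
  refine hcon x (fun l hl => hne ?_) hx
  unfold iidLaw
  rw [Measure.pi_singleton]
  refine Finset.prod_eq_zero (Finset.mem_univ l) ?_
  rw [PMF.toMeasure_apply_singleton ν _ (measurableSet_singleton _), hl]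

theorem sub_mem_supportSpan {ν : PMF ℕ} {a : ℕ} (ha : ν a ≠ 0) {n : ℕ} {y : ℤ}
    (h : sumProb ν n y ≠ 0) : y - n * a ∈ supportSpan ν := by
  obtain ⟨x, hx, rfl⟩ := exists_sum_eq_of_sumProb_ne_zero h
  have : ∑ l, (x l : ℤ) - n * a = ∑ l, ((x l : ℤ) - a) := by
    simp [Finset.sum_sub_distrib]
  rw [this]
  exact AddSubgroup.sum_mem _ fun l _ => AddSubgroup.subset_closure ⟨x l, a, hx l, ha, rfl⟩

theorem exists_supportSpan_eq (ν : PMF ℕ) : ∃ d : ℤ, supportSpan ν = AddSubgroup.zmultiples d := by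
  obtain ⟨d, hd⟩ := Int.subgroup_cyclic (supportSpan ν)
  exact ⟨d, by rw [hd, AddSubgroup.zmultiples_eq_closure]⟩

theorem exp_neg_two_mul_le_one_sub {u : ℝ} (hu0 : 0 ≤ u) (hu : u ≤ 1 / 2) :
    Real.exp (-(2 * u)) ≤ 1 - u := by
  rw [Real.exp_neg]
  refine inv_le_of_inv_le₀ (by linarith) ?_
  have h := Real.add_one_le_exp (2 * u)
  refine le_trans ?_ h
  rw [inv_le_iff_one_le_mul₀ (by linarith)]
  nlinarith

/-- Near its mean, the sum takes each value of the right residue class with a probability that is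
not exponentially small. -/
theorem eventually_exp_neg_rpow_le_sumProb {ν : PMF ℕ} {C θ₀ : ℝ} (hθ₀ : 0 < θ₀)
    (hν : QuadraticMGF ν 1 C θ₀) {a : ℕ} (ha : ν a ≠ 0) {ρ : ℝ} (hρ : 0 < ρ) (B : ℝ) :
    ∀ᶠ n : ℕ in atTop, ∀ y : ℤ, |(y : ℝ) - n| ≤ B → y - n * a ∈ supportSpan ν →
      Real.exp (-(n : ℝ) ^ ρ) ≤ sumProb ν n y := by
  -- `2 * α ≤ ρ` makes the additive error at least the target `exp(-n^ρ)`. Starting within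
  -- `n^(1/2+α/2)` of the mean gives total loss exponent `3 * α / 2`, below the error exponent `2 *
  -- α`.
  set α : ℝ := min (ρ / 2) (1 / 8) with hα
  have hα0 : 0 < α := lt_min (half_pos hρ) (by norm_num)
  have hα8 : α ≤ 1 / 8 := min_le_right _ _
  have hαρ : 2 * α ≤ ρ := by linarith [min_le_left (ρ / 2) (1 / 8 : ℝ)]
  have hα2 : α < 1 / 2 := by linarith
  obtain ⟨d, hd⟩ := exists_supportSpan_eq ν
  have hdmem : d ∈ supportSpan ν := hd ▸ AddSubgroup.mem_zmultiples d
  obtain ⟨D₁, hD₁, h₁⟩ := shiftBound_of_mem_supportSpan ν hα2 hdmem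
  obtain ⟨D₂, hD₂, h₂⟩ := shiftBound_of_mem_supportSpan ν hα2 (neg_mem hdmem)
  set D := max D₁ D₂ with hD
  have hD0 : 0 ≤ D := hD₁.trans (le_max_left _ _)
  have hβ : (1 / 2 : ℝ) < 1 / 2 + α / 2 := by linarith
  have hβ1 : (1 / 2 + α / 2 : ℝ) < 1 := by linarith
  filter_upwards [h₁, h₂, eventually_mul_rpow_le hα2 D (show (0 : ℝ) < 1 / 2 by norm_num),
    eventually_exists_sumProb_ge hθ₀ hν hβ hβ1,
    eventually_const_mul_rpow_le 2 hβ1, eventually_ge_atTop 1,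
    (tendsto_natCast_rpow (show 0 < 1 / 2 + α / 2 by linarith)).eventually_ge_atTop B,
    eventually_const_mul_rpow_le (4 * D + 2) (show 3 * α / 2 < 2 * α by linarith),
    eventually_const_mul_le_exp_rpow 6 (show 0 < 3 * α / 2 by linarith),
    eventually_const_mul_le_exp_rpow (D + 1) (show 0 < 3 * α / 2 by linarith)]
    with n h1 h2 h3 ⟨y₀, hy₀, hp₀⟩ h5 h6 h7 h8 h9 h10 y hy hspan
  have hn0 : (0 : ℝ) < n := by exact_mod_cast h6
  have hn1 : (1 : ℝ) ≤ n := by exact_mod_cast h6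
  set η := (n : ℝ) ^ (α - 1 / 2) with hη
  set e := Real.exp (-(n : ℝ) ^ (2 * α)) with he
  have hη0 : 0 ≤ η := Real.rpow_nonneg hn0.le _
  have he0 : 0 < e := Real.exp_pos _
  have hp₀pos : 0 < sumProb ν n y₀ := lt_of_lt_of_le (by positivity) hp₀
  have hdiff : y - y₀ ∈ supportSpan ν := by
    have := sub_mem hspan (sub_mem_supportSpan ha hp₀pos.ne')
    rwa [sub_sub_sub_cancel_right] at this
  rw [hd, AddSubgroup.mem_zmultiples_iff] at hdiff
  obtain ⟨k, hk⟩ := hdiff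
  rw [smul_eq_mul] at hk
  have hstep : ∀ z, (z = d ∨ z = -d) → ∀ y,
      (1 - D * η) * sumProb ν n y - D * e ≤ sumProb ν n (y + z) := by
    intro z hz y
    have hp := sumProb_nonneg ν n y
    have g1 := mul_le_mul_of_nonneg_right (le_max_left D₁ D₂) (mul_nonneg hη0 hp)
    have g2 := mul_le_mul_of_nonneg_right (le_max_right D₁ D₂) (mul_nonneg hη0 hp)
    have g3 := mul_le_mul_of_nonneg_right (le_max_left D₁ D₂) he0.le
    have g4 := mul_le_mul_of_nonneg_right (le_max_right D₁ D₂) he0.le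
    rcases hz with rfl | rfl
    · have := h1 y
      simp only [hD]; linarith
    · have := h2 y
      simp only [hD]; linarith
  -- The point `y` is reached from `y₀` by steps of the lattice generator `d` or its opposite; when
  -- `d = 0` the two points coincide.
  obtain ⟨t, z, hz, htz, htle⟩ : ∃ (t : ℕ) (z : ℤ), (z = d ∨ z = -d) ∧ y₀ + t * z = y ∧
      (t : ℤ) ≤ |y - y₀| := by
    by_cases hd0 : d = 0
    · subst hd0
      exact ⟨0, 0, Or.inl rfl, by linarith, by simp⟩
    · have habs : (k.natAbs : ℤ) ≤ |y - y₀| := by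
        rw [← hk, abs_mul, Int.natCast_natAbs]
        exact le_mul_of_one_le_right (abs_nonneg _) (Int.one_le_abs hd0)
      rcases Int.natAbs_eq k with h | h
      · exact ⟨k.natAbs, d, Or.inl rfl, by rw [← h]; linarith, habs⟩
      · refine ⟨k.natAbs, -d, Or.inr rfl, ?_, habs⟩
        rw [mul_neg, ← neg_mul, ← h]; linarith
  have hmain := sumProb_add_nsmul_ge (mul_nonneg hD0 hη0) (by linarith) (mul_nonneg hD0 he0.le)
    (hstep z hz) y₀ t
  rw [htz] at hmain
  have htR : (t : ℝ) ≤ 2 * (n : ℝ) ^ (1 / 2 + α / 2) := by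
    have h11 : (t : ℝ) ≤ |(y : ℝ) - y₀| := by exact_mod_cast htle
    have h12 : |(y : ℝ) - y₀| ≤ |(y : ℝ) - n| + |(y₀ : ℝ) - n| := by
      rw [abs_sub_comm (y₀ : ℝ)]; exact abs_sub_le _ _ _
    linarith
  have htn : (t : ℝ) ≤ n := by
    rw [Real.rpow_one] at h5; linarith
  set w := (n : ℝ) ^ (3 * α / 2) with hw
  have htη : t * η ≤ 2 * w := by
    calc t * η ≤ 2 * (n : ℝ) ^ (1 / 2 + α / 2) * η := mul_le_mul_of_nonneg_right htR hη0
      _ = 2 * w := by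
        rw [mul_assoc, hη, ← Real.rpow_add hn0, hw]; ring_nf
  have hpow : Real.exp (-(4 * D * w)) ≤ (1 - D * η) ^ t := by
    calc Real.exp (-(4 * D * w)) ≤ Real.exp (t * (-(2 * (D * η)))) := by
          refine Real.exp_le_exp.2 ?_
          have := mul_le_mul_of_nonneg_left htη hD0
          nlinarith
      _ = Real.exp (-(2 * (D * η))) ^ t := Real.exp_nat_mul _ _
      _ ≤ _ := pow_le_pow_left₀ (Real.exp_pos _).le
          (exp_neg_two_mul_le_one_sub (mul_nonneg hD0 hη0) h3) t
  have hE : Real.exp (-(4 * D * w)) * Real.exp (-w) ≤ (1 - D * η) ^ t * sumProb ν n y₀ := by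
    refine mul_le_mul hpow (le_trans ?_ hp₀) (Real.exp_pos _).le ((Real.exp_pos _).le.trans hpow)
    rw [Real.exp_neg, ← one_div]
    exact one_div_le_one_div_of_le (by positivity) h9
  -- The transported main term exceeds the accumulated error `t * D * e` by at least one more `e`,
  -- which is what remains in the end.
  have hfinal : (t * D + 1) * e ≤ Real.exp (-(4 * D * w)) * Real.exp (-w) := by
    have g1 : t * D + 1 ≤ Real.exp w := by
      have := mul_le_mul_of_nonneg_right htn hD0
      linarith
    calc (t * D + 1) * e ≤ Real.exp w * e := mul_le_mul_of_nonneg_right g1 he0.le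
      _ ≤ _ := by
        rw [he, ← Real.exp_add, ← Real.exp_add]
        exact Real.exp_le_exp.2 (by linarith)
  have hlast : Real.exp (-(n : ℝ) ^ ρ) ≤ e := by
    refine Real.exp_le_exp.2 (neg_le_neg ?_)
    exact Real.rpow_le_rpow_of_exponent_le hn1 hαρ
  nlinarith

/-! ### First passage times and cyclic rotations -/

/-- A finite sequence extended by zeros. -/
def extend {n : ℕ} (x : Fin n → ℕ) (l : ℕ) : ℕ := if h : l < n then x ⟨l, h⟩ else 0

/-- The partial sums of a finite sequence. -/
def partialSum {n : ℕ} (x : Fin n → ℕ) (m : ℕ) : ℕ := ∑ l ∈ Finset.range m, extend x l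

/-- The sequences for which the walk with steps `x l - 1` started from `k` first reaches `0` at
time `n`. -/
def firstPassage (n k : ℕ) : Set (Fin n → ℕ) :=
  {x | k + partialSum x n = n ∧ ∀ m < n, m < k + partialSum x m}

theorem partialSum_self {n : ℕ} (x : Fin n → ℕ) : partialSum x n = ∑ l, x l := by
  rw [partialSum, Finset.sum_range]
  exact Finset.sum_congr rfl fun l _ => by simp [extend]

theorem partialSum_succ {n : ℕ} (x : Fin (n + 1) → ℕ) (m : ℕ) :
    partialSum x (m + 1) = x 0 + partialSum (fun l : Fin n => x l.succ) m := by
  rw [partialSum, Finset.sum_range_succ', add_comm, partialSum]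
  congr 1
  refine Finset.sum_congr rfl fun l _ => ?_
  unfold extend
  by_cases h : l < n
  · rw [dif_pos h, dif_pos (Nat.succ_lt_succ h)]; rfl
  · rw [dif_neg h, dif_neg (fun h' => h (Nat.lt_of_succ_lt_succ h'))]

theorem mem_firstPassage_succ {n k : ℕ} (x : Fin (n + 1) → ℕ) :
    x ∈ firstPassage (n + 1) (k + 1) ↔ (fun l : Fin n => x l.succ) ∈ firstPassage n (k + x 0) := by
  unfold firstPassage
  simp only [Set.mem_ofPred_eq, partialSum_succ]
  refine and_congr ⟨fun h => by omega, fun h => by omega⟩ ⟨fun h m hm => ?_, fun h m hm => ?_⟩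
  · have := h (m + 1) (by omega)
    rw [partialSum_succ] at this
    omega
  · rcases m with _ | m
    · omega
    · have := h m (by omega)
      rw [partialSum_succ]
      omega

/-- The probability that the walk with steps of law `ν` minus one first goes from `k` to `0` at
time `n`. -/
noncomputable def passageProb (ν : PMF ℕ) (n k : ℕ) : ENNReal := iidLaw ν n (firstPassage n k)

theorem passageProb_zero_zero (ν : PMF ℕ) : passageProb ν 0 0 = 1 := by
  have : firstPassage 0 0 = Set.univ := by ext x; simp [firstPassage, partialSum]
  rw [passageProb, this, measure_univ]

theorem passageProb_zero_succ (ν : PMF ℕ) (k : ℕ) : passageProb ν 0 (k + 1) = 0 := by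
  have : firstPassage 0 (k + 1) = ∅ := by ext x; simp [firstPassage]
  rw [passageProb, this, measure_empty]

theorem passageProb_succ_zero (ν : PMF ℕ) (n : ℕ) : passageProb ν (n + 1) 0 = 0 := by
  have : firstPassage (n + 1) 0 = ∅ := by
    ext x
    simp only [firstPassage, Set.mem_ofPred_eq, Set.mem_empty_iff_false, iff_false]
    rintro ⟨-, h⟩
    simpa [partialSum] using h 0 (Nat.succ_pos n)
  rw [passageProb, this, measure_empty]

/-- Decomposition at the first step. The same recursion governs `countProb`, which is how the two
are identified. -/
theorem passageProb_succ_succ (ν : PMF ℕ) (n k : ℕ) :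
    passageProb ν (n + 1) (k + 1) = ∑' a, ν a * passageProb ν n (k + a) := by
  have h := measurePreserving_piFinSuccAbove (fun _ : Fin (n + 1) => ν.toMeasure) 0
  have hpre : firstPassage (n + 1) (k + 1)
      = (MeasurableEquiv.piFinSuccAbove (fun _ => ℕ) 0) ⁻¹'
        {p : ℕ × (Fin n → ℕ) | p.2 ∈ firstPassage n (k + p.1)} := by
    ext x
    rw [mem_firstPassage_succ]
    rfl
  unfold passageProb
  conv_lhs => unfold iidLaw
  rw [hpre, h.measure_preimage (MeasurableSet.of_discrete).nullMeasurableSet,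
    Measure.prod_apply MeasurableSet.of_discrete, lintegral_toMeasure]
  rfl

theorem firstPassage_subset (n k : ℕ) : firstPassage n k ⊆ sumEq n ((n : ℤ) - k) := by
  intro x hx
  have h := hx.1
  rw [partialSum_self] at h
  change ∑ l, (x l : ℤ) = n - k
  have h' : (k : ℤ) + ∑ l, (x l : ℤ) = n := by exact_mod_cast h
  linarith

/-- A periodic integer sequence minus a linear drift has a rotation which stays above its final
value. -/
theorem exists_rotation {n k : ℕ} (hn : 0 < n) (hk : 0 < k) {T : ℕ → ℤ}
    (hT : ∀ m, T (m + n) = T m - k) : ∃ r < n, ∀ m < n, T r - k < T (m + r) := by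
  obtain ⟨r₀, hr₀, hmin⟩ := Finset.exists_min_image (Finset.range n) T
    ⟨0, Finset.mem_range.2 hn⟩
  have hex : ∃ r, r < n ∧ T r = T r₀ := ⟨r₀, Finset.mem_range.1 hr₀, rfl⟩
  classical
  obtain ⟨hr, hTr⟩ := Nat.find_spec hex
  -- The rotation starts at the first minimum over a period; being first gives strictness after the
  -- wrap-around, where the drift has been subtracted.
  have hfirst : ∀ q < Nat.find hex, T (Nat.find hex) < T q := by
    intro q hq
    have hqn := hq.trans hr
    have h1 := hmin q (Finset.mem_range.2 hqn)
    have h2 : T q ≠ T r₀ := fun h => Nat.find_min hex hq ⟨hqn, h⟩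
    rw [hTr]
    exact lt_of_le_of_ne h1 h2.symm
  refine ⟨Nat.find hex, hr, fun m hm => ?_⟩
  generalize Nat.find hex = r at *
  have hk' : (0 : ℤ) < k := by exact_mod_cast hk
  rcases lt_or_ge (m + r) n with h | h
  · have := hmin (m + r) (Finset.mem_range.2 h)
    linarith
  · have h1 := hT (m + r - n)
    rw [Nat.sub_add_cancel h] at h1
    have h2 := hfirst (m + r - n) (by omega)
    linarith

theorem exists_rotation_mem_firstPassage {n k : ℕ} (hk : 0 < k) {x : Fin (n + 1) → ℕ}
    (hx : x ∈ sumEq (n + 1) (((n + 1 : ℕ) : ℤ) - k)) :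
    ∃ r : Fin (n + 1), (fun l => x (l + r)) ∈ firstPassage (n + 1) k := by
  set X : ℕ → ℕ := fun l => x ⟨l % (n + 1), Nat.mod_lt _ (Nat.succ_pos n)⟩ with hX
  have hXper : ∀ l, X (l + (n + 1)) = X l := fun l => by simp [hX]
  set S : ℕ → ℕ := fun m => ∑ l ∈ Finset.range m, X l with hS
  have hSn : (S (n + 1) : ℤ) = ((n + 1 : ℕ) : ℤ) - k := by
    have h1 : S (n + 1) = ∑ l, x l := by
      simp only [hS]
      rw [Finset.sum_range]
      refine Finset.sum_congr rfl fun l _ => ?_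
      simp only [hX]
      congr 1
      exact Fin.ext (Nat.mod_eq_of_lt l.2)
    rw [h1]
    push_cast
    exact hx
  have hSadd : ∀ m q, S (m + q) = S q + ∑ l ∈ Finset.range m, X (l + q) := by
    intro m q
    simp only [hS]
    rw [add_comm m q, Finset.sum_range_add]
    congr 1
    exact Finset.sum_congr rfl fun l _ => by rw [add_comm]
  have hSper : ∀ m, S (m + (n + 1)) = S m + S (n + 1) := by
    intro m
    rw [hSadd, add_comm]
    congr 1
    exact Finset.sum_congr rfl fun l _ => hXper l
  obtain ⟨r, hr, h⟩ := exists_rotation (n := n + 1) (k := k) (T := fun m => (S m : ℤ) - m)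
    (Nat.succ_pos n) hk fun m => by
      simp only [hSper]; push_cast at hSn ⊢; linarith
  refine ⟨⟨r, hr⟩, ?_⟩
  have hps : ∀ m ≤ n + 1, partialSum (fun l : Fin (n + 1) => x (l + ⟨r, hr⟩)) m + S r = S (m + r) := by
    intro m hm
    rw [hSadd, add_comm, partialSum]
    congr 1
    refine Finset.sum_congr rfl fun l hl => ?_
    have hl' : l < n + 1 := (Finset.mem_range.1 hl).trans_le hm
    rw [extend, dif_pos hl', hX]
    congr 1
  refine ⟨?_, fun m hm => ?_⟩
  · have h1 := hps (n + 1) le_rfl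
    rw [add_comm (n + 1) r, hSper] at h1
    have h2 : partialSum (fun l : Fin (n + 1) => x (l + ⟨r, hr⟩)) (n + 1) = S (n + 1) := by omega
    rw [h2]
    omega
  · have h1 := hps m hm.le
    have h2 := h m hm
    push_cast at h2
    omega

/-- One half of the cycle lemma: some rotation of each sequence with this sum is a first passage,
and rotations preserve the product law. The exact number of good rotations is not needed. -/
theorem sumProb_le_passageProb (ν : PMF ℕ) {n k : ℕ} (hk : 0 < k) :
    iidLaw ν (n + 1) (sumEq (n + 1) (((n + 1 : ℕ) : ℤ) - k))
      ≤ (n + 1 : ℕ) * passageProb ν (n + 1) k := by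
  have hrot : ∀ r : Fin (n + 1), iidLaw ν (n + 1)
      ((fun (x : Fin (n + 1) → ℕ) l => x (l + r)) ⁻¹' firstPassage (n + 1) k)
        = passageProb ν (n + 1) k := by
    intro r
    have h := measurePreserving_piCongrLeft (fun _ : Fin (n + 1) => ν.toMeasure)
      (Equiv.addRight r).symm
    have hfun : (MeasurableEquiv.piCongrLeft (fun _ => ℕ) (Equiv.addRight r).symm :
        (Fin (n + 1) → ℕ) → Fin (n + 1) → ℕ) = fun x l => x (l + r) := by
      funext x l
      rw [MeasurableEquiv.coe_piCongrLeft]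
      have := Equiv.piCongrLeft_apply_apply (fun _ : Fin (n + 1) => ℕ) (Equiv.addRight r).symm x
        (l + r)
      simpa using this
    unfold passageProb iidLaw
    have h' := h.measure_preimage
      (MeasurableSet.of_discrete (s := firstPassage (n + 1) k)).nullMeasurableSet
    rwa [hfun] at h'
  have hsub : sumEq (n + 1) (((n + 1 : ℕ) : ℤ) - k)
      ⊆ ⋃ r : Fin (n + 1), (fun (x : Fin (n + 1) → ℕ) l => x (l + r)) ⁻¹' firstPassage (n + 1) k := by
    intro x hx
    exact Set.mem_iUnion.2 (exists_rotation_mem_firstPassage hk hx)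
  refine (measure_mono hsub).trans ((measure_iUnion_le _).trans ?_)
  rw [tsum_fintype]
  simp only [hrot]
  simp

/-! ### The reduced offspring distribution -/

theorem PMF.tsum_bind_mul {α β : Type*} (p : PMF α) (g : α → PMF β) (F : β → ENNReal) :
    ∑' b, p.bind g b * F b = ∑' a, p a * ∑' b, g a b * F b := by
  simp only [PMF.bind_apply, ← ENNReal.tsum_mul_right, ← ENNReal.tsum_mul_left]
  rw [ENNReal.tsum_comm]
  simp only [mul_assoc]

theorem PMF.tsum_pure_mul {α : Type*} (a : α) (F : α → ENNReal) :
    ∑' b, PMF.pure a b * F b = F a := by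
  classical
  rw [tsum_eq_single a]
  · simp
  · intro b hb
    simp [PMF.pure_apply, hb]

/-- The law of the sum of `k` independent variables with law `ν`. -/
noncomputable def iidSum (ν : PMF ℕ) : ℕ → PMF ℕ
  | 0 => PMF.pure 0
  | k + 1 => ν.bind fun a => (iidSum ν k).bind fun b => PMF.pure (a + b)

theorem tsum_iidSum_zero (ν : PMF ℕ) (F : ℕ → ENNReal) : ∑' b, iidSum ν 0 b * F b = F 0 :=
  PMF.tsum_pure_mul 0 F

theorem tsum_iidSum_succ (ν : PMF ℕ) (k : ℕ) (F : ℕ → ENNReal) :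
    ∑' b, iidSum ν (k + 1) b * F b = ∑' a, ν a * ∑' b, iidSum ν k b * F (a + b) := by
  rw [iidSum, PMF.tsum_bind_mul]
  simp only [PMF.tsum_bind_mul, PMF.tsum_pure_mul]

/-- The law of the number of grandchildren of a vertex with offspring distribution `ν₁` whose
children have offspring distribution `ν₂`. -/
noncomputable def grandchildLaw (ν₁ ν₂ : PMF ℕ) : PMF ℕ := ν₁.bind (iidSum ν₂)

theorem tsum_grandchildLaw (ν₁ ν₂ : PMF ℕ) (F : ℕ → ENNReal) :
    ∑' b, grandchildLaw ν₁ ν₂ b * F b = ∑' a, ν₁ a * ∑' b, iidSum ν₂ a b * F b :=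
  PMF.tsum_bind_mul _ _ _

theorem tsum_iidSum_exp (ν : PMF ℕ) (θ : ℝ) (k : ℕ) :
    ∑' b : ℕ, iidSum ν k b * ENNReal.ofReal (Real.exp (θ * b))
      = (∑' a : ℕ, ν a * ENNReal.ofReal (Real.exp (θ * a))) ^ k := by
  induction k with
  | zero => rw [tsum_iidSum_zero ν fun b : ℕ => ENNReal.ofReal (Real.exp (θ * b))]; simp
  | succ k ih =>
    rw [tsum_iidSum_succ ν k fun b : ℕ => ENNReal.ofReal (Real.exp (θ * b)), pow_succ', ← ih,
      ← ENNReal.tsum_mul_right]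
    refine tsum_congr fun a => ?_
    rw [mul_assoc]
    congr 1
    rw [← ENNReal.tsum_mul_left]
    refine tsum_congr fun b => ?_
    rw [Nat.cast_add, mul_add, Real.exp_add, ENNReal.ofReal_mul (Real.exp_pos _).le]
    ring

/-- Laplace transforms compose: that of `ν₁` is evaluated at `τ = m₂ θ + C₂ θ²`, which bounds the
log-Laplace transform of `ν₂`. The choice of `θ₀` keeps `|τ| ≤ θ₁`. -/
theorem QuadraticMGF.grandchildLaw {ν₁ ν₂ : PMF ℕ} {m₁ m₂ C₁ C₂ θ₁ θ₂ : ℝ} (hm₂ : 0 ≤ m₂)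
    (hC₁ : 0 ≤ C₁) (hC₂ : 0 ≤ C₂) (hθ₁ : 0 < θ₁) (hθ₂ : 0 < θ₂)
    (h₁ : QuadraticMGF ν₁ m₁ C₁ θ₁) (h₂ : QuadraticMGF ν₂ m₂ C₂ θ₂) :
    ∃ C θ₀ : ℝ, 0 < θ₀ ∧ QuadraticMGF (grandchildLaw ν₁ ν₂) (m₁ * m₂) C θ₀ := by
  refine ⟨m₁ * C₂ + C₁ * (m₂ + C₂) ^ 2, min (min θ₂ 1) (θ₁ / (m₂ + C₂ + 1)), by positivity,
    fun θ hθ => ?_⟩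
  have hle2 : |θ| ≤ θ₂ := hθ.trans ((min_le_left _ _).trans (min_le_left _ _))
  have hle1 : |θ| ≤ 1 := hθ.trans ((min_le_left _ _).trans (min_le_right _ _))
  have hle3 : |θ| * (m₂ + C₂ + 1) ≤ θ₁ :=
    (le_div_iff₀ (by positivity)).1 (hθ.trans (min_le_right _ _))
  set τ := m₂ * θ + C₂ * θ ^ 2 with hτ
  have hτle : |τ| ≤ (m₂ + C₂) * |θ| := by
    refine (abs_add_le _ _).trans ?_
    rw [abs_mul, abs_mul, abs_of_nonneg hm₂, abs_of_nonneg hC₂, abs_pow]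
    have := mul_le_mul_of_nonneg_left (mul_le_of_le_one_right (abs_nonneg θ) hle1) hC₂
    nlinarith
  have hτ1 : |τ| ≤ θ₁ := by
    have := abs_nonneg θ
    nlinarith
  have hτ2 : τ ^ 2 ≤ (m₂ + C₂) ^ 2 * θ ^ 2 := by
    rw [← sq_abs, ← sq_abs θ, ← mul_pow]
    exact pow_le_pow_left₀ (abs_nonneg _) hτle 2
  rw [tsum_grandchildLaw ν₁ ν₂ fun b : ℕ => ENNReal.ofReal (Real.exp (θ * b))]
  simp only [tsum_iidSum_exp]
  calc ∑' a : ℕ, ν₁ a * (∑' a : ℕ, ν₂ a * ENNReal.ofReal (Real.exp (θ * a))) ^ a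
      ≤ ∑' a : ℕ, ν₁ a * ENNReal.ofReal (Real.exp (τ * a)) := by
        refine ENNReal.tsum_le_tsum fun a => mul_le_mul_right ?_ _
        refine (pow_le_pow_left₀ zero_le (h₂ θ hle2) a).trans (le_of_eq ?_)
        rw [← ENNReal.ofReal_pow (Real.exp_pos _).le, ← Real.exp_nat_mul, mul_comm]
    _ ≤ ENNReal.ofReal (Real.exp (m₁ * τ + C₁ * τ ^ 2)) := h₁ τ hτ1
    _ ≤ _ := by
        refine ENNReal.ofReal_le_ofReal (Real.exp_le_exp.2 ?_)
        have := mul_le_mul_of_nonneg_left hτ2 hC₁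
        rw [hτ] at this ⊢
        nlinarith

/-! ### The number of vertices of a given type in a tree -/

/-- The union of the subtrees rooted at the elements of `L`. -/
def descendants (L : List Word) (Y : Word → ℕ) : Set Word :=
  {w | ∃ u ∈ L, u <+: w ∧ ∀ (p : Word) (a : ℕ), u <+: p → p ++ [a] <+: w → a < Y p}

theorem descendants_congr {L L' : List Word} (h : ∀ u, u ∈ L ↔ u ∈ L') (Y : Word → ℕ) :
    descendants L Y = descendants L' Y := by
  ext w
  simp only [descendants, Set.mem_ofPred_eq, h]

theorem descendants_update {L : List Word} {u : Word} (h : ∀ v ∈ L, ¬ v <+: u) (Y : Word → ℕ)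
    (a : ℕ) : descendants L (Function.update Y u a) = descendants L Y := by
  ext w
  refine exists_congr fun v => and_congr_right fun hv => and_congr_right fun _ =>
    forall₄_congr fun p b hp _ => ?_
  rw [Function.update_of_ne]
  rintro rfl
  exact h v hv hp

theorem descendants_cons (u : Word) (L : List Word) (Y : Word → ℕ) :
    descendants (u :: L) Y = insert u (descendants (children u (Y u) ++ L) Y) := by
  ext w
  simp only [descendants, Set.mem_ofPred_eq, Set.mem_insert_iff, List.mem_cons, List.mem_append,
    mem_children]
  constructor
  · rintro ⟨v, rfl | hv, hvw, h⟩
    · obtain ⟨x, rfl⟩ := hvw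
      rcases x with _ | ⟨b, x⟩
      · exact Or.inl (List.append_nil v)
      · have hpre : v ++ [b] <+: v ++ b :: x := ⟨x, by simp⟩
        refine Or.inr ⟨v ++ [b], Or.inl ⟨b, h v b List.prefix_rfl hpre, rfl⟩, hpre, ?_⟩
        exact fun p a hp => h p a ((List.prefix_append v [b]).trans hp)
    · exact Or.inr ⟨v, Or.inr hv, hvw, h⟩
  · rintro (rfl | ⟨v, ⟨b, hb, rfl⟩ | hv, hvw, h⟩)
    · refine ⟨w, Or.inl rfl, List.prefix_rfl, fun p a hp h => ?_⟩
      have h1 := hp.length_le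
      have h2 := h.length_le
      simp at h2
      omega
    · refine ⟨u, Or.inl rfl, (List.prefix_append u [b]).trans hvw, fun p a hp hpw => ?_⟩
      by_cases hpu : p = u
      · subst hpu
        have h3 := List.prefix_of_prefix_length_le hpw hvw (by simp)
        have h4 := h3.eq_of_length (by simp)
        have h5 := List.append_cancel_left h4
        simp only [List.cons.injEq, and_true] at h5
        rwa [h5]
      · refine h p a ?_ hpw
        refine List.prefix_of_prefix_length_le hvw ((List.prefix_append p [a]).trans hpw) ?_
        have h6 : u.length < p.length := by
          rcases hp.length_le.lt_or_eq with h | h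
          · exact h
          · exact absurd (hp.eq_of_length h).symm hpu
        simpa using h6
    · exact ⟨v, Or.inr hv, hvw, h⟩

theorem not_child_isPrefix (u : Word) (b : ℕ) : ¬ u ++ [b] <+: u := by
  intro h
  have := h.length_le
  simp at this

/-- The words of the list are pairwise incomparable for the prefix order. -/
def Incomparable (L : List Word) : Prop := L.Pairwise fun u v => ¬ u <+: v ∧ ¬ v <+: u

theorem Incomparable.perm {L L' : List Word} (h : Incomparable L) (hp : L.Perm L') :
    Incomparable L' :=
  hp.pairwise h fun h => ⟨h.2, h.1⟩

theorem incomparable_children (u : Word) (n : ℕ) : Incomparable (children u n) := by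
  refine List.Pairwise.map _ (R := (· ≠ ·)) (fun a b hab => ?_) List.nodup_range
  have key : ∀ a b : ℕ, u ++ [a] <+: u ++ [b] → a = b := by
    intro a b h
    have h1 := List.append_cancel_left (h.eq_of_length (by simp))
    simpa using h1
  exact ⟨fun h => hab (key a b h), fun h => hab (key b a h).symm⟩

theorem Incomparable.children_append {u : Word} {L : List Word} (h : Incomparable (u :: L))
    (n : ℕ) : Incomparable (children u n ++ L) := by
  obtain ⟨h1, h2⟩ := List.pairwise_cons.1 h
  refine List.pairwise_append.2 ⟨incomparable_children u n, h2, fun v hv w hw => ?_⟩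
  obtain ⟨b, -, rfl⟩ := mem_children.1 hv
  refine ⟨fun h3 => (h1 w hw).1 ((List.prefix_append u [b]).trans h3), fun h3 => ?_⟩
  rcases List.prefix_concat_iff.1 h3 with h4 | h4
  · exact (h1 w hw).1 (h4 ▸ List.prefix_append u [b])
  · exact (h1 w hw).2 h4

theorem Incomparable.not_isPrefix {u : Word} {L : List Word} (h : Incomparable (u :: L)) (n : ℕ) :
    ∀ v ∈ children u n ++ L, ¬ v <+: u := by
  intro v hv
  rcases List.mem_append.1 hv with hv | hv
  · obtain ⟨b, -, rfl⟩ := mem_children.1 hv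
    exact not_child_isPrefix u b
  · exact ((List.pairwise_cons.1 h).1 v hv).2

/-- The number of vertices of type `c` in the subtrees rooted at the elements of `L`. -/
noncomputable def typeCount (e c : ZMod 2) (L : List Word) (Y : Word → ℕ) : ENat :=
  {w ∈ descendants L Y | wordType e w = c}.encard

theorem typeCount_cons {e c : ZMod 2} {u : Word} {L : List Word} (h : Incomparable (u :: L))
    (Y : Word → ℕ) : typeCount e c (u :: L) Y
      = typeCount e c (children u (Y u) ++ L) Y + if wordType e u = c then 1 else 0 := by
  have hu : u ∉ descendants (children u (Y u) ++ L) Y := by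
    rintro ⟨v, hv, hvu, -⟩
    exact h.not_isPrefix _ v hv hvu
  unfold typeCount
  rw [descendants_cons]
  split_ifs with hc
  · have : {w ∈ insert u (descendants (children u (Y u) ++ L) Y) | wordType e w = c}
        = insert u {w ∈ descendants (children u (Y u) ++ L) Y | wordType e w = c} := by
      ext w
      constructor
      · rintro ⟨rfl | hw, ht⟩
        · exact Or.inl rfl
        · exact Or.inr ⟨hw, ht⟩
      · rintro (rfl | hw)
        · exact ⟨Or.inl rfl, hc⟩
        · exact ⟨Or.inr hw.1, hw.2⟩
    rw [this, Set.encard_insert_of_notMem fun hmem => hu hmem.1]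
  · rw [add_zero]
    congr 1
    ext w
    constructor
    · rintro ⟨rfl | hw, ht⟩
      · exact absurd ht hc
      · exact ⟨hw, ht⟩
    · exact fun hw => ⟨Or.inr hw.1, hw.2⟩

theorem measurableSet_typeCount_eq (e c : ZMod 2) (L : List Word) (n : ℕ) :
    MeasurableSet {Y | typeCount e c L Y = n} := by
  have hdesc : ∀ w, Measurable fun Y : Word → ℕ => w ∈ descendants L Y := by
    intro w
    refine Measurable.exists fun u => measurable_const.and (measurable_const.and
      (Measurable.forall fun p => Measurable.forall fun a =>
        Measurable.imp measurable_const (Measurable.imp measurable_const ?_)))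
    exact (measurable_of_countable fun m : ℕ => a < m).comp (measurable_pi_apply p)
  have : {Y | typeCount e c L Y = n} = {Y | ∃ S : Finset Word, S.card = n ∧
      ∀ v, v ∈ S ↔ (v ∈ descendants L Y ∧ wordType e v = c)} := by
    ext Y
    exact encard_eq_natCast_iff
  rw [this]
  exact measurableSet_setOfPred.2 (Measurable.exists fun S => measurable_const.and
    (Measurable.forall fun v => measurable_const.iff ((hdesc v).and measurable_const)))

/-- The probability that the subtrees rooted at `L` have `n` vertices of type `c`. -/
noncomputable def countProb (μ : ZMod 2 → PMF ℕ) (e c : ZMod 2) (n : ℕ) (L : List Word) :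
    ENNReal :=
  wordLaw μ e {Y | typeCount e c L Y = n}

theorem countProb_congr (μ : ZMod 2 → PMF ℕ) (e c : ZMod 2) (n : ℕ) {L L' : List Word}
    (h : ∀ u, u ∈ L ↔ u ∈ L') : countProb μ e c n L = countProb μ e c n L' := by
  unfold countProb typeCount
  simp only [descendants_congr h]

/-- Revealing the offspring of `u` replaces `u` by its children in the list. By incomparability the
remaining subtrees do not involve `Y u`. The hypothesis `hn` covers both types of `u`, according to
whether `u` itself is counted. -/
theorem countProb_resample (μ : ZMod 2 → PMF ℕ) {e c : ZMod 2} {u : Word} {L : List Word}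
    (h : Incomparable (u :: L)) {n n' : ℕ}
    (hn : ∀ x : ENat, x + (if wordType e u = c then 1 else 0) = n ↔ x = n') :
    countProb μ e c n (u :: L)
      = ∑' a, μ (wordType e u) a * countProb μ e c n' (children u a ++ L) := by
  have hm := measurableSet_typeCount_eq e c (u :: L) n
  have hm' := fun a => measurableSet_typeCount_eq e c (children u a ++ L) n'
  unfold countProb
  conv_lhs => rw [← lintegral_indicator_one hm]
  unfold wordLaw
  rw [lintegral_infinitePi_update _ u (measurable_one.indicator hm)]
  have hstep : ∀ (Y : Word → ℕ) (a : ℕ),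
      {Y | typeCount e c (u :: L) Y = n}.indicator (1 : (Word → ℕ) → ENNReal)
        (Function.update Y u a)
      = {Y | typeCount e c (children u a ++ L) Y = n'}.indicator 1 Y := by
    intro Y a
    have hiff : typeCount e c (u :: L) (Function.update Y u a) = n
        ↔ typeCount e c (children u a ++ L) Y = n' := by
      rw [typeCount_cons h, hn, Function.update_self]
      unfold typeCount
      rw [descendants_update (h.not_isPrefix a)]
    simp only [Set.indicator_apply, Set.mem_ofPred_eq, hiff]
    rfl
  simp only [hstep, lintegral_toMeasure]
  rw [lintegral_tsum fun a =>
    ((measurable_one.indicator (hm' a)).const_mul _).aemeasurable]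
  refine tsum_congr fun a => ?_
  rw [lintegral_const_mul _ (measurable_one.indicator (hm' a)), lintegral_indicator_one (hm' a)]

theorem countProb_cons_of_ne (μ : ZMod 2 → PMF ℕ) {e c : ZMod 2} {u : Word} {L : List Word}
    (h : Incomparable (u :: L)) (hu : wordType e u ≠ c) (n : ℕ) :
    countProb μ e c n (u :: L)
      = ∑' a, μ (wordType e u) a * countProb μ e c n (children u a ++ L) :=
  countProb_resample μ h fun x => by simp [hu]

theorem countProb_succ_cons (μ : ZMod 2 → PMF ℕ) {e c : ZMod 2} {u : Word} {L : List Word}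
    (h : Incomparable (u :: L)) (hu : wordType e u = c) (n : ℕ) :
    countProb μ e c (n + 1) (u :: L)
      = ∑' a, μ c a * countProb μ e c n (children u a ++ L) := by
  rw [countProb_resample μ h (n' := n) fun x => ?_, hu]
  rw [if_pos hu, Nat.cast_add, Nat.cast_one]
  exact (ENat.add_left_injective_of_ne_top ENat.one_ne_top).eq_iff

theorem countProb_zero_cons (μ : ZMod 2 → PMF ℕ) {e c : ZMod 2} {u : Word} {L : List Word}
    (h : Incomparable (u :: L)) (hu : wordType e u = c) :
    countProb μ e c 0 (u :: L) = 0 := by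
  have : {Y | typeCount e c (u :: L) Y = (0 : ℕ)} = ∅ := by
    ext Y
    simp [typeCount_cons h, hu]
  rw [countProb, this, measure_empty]

theorem countProb_nil (μ : ZMod 2 → PMF ℕ) (e c : ZMod 2) (n : ℕ) :
    countProb μ e c n [] = if n = 0 then 1 else 0 := by
  have h0 : ∀ Y, typeCount e c [] Y = 0 := by
    intro Y
    simp [typeCount, descendants]
  unfold countProb
  simp only [h0]
  rcases n with _ | n
  · simp
  · have : (0 : ENat) ≠ ((n + 1 : ℕ) : ENat) := by exact_mod_cast (Nat.succ_ne_zero n).symm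
    rw [if_neg (Nat.succ_ne_zero n)]
    exact measure_mono_null (t := ∅) (fun Y hY => absurd hY this) measure_empty

/-- Vertices of type `c + 1` are not counted, so each is replaced by its children, of type `c`, at
the same `n`. These children are moved behind the rest of `C` for the induction. -/
theorem countProb_append (μ : ZMod 2 → PMF ℕ) {e c : ZMod 2} {n : ℕ} {F : ℕ → ENNReal}
    (hF : ∀ L : List Word, Incomparable L → (∀ u ∈ L, wordType e u = c) →
      countProb μ e c n L = F L.length) (C L : List Word) (h : Incomparable (C ++ L))
    (hC : ∀ u ∈ C, wordType e u = c + 1) (hL : ∀ u ∈ L, wordType e u = c) :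
    countProb μ e c n (C ++ L) = ∑' b, iidSum (μ (c + 1)) C.length b * F (L.length + b) := by
  induction C generalizing L with
  | nil =>
    rw [List.length_nil, tsum_iidSum_zero _ fun b => F (L.length + b)]
    exact hF L h hL
  | cons v C ih =>
    have hv : wordType e v = c + 1 := hC v (by simp)
    rw [List.cons_append] at h ⊢
    rw [countProb_cons_of_ne μ h (by rw [hv]; exact ZMod.two_add_one_ne c), hv, List.length_cons,
      tsum_iidSum_succ _ _ fun b => F (L.length + b)]
    refine tsum_congr fun a => ?_
    congr 1
    have hperm : (children v a ++ (C ++ L)).Perm (C ++ (children v a ++ L)) := by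
      rw [← List.append_assoc, ← List.append_assoc]
      exact List.perm_append_comm.append_right L
    rw [countProb_congr μ e c n fun u => hperm.mem_iff,
      ih (children v a ++ L) ((h.children_append a).perm hperm)
        (fun u hu => hC u (List.mem_cons_of_mem _ hu)) ?_]
    · refine tsum_congr fun b => ?_
      rw [List.length_append, children, List.length_map, List.length_range]
      congr 2
      omega
    · intro u hu
      rcases List.mem_append.1 hu with hu | hu
      · obtain ⟨b, -, rfl⟩ := mem_children.1 hu
        rw [wordType_child, hv, ZMod.two_add_one_add_one]
      · exact hL u hu

/-- Revealing a vertex of type `c` and then all its children uses one unit of `n` and replaces the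
vertex by its grandchildren: a step of the walk with offspring law `grandchildLaw`. -/
theorem countProb_eq_passageProb (μ : ZMod 2 → PMF ℕ) (e c : ZMod 2) (n : ℕ) (L : List Word)
    (h : Incomparable L) (hL : ∀ u ∈ L, wordType e u = c) :
    countProb μ e c n L = passageProb (grandchildLaw (μ c) (μ (c + 1))) n L.length := by
  induction n generalizing L with
  | zero =>
    rcases L with _ | ⟨u, L⟩
    · rw [countProb_nil, List.length_nil, passageProb_zero_zero, if_pos rfl]
    · rw [countProb_zero_cons μ h (hL u (by simp)), List.length_cons, passageProb_zero_succ]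
  | succ n ih =>
    rcases L with _ | ⟨u, L⟩
    · rw [countProb_nil, List.length_nil, passageProb_succ_zero, if_neg (Nat.succ_ne_zero n)]
    · have hu := hL u (by simp)
      rw [countProb_succ_cons μ h hu, List.length_cons, passageProb_succ_succ,
        tsum_grandchildLaw _ _ fun a => passageProb _ n (L.length + a)]
      refine tsum_congr fun a => ?_
      congr 1
      rw [countProb_append μ ih (children u a) L (h.children_append a) ?_
        fun v hv => hL v (List.mem_cons_of_mem _ hv), children, List.length_map, List.length_range]
      intro v hv
      obtain ⟨b, -, rfl⟩ := mem_children.1 hv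
      rw [wordType_child, hu]

theorem gwTree_encard_eq (μ : ZMod 2 → PMF ℕ) (i c : ZMod 2) (n : ℕ) :
    gwTree μ i {t | (treeType i c t).encard = n} = countProb μ i c n [[]] := by
  rw [gwTree_eq_map, Measure.map_apply measurable_treeOf (measurableSet_encard_treeType_eq i c n)]
  have hdesc : ∀ Y, descendants [[]] Y = treeOf Y := by
    intro Y
    ext w
    simp [descendants, treeOf]
  unfold countProb typeCount
  simp only [hdesc]
  rfl

theorem gwTree_encard_eq_of_eq (μ : ZMod 2 → PMF ℕ) (c : ZMod 2) (n : ℕ) :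
    gwTree μ c {t | (treeType c c t).encard = n}
      = passageProb (grandchildLaw (μ c) (μ (c + 1))) n 1 := by
  rw [gwTree_encard_eq, countProb_eq_passageProb μ c c n [[]] (List.pairwise_singleton _ _)
    (by simp [wordType])]
  rfl

theorem gwTree_encard_eq_of_ne (μ : ZMod 2 → PMF ℕ) (c : ZMod 2) (n : ℕ) :
    gwTree μ (c + 1) {t | (treeType (c + 1) c t).encard = n}
      = ∑' b, μ (c + 1) b * passageProb (grandchildLaw (μ c) (μ (c + 1))) n b := by
  rw [gwTree_encard_eq]
  have h := countProb_append μ (countProb_eq_passageProb μ (c + 1) c n) [[]] []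
    (List.pairwise_singleton _ _) (by simp [wordType]) (by simp)
  rw [List.append_nil] at h
  rw [h, List.length_singleton, tsum_iidSum_succ _ _ fun b => passageProb _ n (([] : List Word).length + b)]
  refine tsum_congr fun a => ?_
  rw [tsum_iidSum_zero _ fun b => passageProb _ n (([] : List Word).length + (a + b))]
  simp

/-! ### A lower bound for the probability that a tree has a given number of vertices -/

theorem sumProb_ne_zero_of_passageProb_ne_zero {ν : PMF ℕ} {n k : ℕ} (h : passageProb ν n k ≠ 0) :
    sumProb ν n ((n : ℤ) - k) ≠ 0 := by
  intro h0
  rw [sumProb, measureReal_eq_zero_iff] at h0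
  exact h (measure_mono_null (firstPassage_subset n k) h0)

/-- The factor `n` lost in the cycle lemma and the constant `q` are absorbed by passing from
exponent `ρ / 2` to `ρ`. -/
theorem eventually_le_mul_passageProb {ν : PMF ℕ} {C θ₀ : ℝ} (hθ₀ : 0 < θ₀)
    (hν : QuadraticMGF ν 1 C θ₀) {a : ℕ} (ha : ν a ≠ 0) {ρ : ℝ} (hρ : 0 < ρ) {b : ℕ} (hb : 0 < b)
    {q : ENNReal} (hq : q ≠ 0) :
    ∀ᶠ n : ℕ in atTop, (n : ℤ) - b - n * a ∈ supportSpan ν →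
      ENNReal.ofReal (Real.exp (-(n : ℝ) ^ ρ)) ≤ q * passageProb ν n b := by
  set q' : ℝ := (min q 1).toReal with hq'
  have hmin : min q 1 ≠ ⊤ := ne_top_of_le_ne_top ENNReal.one_ne_top (min_le_right _ _)
  have hq'0 : 0 < q' := ENNReal.toReal_pos (by simp [hq]) hmin
  filter_upwards [eventually_exp_neg_rpow_le_sumProb hθ₀ hν ha (half_pos hρ) b,
    eventually_const_mul_le_exp_rpow q'⁻¹ (half_pos hρ),
    eventually_const_mul_rpow_le 2 (half_lt_self hρ), eventually_ge_atTop 1] with n h1 h2 h3 h4 hspan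
  obtain ⟨n', rfl⟩ : ∃ n', n = n' + 1 := ⟨n - 1, by omega⟩
  have hp := h1 (((n' + 1 : ℕ) : ℤ) - b) (by push_cast; simp) hspan
  set n := n' + 1
  have hn0 : (0 : ℝ) < n := by positivity
  have hP : ENNReal.ofReal (sumProb ν n ((n : ℤ) - b)) ≤ (n : ENNReal) * passageProb ν n b := by
    rw [sumProb, ofReal_measureReal]
    exact sumProb_le_passageProb ν hb
  have hreal : n * Real.exp (-(n : ℝ) ^ ρ) ≤ q' * sumProb ν n ((n : ℤ) - b) := by
    set w := (n : ℝ) ^ (ρ / 2)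
    have e1 : (n : ℝ) ≤ q' * Real.exp w := by rwa [inv_mul_le_iff₀ hq'0] at h2
    calc n * Real.exp (-(n : ℝ) ^ ρ) ≤ q' * Real.exp w * Real.exp (-(2 * w)) :=
          mul_le_mul e1 (Real.exp_le_exp.2 (neg_le_neg h3)) (Real.exp_pos _).le (by positivity)
      _ = q' * Real.exp (-w) := by rw [mul_assoc, ← Real.exp_add]; ring_nf
      _ ≤ _ := mul_le_mul_of_nonneg_left hp hq'0.le
  have hE : (n : ENNReal) * ENNReal.ofReal (Real.exp (-(n : ℝ) ^ ρ))
      ≤ (n : ENNReal) * (q * passageProb ν n b) := by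
    calc (n : ENNReal) * ENNReal.ofReal (Real.exp (-(n : ℝ) ^ ρ))
        = ENNReal.ofReal (n * Real.exp (-(n : ℝ) ^ ρ)) := by
          rw [ENNReal.ofReal_mul hn0.le, ENNReal.ofReal_natCast]
      _ ≤ ENNReal.ofReal (q' * sumProb ν n ((n : ℤ) - b)) := ENNReal.ofReal_le_ofReal hreal
      _ = min q 1 * ENNReal.ofReal (sumProb ν n ((n : ℤ) - b)) := by
          rw [ENNReal.ofReal_mul hq'0.le, hq', ENNReal.ofReal_toReal hmin]
      _ ≤ q * ((n : ENNReal) * passageProb ν n b) := mul_le_mul' (min_le_left _ _) hP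
      _ = _ := by ring
  exact (ENNReal.mul_le_mul_iff_right (by simp [n]) (ENNReal.natCast_ne_top n)).1 hE

/-- Modulo a nonzero integer, a set of natural numbers is represented by a finite subset. -/
theorem exists_finset_representatives (Q : Set ℕ) {d : ℤ} (hd : d ≠ 0) :
    ∃ S : Finset ℕ, (∀ b ∈ S, b ∈ Q) ∧ ∀ b ∈ Q, ∃ b' ∈ S, (b : ℤ) - b' ∈ AddSubgroup.zmultiples d := by
  have : NeZero d.natAbs := ⟨Int.natAbs_ne_zero.2 hd⟩
  set f : ℕ → ZMod d.natAbs := fun b => (b : ZMod d.natAbs)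
  have hfin : (f '' Q).Finite := Set.toFinite _
  obtain ⟨S, hSQ, hS⟩ := Set.exists_subset_bijOn Q f
  have hSfin : S.Finite := Set.Finite.of_finite_image (hS.image_eq ▸ hfin) hS.injOn
  refine ⟨hSfin.toFinset, fun b hb => hSQ (hSfin.mem_toFinset.1 hb), fun b hb => ?_⟩
  obtain ⟨b', hb', h⟩ := hS.surjOn (Set.mem_image_of_mem f hb)
  refine ⟨b', hSfin.mem_toFinset.2 hb', ?_⟩
  rw [Int.mem_zmultiples_iff, ← Int.natAbs_dvd, ← ZMod.intCast_zmod_eq_zero_iff_dvd]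
  push_cast
  exact sub_eq_zero.2 h.symm

theorem eventually_gwTree_encard_ge {μ : ZMod 2 → PMF ℕ} (hcrit : Critical μ)
    (hexp : ∀ i, HasExpMoment (μ i)) {ρ : ℝ} (hρ : 0 < ρ) (i c : ZMod 2) :
    ∀ᶠ n : ℕ in atTop,
      gwTree μ i {t | (treeType i c t).encard = n} = 0 ∨
      ENNReal.ofReal (Real.exp (-(n : ℝ) ^ ρ))
        ≤ gwTree μ i {t | (treeType i c t).encard = n} := by
  obtain ⟨C₁, θ₁, hC₁, hθ₁, h₁⟩ := (hexp c).exists_quadraticMGF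
  obtain ⟨C₂, θ₂, hC₂, hθ₂, h₂⟩ := (hexp (c + 1)).exists_quadraticMGF
  obtain ⟨C, θ₀, hθ₀, hν⟩ := h₁.grandchildLaw (mean_nonneg _) hC₁ hC₂ hθ₁ hθ₂ h₂
  have hmean : mean (μ c) * mean (μ (c + 1)) = 1 := by
    rcases ZMod.two_eq_zero_or_one c with rfl | rfl
    · exact hcrit
    · rw [mul_comm]; exact hcrit
  rw [hmean] at hν
  set ν := grandchildLaw (μ c) (μ (c + 1)) with hνdef
  obtain ⟨a, ha⟩ := ν.support_nonempty
  rw [PMF.mem_support_iff] at ha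
  rcases ZMod.two_eq_or_eq_add_one i c with rfl | rfl
  · filter_upwards [eventually_le_mul_passageProb hθ₀ hν ha hρ one_pos one_ne_zero] with n hn
    rw [gwTree_encard_eq_of_eq, ← hνdef]
    by_cases h0 : passageProb ν n 1 = 0
    · exact Or.inl h0
    · right
      rw [one_mul] at hn
      exact hn (sub_mem_supportSpan ha (sumProb_ne_zero_of_passageProb_ne_zero h0))
  -- With a root of the other type, a positive probability yields a number `b` of children of the
  -- root, in the right residue class, from which the walk can be absorbed at time `n`. It is
  -- positive, since `n` vertices of type `c` need at least one child.
  · have hpos : ∀ n : ℕ, 1 ≤ n → gwTree μ (c + 1) {t | (treeType (c + 1) c t).encard = n} ≠ 0 →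
        ∃ b, 0 < b ∧ μ (c + 1) b ≠ 0 ∧ (n : ℤ) - b - n * a ∈ supportSpan ν := by
      intro n hn h
      rw [gwTree_encard_eq_of_ne, ← hνdef, Ne, ENNReal.tsum_eq_zero, not_forall] at h
      obtain ⟨b, hb⟩ := h
      obtain ⟨hb1, hb2⟩ := mul_ne_zero_iff.1 hb
      refine ⟨b, Nat.pos_of_ne_zero ?_, hb1,
        sub_mem_supportSpan ha (sumProb_ne_zero_of_passageProb_ne_zero hb2)⟩
      rintro rfl
      obtain ⟨n', rfl⟩ : ∃ n', n = n' + 1 := ⟨n - 1, by omega⟩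
      exact hb2 (passageProb_succ_zero ν n')
    obtain ⟨d, hd⟩ := exists_supportSpan_eq ν
    -- If `d = 0`, the sum is almost surely `n * a`. A passage from `b > 0` would force `a = 0`,
    -- against the concentration of the sum near `n`.
    by_cases hd0 : d = 0
    · filter_upwards [eventually_exists_sumProb_ge hθ₀ hν (β := 3 / 4) (by norm_num) (by norm_num),
        eventually_const_mul_rpow_le 2 (show (3 / 4 : ℝ) < 1 by norm_num), eventually_ge_atTop 1]
        with n ⟨y, hy, hyp⟩ hβ hn1
      left
      by_contra hne
      obtain ⟨b, hb, -, hspan⟩ := hpos n hn1 hne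
      have hn0 : (0 : ℝ) < n := by exact_mod_cast hn1
      have hy' : y - n * a ∈ supportSpan ν :=
        sub_mem_supportSpan ha (lt_of_lt_of_le (by positivity) hyp).ne'
      rw [hd, hd0, AddSubgroup.zmultiples_zero_eq_bot, AddSubgroup.mem_bot] at hspan hy'
      have hy1 : y = n * a := by linarith
      rw [Real.rpow_one] at hβ
      rw [hy1] at hy
      push_cast at hy
      have ha0 : a = 0 := by
        by_contra hne
        have h1 : (1 : ℤ) ≤ a := by exact_mod_cast Nat.one_le_iff_ne_zero.2 hne
        have h2 : (1 : ℤ) ≤ b := by exact_mod_cast hb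
        have h3 : (0 : ℤ) ≤ n := Int.natCast_nonneg n
        nlinarith
      rw [ha0] at hy
      simp only [Nat.cast_zero, mul_zero, zero_sub, abs_neg, Nat.abs_cast] at hy
      linarith
    -- The law of `b` may have infinite support, so the threshold in `n` is made uniform by keeping
    -- one representative per residue class modulo `d`.
    · obtain ⟨S, hSQ, hS⟩ := exists_finset_representatives {b | 0 < b ∧ μ (c + 1) b ≠ 0} hd0
      have hev : ∀ᶠ n : ℕ in atTop, ∀ b ∈ S, (n : ℤ) - b - n * a ∈ supportSpan ν →
          ENNReal.ofReal (Real.exp (-(n : ℝ) ^ ρ)) ≤ μ (c + 1) b * passageProb ν n b :=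
        (Filter.eventually_all_finset S).2 fun b hb =>
          eventually_le_mul_passageProb hθ₀ hν ha hρ (hSQ b hb).1 (hSQ b hb).2
      filter_upwards [hev, eventually_ge_atTop 1] with n hn hn1
      by_cases h0 : gwTree μ (c + 1) {t | (treeType (c + 1) c t).encard = n} = 0
      · exact Or.inl h0
      · right
        obtain ⟨b, hb1, hb2, hspan⟩ := hpos n hn1 h0
        obtain ⟨b', hb', hbb'⟩ := hS b ⟨hb1, hb2⟩
        have hspan' : (n : ℤ) - b' - n * a ∈ supportSpan ν := by
          have := add_mem hspan (show (b : ℤ) - b' ∈ supportSpan ν by rw [hd]; exact hbb')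
          rwa [show (n : ℤ) - b - n * a + (b - b') = n - b' - n * a by ring] at this
        refine (hn b' hb' hspan').trans ?_
        rw [gwTree_encard_eq_of_ne]
        exact ENNReal.le_tsum (f := fun b => μ (c + 1) b * passageProb ν n b) b'

end TwoTypeGW

theorem lemma15 (μ : ZMod 2 → PMF ℕ) (hnd : TwoTypeGW.Nondegenerate μ)
    (hcrit : TwoTypeGW.Critical μ) (hexp : ∀ i : ZMod 2, TwoTypeGW.HasExpMoment (μ i))
    (γ : ℝ) (hγ : 0 < γ) :
    ∃ ε : ℝ, 0 < ε ∧ ∀ i j : ZMod 2,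
      (∀ᶠ n : ℕ in atTop,
        TwoTypeGW.gwForest μ i
          {f | (n : ℝ) ^ (1 / 2 + γ) < ⨆ k : Fin (n + 1),
            |(TwoTypeGW.forestG i j f k : ℝ) - (1 + TwoTypeGW.mean (μ j)) * (k : ℕ)|}
          ≤ ENNReal.ofReal (Real.exp (-(n : ℝ) ^ ε))) ∧
      ∀ c : ZMod 2, ∀ᶠ n : ℕ in atTop,
        ProbabilityTheory.cond (TwoTypeGW.gwTree μ i)
          {t | (TwoTypeGW.treeType i c t).encard = n}
          {t | (n : ℝ) ^ (1 / 2 + γ) < ⨆ k : Fin ((TwoTypeGW.treeType i j t).ncard + 1),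
            |(TwoTypeGW.treeG i j t k : ℝ) - (1 + TwoTypeGW.mean (μ j)) * (k : ℕ)|}
          ≤ ENNReal.ofReal (Real.exp (-(n : ℝ) ^ ε)) := by
  exact TwoTypeGW.deviation_of_lower_bound hcrit hexp hγ
    fun ρ hρ i c => TwoTypeGW.eventually_gwTree_encard_ge hcrit hexp hρ i c
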